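/- Let $R$ and $B$ be disjoint finite sets of red and blue points in the plane such that $S=R\cup B$ is in convex position, given by its points (coordinates and colors) in clockwise circular order. An alternating path or cycle on $S$ is a path or cycle whose vertices are points of $S$ and whose edges are straight-line segments joining points of different colors; it is Hamiltonian if it visits every point of $S$ exactly once. Two edges cross if their relative interiors intersect, the number of crossings is the number of pairs of crossing edges, and a path or cycle is $1$-plane if each of its edges is crossed by at most one other of its edges. A Hamiltonian alternating cycle is optimum if it has the minimum number of crossings among all Hamiltonian alternating cycles on $S$; a Hamiltonian alternating path is optimum if it has the minimum number of crossings among all Hamiltonian alternating paths on $S$ with the same endpoints. Then the following statements hold. (i) If $|R|=|B|=n\ge 2$, an optimum Hamiltonian alternating cycle on $S$ can be computed in $O(n)$ time and space. (ii) If $|R|=|B|=n\ge 2$ and $r\in R$, $b\in B$ are consecutive points of $S$ (in the circular order), an optimum Hamiltonian alternating path on $S$ with endpoints $r$ and $b$ can be computed in $O(n)$ time and space. (iii) If $|R|=|B|+1=n+1\ge 2$ and $r,r'\in R$ are two consecutive points of $S$, an optimum Hamiltonian alternating path on $S$ with endpoints $r$ and $r'$ can be computed in $O(n)$ time and space. Moreover,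 in all three cases, every optimum is $1$-plane. The model of computation is the real RAM with unit costs, whose integer registers and cells hold words of $O(\log n)$ bits. -/

import Mathlib

/-! ## The machine: a structured real RAM with unit costs

There are finitely many integer and real registers in a program, and finitely many integer and
real arrays. Every elementary instruction and every test costs one time unit. A machine of size `M`
owns the cells `0, …, M - 1` of each array, and an integer cell or register can only be assigned a
value that is at most `M` (so integers are words of `log₂ M + O(1)` bits, and there is no way to
pack long data into one of them). An instruction that violates these limits cannot be executed. -/

namespace RealRAM

/-- The contents of the integer registers, integer arrays, real registers and real arrays. -/
structure State where
  ivar : ℕ → ℕ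
  iarr : ℕ → ℕ → ℕ
  rvar : ℕ → ℝ
  rarr : ℕ → ℕ → ℝ

/-- An integer operand: a constant or a register. -/
inductive Operand where
  | lit (k : ℕ)
  | var (x : ℕ)

def Operand.eval (s : State) : Operand → ℕ
  | .lit k => k
  | .var x => s.ivar x

/-- Elementary instructions. The first argument of `set`, `add`, `sub`, `load`, … is the register
that receives the result; `load x A a` is `x := A[a]` and `store A a b` is `A[a] := b`. -/
inductive Instr where
  | set (x : ℕ) (a : Operand)
  | add (x : ℕ) (a b : Operand)
  | sub (x : ℕ) (a b : Operand)
  | load (x : ℕ) (A : ℕ) (a : Operand)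
  | store (A : ℕ) (a b : Operand)
  | rset (x : ℕ) (q : ℚ)
  | radd (x y z : ℕ)
  | rsub (x y z : ℕ)
  | rmul (x y z : ℕ)
  | rdiv (x y z : ℕ)
  | rload (x : ℕ) (A : ℕ) (a : Operand)
  | rstore (A : ℕ) (a : Operand) (x : ℕ)

/-- Assignment to an integer register. -/
def State.setVar (s : State) (x v : ℕ) : State :=
  { s with ivar := Function.update s.ivar x v }

/-- Assignment to a cell of an integer array. -/
def State.setCell (s : State) (A i v : ℕ) : State :=
  { s with iarr := Function.update s.iarr A (Function.update (s.iarr A) i v) }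

/-- Assignment to a real register. -/
noncomputable def State.setRVar (s : State) (x : ℕ) (v : ℝ) : State :=
  { s with rvar := Function.update s.rvar x v }

/-- Assignment to a cell of a real array. -/
noncomputable def State.setRCell (s : State) (A i : ℕ) (v : ℝ) : State :=
  { s with rarr := Function.update s.rarr A (Function.update (s.rarr A) i v) }

/-- `Step M c s s'`: on a machine of size `M` the instruction `c` leads from `s` to `s'`.
Integer subtraction is truncated at zero. -/
inductive Step (M : ℕ) : Instr → State → State → Prop where
  | set (s : State) (x : ℕ) (a : Operand) :
      a.eval s ≤ M → Step M (.set x a) s (s.setVar x (a.eval s))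
  | add (s : State) (x : ℕ) (a b : Operand) :
      a.eval s + b.eval s ≤ M → Step M (.add x a b) s (s.setVar x (a.eval s + b.eval s))
  | sub (s : State) (x : ℕ) (a b : Operand) :
      a.eval s - b.eval s ≤ M → Step M (.sub x a b) s (s.setVar x (a.eval s - b.eval s))
  | load (s : State) (x A : ℕ) (a : Operand) :
      a.eval s < M → s.iarr A (a.eval s) ≤ M →
        Step M (.load x A a) s (s.setVar x (s.iarr A (a.eval s)))
  | store (s : State) (A : ℕ) (a b : Operand) :
      a.eval s < M → b.eval s ≤ M → Step M (.store A a b) s (s.setCell A (a.eval s) (b.eval s))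
  | rset (s : State) (x : ℕ) (q : ℚ) : Step M (.rset x q) s (s.setRVar x q)
  | radd (s : State) (x y z : ℕ) :
      Step M (.radd x y z) s (s.setRVar x (s.rvar y + s.rvar z))
  | rsub (s : State) (x y z : ℕ) :
      Step M (.rsub x y z) s (s.setRVar x (s.rvar y - s.rvar z))
  | rmul (s : State) (x y z : ℕ) :
      Step M (.rmul x y z) s (s.setRVar x (s.rvar y * s.rvar z))
  | rdiv (s : State) (x y z : ℕ) :
      s.rvar z ≠ 0 → Step M (.rdiv x y z) s (s.setRVar x (s.rvar y / s.rvar z))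
  | rload (s : State) (x A : ℕ) (a : Operand) :
      a.eval s < M → Step M (.rload x A a) s (s.setRVar x (s.rarr A (a.eval s)))
  | rstore (s : State) (A : ℕ) (a : Operand) (x : ℕ) :
      a.eval s < M → Step M (.rstore A a x) s (s.setRCell A (a.eval s) (s.rvar x))

/-- Tests: comparison of two integer operands, or of two real registers. -/
inductive Cond where
  | lt (a b : Operand)
  | eq (a b : Operand)
  | rlt (x y : ℕ)

def Cond.Holds (s : State) : Cond → Prop
  | .lt a b => a.eval s < b.eval s
  | .eq a b => a.eval s = b.eval s
  | .rlt x y => s.rvar x < s.rvar y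

/-- Programs. -/
inductive Program where
  | skip
  | instr (c : Instr)
  | seq (P Q : Program)
  | ite (b : Cond) (P Q : Program)
  | loop (b : Cond) (P : Program)

/-- `Exec M P s s' t`: on a machine of size `M` the program `P`, started in the state `s`,
halts in the state `s'` after exactly `t` time units. `loop b P` is "while `b` do `P`". -/
inductive Exec (M : ℕ) : Program → State → State → ℕ → Prop where
  | skip (s : State) : Exec M .skip s s 1
  | instr {c : Instr} {s s' : State} : Step M c s s' → Exec M (.instr c) s s' 1
  | seq {P Q : Program} {s s' s'' : State} {t u : ℕ} :
      Exec M P s s' t → Exec M Q s' s'' u → Exec M (.seq P Q) s s'' (t + u)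
  | ite_true {b : Cond} {P Q : Program} {s s' : State} {t : ℕ} :
      b.Holds s → Exec M P s s' t → Exec M (.ite b P Q) s s' (t + 1)
  | ite_false {b : Cond} {P Q : Program} {s s' : State} {t : ℕ} :
      ¬ b.Holds s → Exec M Q s s' t → Exec M (.ite b P Q) s s' (t + 1)
  | loop_true {b : Cond} {P : Program} {s s' s'' : State} {t u : ℕ} :
      b.Holds s → Exec M P s s' t → Exec M (.loop b P) s' s'' u →
        Exec M (.loop b P) s s'' (t + u + 1)
  | loop_false {b : Cond} {P : Program} {s : State} :
      ¬ b.Holds s → Exec M (.loop b P) s s 1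

/-- On a machine of size `M`, started in the state `s`, the program `P` halts after at most `T`
time units, in a state with the property `Q`. -/
def Program.Achieves (P : Program) (M T : ℕ) (s : State) (Q : State → Prop) : Prop :=
  ∃ (s' : State) (t : ℕ), Exec M P s s' t ∧ t ≤ T ∧ Q s'

end RealRAM

/-! ## Bicolored point sets and geometric graphs on them -/

/-- A list of `N` points of the plane, each of them red or blue. -/
structure BicoloredPoints (N : ℕ) where
  pos : Fin N → EuclideanSpace ℝ (Fin 2)
  isRed : Fin N → Bool

namespace BicoloredPoints

variable {N : ℕ} (S : BicoloredPoints N)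

/-- The (indices of the) red points. -/
def red : Finset (Fin N) := Finset.univ.filter fun i => S.isRed i = true

/-- The (indices of the) blue points. -/
def blue : Finset (Fin N) := Finset.univ.filter fun i => S.isRed i = false

/-- Convex position: no point lies in the convex hull of the others
(in particular the points are pairwise distinct and no three are collinear). -/
def ConvexPosition : Prop := ConvexIndependent ℝ S.pos

/-- Twice the signed area of the triangle `abc`; negative when `c` lies to the right of the
line directed from `a` to `b`. -/
def orient (a b c : EuclideanSpace ℝ (Fin 2)) : ℝ :=
  (b 0 - a 0) * (c 1 - a 1) - (b 1 - a 1) * (c 0 - a 0)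

/-- `j` comes directly after `i` in the cyclic order of the indices. -/
def IsNext (i j : Fin N) : Prop := (j : ℕ) = ((i : ℕ) + 1) % N

/-- The points are listed in clockwise circular order along the boundary of their convex hull:
all the other points lie to the right of the line directed from a point to the next one. -/
def ClockwiseOrder : Prop :=
  ∀ i j k : Fin N, IsNext i j → k ≠ i → k ≠ j → orient (S.pos i) (S.pos j) (S.pos k) < 0

/-- The points `i` and `j` are consecutive in the circular order. -/
def Consecutive (i j : Fin N) : Prop := IsNext i j ∨ IsNext j i

/-- The graph of all bichromatic edges. Alternating paths and cycles are the paths and cycles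
of this graph. -/
def bichromatic : SimpleGraph (Fin N) where
  Adj i j := S.isRed i ≠ S.isRed j
  symm := ⟨fun _ _ h => h.symm⟩
  loopless := ⟨fun _ h => h rfl⟩

/-- Two edges, drawn as straight-line segments, have a common point in their relative interiors. -/
def Cross (e f : Sym2 (Fin N)) : Prop :=
  ∃ a b c d : Fin N, e = s(a, b) ∧ f = s(c, d) ∧
    (openSegment ℝ (S.pos a) (S.pos b) ∩ openSegment ℝ (S.pos c) (S.pos d)).Nonempty

/-- The number of crossings of a set of edges: the number of unordered pairs of distinct
crossing edges. -/
noncomputable def crossings (E : Set (Sym2 (Fin N))) : ℕ :=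
  {q : Sym2 (Sym2 (Fin N)) | ∃ e ∈ E, ∃ f ∈ E, e ≠ f ∧ S.Cross e f ∧ q = s(e, f)}.ncard

/-- Every edge is crossed by at most one other edge. -/
def OnePlane (E : Set (Sym2 (Fin N))) : Prop :=
  ∀ e ∈ E, {f ∈ E | f ≠ e ∧ S.Cross e f}.ncard ≤ 1

/-- `w` is a Hamiltonian alternating cycle with the minimum number of crossings. -/
def IsOptimumCycle {u : Fin N} (w : S.bichromatic.Walk u u) : Prop :=
  w.IsHamiltonianCycle ∧
    ∀ (v : Fin N) (w' : S.bichromatic.Walk v v), w'.IsHamiltonianCycle →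
      S.crossings w.edgeSet ≤ S.crossings w'.edgeSet

/-- `w` is a Hamiltonian alternating path from `u` to `v` with the minimum number of crossings
among all Hamiltonian alternating paths from `u` to `v`. -/
def IsOptimumPath {u v : Fin N} (w : S.bichromatic.Walk u v) : Prop :=
  w.IsHamiltonian ∧
    ∀ w' : S.bichromatic.Walk u v, w'.IsHamiltonian →
      S.crossings w.edgeSet ≤ S.crossings w'.edgeSet

/-- The input: the integer registers `0, 1, 2` contain the number of points and two indices
(prescribed endpoints), the integer array `0` contains the colors in the given order (`0` for red,
`1` for blue), the real arrays `0` and `1` the coordinates. All else is zero. -/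
noncomputable def input (a b : ℕ) : RealRAM.State where
  ivar x := if x = 0 then N else if x = 1 then a else if x = 2 then b else 0
  iarr A k := if h : k < N then (if A = 0 ∧ S.isRed ⟨k, h⟩ = false then 1 else 0) else 0
  rvar _ := 0
  rarr A k := if h : k < N then
      (if A = 0 then S.pos ⟨k, h⟩ 0 else if A = 1 then S.pos ⟨k, h⟩ 1 else 0) else 0

/-- The output convention: the integer array `1` lists the indices of the `N` successive vertices
of the path or cycle. -/
def Outputs (s : RealRAM.State) {u v : Fin N} (w : S.bichromatic.Walk u v) : Prop :=
  ∀ k : Fin N, s.iarr 1 k = (w.getVert k : ℕ)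

end BicoloredPoints

/-! ## Crossings of chords of a convex polygon whose vertices are numbered along the boundary -/

/-! For points in clockwise convex position, two distinct edges cross exactly when their endpoints
interleave in the circular order (`ClockwiseOrder.cross_iff`). The problem thus becomes one about
chords between numbers and about tours, closed polygons given as lists. `total` counts ordered
pairs, hence is twice the number of crossings. Edges form multisets because a tour on two points
uses its edge twice.

Lower bound: a tour has at least half as many crossings as the hull has monochromatic edges
(`cyclicMonoCount_le_total`). In a tour without crossings, hull neighbors must be joined by an edge,
so their colors differ. Otherwise, uncross two edges. If they start in points of different colors,
reversing a segment gives a tour with fewer crossings. If not, the tour splits in two. If the two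
parts cross, they merge into a tour that is still better than the given one. If they do not, one
part occupies an interval of the circular order; cutting it out loses at most two monochromatic
pairs, paid for by the crossing removed.

Upper bound: read the points from where the excess of red over blue is minimum. The colors then form
a balanced word of parentheses, that is, an ordered forest. Traverse it with the direction reversed
at each level. Every inner node costs at most one crossing and accounts for two monochromatic hull
edges, so the bound is attained, by a tour that contains all bichromatic hull edges
(`bestTour_map_rot`).

Paths: hull edges cross nothing. If the endpoints are consecutive and of different colors, closing a
path by the edge between them turns it into a tour with the same crossings, and the tour above
contains that edge. If both endpoints are red, a blue point inserted between them plays the part of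
the closing edge (`IsExtension`).

1-planarity: an optimum corresponds to a tour that no tour beats, so it suffices to improve a tour
in which an edge crosses two others (`improvable_of_crosses_of_crosses`). If the three edges start
in points of the same color, the move is the exchange of two successive segments. It is a sequence
of uncrossings except in one configuration (up to reflection). There it is an improvement as well,
unless a further edge crosses the given one, and this edge then allows another improvement.

Algorithm: only the colors matter. Prefix sums locate the minimum, a stack matches the parentheses,
and the traversal needs just a position and a direction. A constant number of linear passes
suffices, with integers of size `O(n)`. -/

namespace Chord

/-- The chords `e` and `f` of a convex polygon, whose vertices are numbered in circular order,
have disjoint and interleaved pairs of endpoints. -/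
def Crosses (e f : Sym2 ℕ) : Prop :=
  (e.inf < f.inf ∧ f.inf < e.sup ∧ e.sup < f.sup) ∨
    (f.inf < e.inf ∧ e.inf < f.sup ∧ f.sup < e.sup)

instance (e f : Sym2 ℕ) : Decidable (Crosses e f) := by unfold Crosses; infer_instance

theorem crosses_mk {a b c d : ℕ} : Crosses s(a, b) s(c, d) ↔
    (min a b < min c d ∧ min c d < max a b ∧ max a b < max c d) ∨
      (min c d < min a b ∧ min a b < max c d ∧ max c d < max a b) := Iff.rfl

theorem crosses_comm {e f : Sym2 ℕ} : Crosses e f ↔ Crosses f e := by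
  unfold Crosses; exact or_comm

theorem Crosses.symm {e f : Sym2 ℕ} (h : Crosses e f) : Crosses f e := crosses_comm.1 h

theorem not_crosses_self (e : Sym2 ℕ) : ¬ Crosses e e := by
  unfold Crosses; omega

/-- `v` lies strictly between the endpoints of `e`. -/
def Inside (e : Sym2 ℕ) (v : ℕ) : Prop := e.inf < v ∧ v < e.sup

instance (e : Sym2 ℕ) (v : ℕ) : Decidable (Inside e v) := by unfold Inside; infer_instance

theorem inside_mk {a b v : ℕ} : Inside s(a, b) v ↔ min a b < v ∧ v < max a b := Iff.rfl

theorem crosses_iff_inside {a b c d : ℕ} (hc : c ≠ a) (hc' : c ≠ b) (hd : d ≠ a) (hd' : d ≠ b) :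
    Crosses s(a, b) s(c, d) ↔ ¬ (Inside s(a, b) c ↔ Inside s(a, b) d) := by
  rw [crosses_mk, inside_mk, inside_mk]; omega

/-- `1` if the chords cross, and `0` otherwise. -/
def cr (e f : Sym2 ℕ) : ℕ := if Crosses e f then 1 else 0

theorem cr_comm (e f : Sym2 ℕ) : cr e f = cr f e := by
  unfold cr; simp only [crosses_comm]

theorem crosses_mk_of_le {a b c d : ℕ} (h : a ≤ b) (h' : c ≤ d) : Crosses s(a, b) s(c, d) ↔
    (a < c ∧ c < b ∧ b < d) ∨ (c < a ∧ a < d ∧ d < b) := by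
  rw [crosses_mk, min_eq_left h, max_eq_right h, min_eq_left h', max_eq_right h']

theorem cr_mk_of_le {a b c d : ℕ} (h : a ≤ b) (h' : c ≤ d) : cr s(a, b) s(c, d) =
    if (a < c ∧ c < b ∧ b < d) ∨ (c < a ∧ a < d ∧ d < b) then 1 else 0 := by
  unfold cr
  simp only [crosses_mk_of_le h h']

/-- The chords `wy` and `xz` are the diagonals of a convex quadrilateral. This lemma and the next
treat its two pairs of opposite sides: neither pair meets a third chord more often than the
diagonals do. -/
theorem cr_short_sides_le {w x y z : ℕ} (h₁ : w < x) (h₂ : x < y) (h₃ : y < z) (k : Sym2 ℕ) :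
    cr k s(w, x) + cr k s(y, z) ≤ cr k s(w, y) + cr k s(x, z) := by
  induction k with | _ p q
  wlog h : p ≤ q generalizing p q
  · rw [Sym2.eq_swap]; exact this q p (by omega)
  rw [cr_mk_of_le h (by omega), cr_mk_of_le h (by omega), cr_mk_of_le h (by omega),
    cr_mk_of_le h (by omega)]
  split_ifs <;> omega

theorem cr_long_sides_le {w x y z : ℕ} (h₁ : w < x) (h₂ : x < y) (h₃ : y < z) (k : Sym2 ℕ) :
    cr k s(w, z) + cr k s(x, y) ≤ cr k s(w, y) + cr k s(x, z) := by
  induction k with | _ p q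
  wlog h : p ≤ q generalizing p q
  · rw [Sym2.eq_swap]; exact this q p (by omega)
  rw [cr_mk_of_le h (by omega), cr_mk_of_le h (by omega), cr_mk_of_le h (by omega),
    cr_mk_of_le h (by omega)]
  split_ifs <;> omega

/-- The four possible linear orders of the endpoints of two crossing chords, one of which is
directed upwards. -/
theorem Crosses.order {a b c d : ℕ} (h : Crosses s(a, b) s(c, d)) (hab : a < b) :
    (a < c ∧ c < b ∧ b < d) ∨ (a < d ∧ d < b ∧ b < c) ∨
      (c < a ∧ a < d ∧ d < b) ∨ (d < a ∧ a < c ∧ c < b) := by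
  rw [crosses_mk] at h; omega

/-- Crossing chords are the diagonals of a quadrilateral, and the new chords are opposite sides of
it. Which of the two pairs they are depends on the circular order of the endpoints. -/
theorem cr_uncross {a b c d : ℕ} (h : Crosses s(a, b) s(c, d)) (k : Sym2 ℕ) :
    cr k s(a, d) + cr k s(c, b) ≤ cr k s(a, b) + cr k s(c, d) := by
  -- Reversing both chords merely interchanges the two new chords.
  wlog hab : a < b generalizing a b c d
  · have := this (a := b) (b := a) (c := d) (d := c)
      (by rwa [Sym2.eq_swap, Sym2.eq_swap (a := d)]) (by rw [crosses_mk] at h; omega)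
    rw [Sym2.eq_swap (a := a) (b := d), Sym2.eq_swap (a := c) (b := b),
      Sym2.eq_swap (a := a) (b := b), Sym2.eq_swap (a := c) (b := d)]
    omega
  rcases h.order hab with ⟨h₁, h₂, h₃⟩ | ⟨h₁, h₂, h₃⟩ | ⟨h₁, h₂, h₃⟩ | ⟨h₁, h₂, h₃⟩
  · have := cr_long_sides_le h₁ h₂ h₃ k
    omega
  · have := cr_short_sides_le h₁ h₂ h₃ k
    rw [Sym2.eq_swap (a := c) (b := b), Sym2.eq_swap (a := c) (b := d)]
    omega
  · have := cr_short_sides_le h₁ h₂ h₃ k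
    rw [Sym2.eq_swap (a := c) (b := a)] at this
    have := cr_long_sides_le h₁ h₂ h₃ k
    omega
  · have := cr_short_sides_le h₁ h₂ h₃ k
    rw [Sym2.eq_swap (a := a) (b := d), Sym2.eq_swap (a := c) (b := d)]
    omega

theorem not_crosses_uncross {a b c d : ℕ} (h : Crosses s(a, b) s(c, d)) :
    ¬ Crosses s(a, d) s(c, b) := by
  simp only [crosses_mk] at *
  omega

end Chord

/-! ## Multisets of chords, paths and tours -/

namespace Chord

/-- The number of pairs of crossing chords, one from each multiset. -/
def crSum (E F : Multiset (Sym2 ℕ)) : ℕ := (E.map fun e => (F.map (cr e)).sum).sum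

/-- Twice the number of crossings of a multiset of chords. -/
def total (E : Multiset (Sym2 ℕ)) : ℕ := crSum E E

theorem crSum_add_left (A B C : Multiset (Sym2 ℕ)) :
    crSum (A + B) C = crSum A C + crSum B C := by
  simp [crSum]

theorem crSum_add_right (A B C : Multiset (Sym2 ℕ)) :
    crSum A (B + C) = crSum A B + crSum A C := by
  simp [crSum, Multiset.sum_map_add]

theorem crSum_comm (A B : Multiset (Sym2 ℕ)) : crSum A B = crSum B A := by
  unfold crSum
  rw [Multiset.sum_map_sum_map]
  simp only [cr_comm]

theorem crSum_singleton_left (e : Sym2 ℕ) (B : Multiset (Sym2 ℕ)) :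
    crSum {e} B = (B.map (cr e)).sum := by
  simp [crSum]

theorem crSum_singleton (e f : Sym2 ℕ) : crSum {e} {f} = cr e f := by
  simp [crSum]

theorem total_add (A B : Multiset (Sym2 ℕ)) :
    total (A + B) = total A + 2 * crSum A B + total B := by
  unfold total
  rw [crSum_add_left, crSum_add_right, crSum_add_right, crSum_comm B A]
  ring

theorem total_singleton (e : Sym2 ℕ) : total {e} = 0 := by
  simp [total, crSum, cr, not_crosses_self]

theorem crSum_mono {A B R : Multiset (Sym2 ℕ)}
    (h : ∀ k ∈ R, crSum {k} A ≤ crSum {k} B) : crSum A R ≤ crSum B R := by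
  rw [crSum_comm A, crSum_comm B]
  simp only [crSum_singleton_left] at h
  exact Multiset.sum_map_le_sum_map _ _ h

theorem total_replace_lt {A B R : Multiset (Sym2 ℕ)}
    (h : ∀ k ∈ R, crSum {k} A ≤ crSum {k} B) (h' : total A < total B) :
    total (A + R) < total (B + R) := by
  rw [total_add, total_add]
  have := crSum_mono h
  omega

/-- The new chords do not cross each other and meet the remaining chords no more often than the old
ones did. The lost crossing counts twice in `total`, whence the `2`. -/
theorem total_uncross {a b c d : ℕ} (h : Crosses s(a, b) s(c, d)) (R : Multiset (Sym2 ℕ)) :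
    total ({s(a, d)} + {s(c, b)} + R) + 2 ≤ total ({s(a, b)} + {s(c, d)} + R) := by
  have h₁ : crSum ({s(a, d)} + {s(c, b)}) R ≤ crSum ({s(a, b)} + {s(c, d)}) R := by
    refine crSum_mono fun k _ => ?_
    simp only [crSum_add_right, crSum_singleton]
    exact cr_uncross h k
  rw [total_add _ R, total_add _ R]
  simp only [total_add, total_singleton, crSum_singleton]
  have h₂ : cr s(a, b) s(c, d) = 1 := if_pos h
  have h₃ : cr s(a, d) s(c, b) = 0 := if_neg (not_crosses_uncross h)
  omega

theorem crSum_pos {E F : Multiset (Sym2 ℕ)} (h : crSum E F ≠ 0) :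
    ∃ e ∈ E, ∃ f ∈ F, Crosses e f := by
  by_contra! hc
  apply h
  unfold crSum
  refine Multiset.sum_eq_zero fun x hx => ?_
  obtain ⟨e, he, rfl⟩ := Multiset.mem_map.1 hx
  refine Multiset.sum_eq_zero fun y hy => ?_
  obtain ⟨f, hf, rfl⟩ := Multiset.mem_map.1 hy
  exact if_neg (hc e he f hf)

theorem crSum_eq_zero {E F : Multiset (Sym2 ℕ)} (h : ∀ e ∈ E, ∀ f ∈ F, ¬ Crosses e f) :
    crSum E F = 0 := by
  by_contra hc
  obtain ⟨e, he, f, hf, hef⟩ := crSum_pos hc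
  exact h e he f hf hef

/-- All the chords join points of different colors. -/
def Bichromatic (col : ℕ → Bool) (E : Multiset (Sym2 ℕ)) : Prop :=
  ∀ a b, s(a, b) ∈ E → col a ≠ col b

theorem bichromatic_add {col : ℕ → Bool} {E F : Multiset (Sym2 ℕ)} :
    Bichromatic col (E + F) ↔ Bichromatic col E ∧ Bichromatic col F := by
  simp only [Bichromatic, Multiset.mem_add]
  grind

theorem bichromatic_singleton {col : ℕ → Bool} {a b : ℕ} :
    Bichromatic col {s(a, b)} ↔ col a ≠ col b := by
  simp only [Bichromatic, Multiset.mem_singleton]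
  constructor
  · exact fun h => h a b rfl
  · intro h c d hcd
    rcases Sym2.eq_iff.1 hcd with ⟨rfl, rfl⟩ | ⟨rfl, rfl⟩
    · exact h
    · exact h.symm

/-- The chords between successive entries of a list. -/
def pathEdges : List ℕ → Multiset (Sym2 ℕ)
  | [] => 0
  | [_] => 0
  | a :: b :: l => {s(a, b)} + pathEdges (b :: l)

/-- The list starts with `a` and ends with `b`. -/
def Ends (P : List ℕ) (a b : ℕ) : Prop := P.head? = some a ∧ P.getLast? = some b

theorem Ends.ne_nil {P : List ℕ} {a b : ℕ} (h : Ends P a b) : P ≠ [] := by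
  rintro rfl; simp [Ends] at h

theorem Ends.left_mem {P : List ℕ} {a b : ℕ} (h : Ends P a b) : a ∈ P :=
  List.mem_of_mem_head? h.1

theorem Ends.right_mem {P : List ℕ} {a b : ℕ} (h : Ends P a b) : b ∈ P :=
  List.mem_of_mem_getLast? h.2

theorem Ends.append {P Q : List ℕ} {a b c d : ℕ} (hP : Ends P a b) (hQ : Ends Q c d) :
    Ends (P ++ Q) a d := by
  simp [Ends, List.head?_append, List.getLast?_append, hP.1, hQ.2]

theorem Ends.reverse {P : List ℕ} {a b : ℕ} (h : Ends P a b) : Ends P.reverse b a := by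
  simp [Ends, h.1, h.2]

theorem ends_singleton (a : ℕ) : Ends [a] a a := by simp [Ends]

theorem exists_ends {P : List ℕ} (h : P ≠ []) : ∃ a b, Ends P a b :=
  ⟨P.head h, P.getLast h, by simp [Ends, List.head?_eq_some_head h, List.getLast?_eq_some_getLast h]⟩

theorem ends_cons {a b c : ℕ} {l : List ℕ} : Ends (a :: b :: l) a c ↔ Ends (b :: l) b c := by
  simp [Ends]

theorem pathEdges_append {P Q : List ℕ} {a b c d : ℕ} (hP : Ends P a b) (hQ : Ends Q c d) :
    pathEdges (P ++ Q) = pathEdges P + {s(b, c)} + pathEdges Q := by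
  induction P generalizing a with
  | nil => exact absurd rfl hP.ne_nil
  | cons x t ih =>
    cases t with
    | nil =>
      obtain ⟨q, hq⟩ : ∃ q, Q = c :: q := by
        cases Q with
        | nil => exact absurd rfl hQ.ne_nil
        | cons y q => exact ⟨q, by have := hQ.1; simp at this; rw [this]⟩
      have hx : x = b := by have := hP.2; simpa using this
      subst hq hx
      simp [pathEdges]
    | cons y t =>
      have hP' : Ends (y :: t) y b := by
        refine ⟨rfl, ?_⟩
        have := hP.2
        rwa [List.getLast?_cons_cons] at this
      have := ih hP'
      simp only [List.cons_append, pathEdges] at this ⊢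
      rw [this]
      simp only [add_assoc]

theorem pathEdges_reverse (P : List ℕ) : pathEdges P.reverse = pathEdges P := by
  induction P with
  | nil => rfl
  | cons a t ih =>
    cases t with
    | nil => rfl
    | cons b t =>
      obtain ⟨x, y, h⟩ := exists_ends (P := b :: t) (by simp)
      have hx : x = b := by have := h.1; simpa using this.symm
      subst hx
      rw [List.reverse_cons, pathEdges_append h.reverse (ends_singleton a), ih]
      simp only [pathEdges, add_zero]
      rw [add_comm, Sym2.eq_swap]

/-- The chords of the closed polygon through the entries of a list. -/
def tourEdges (P : List ℕ) : Multiset (Sym2 ℕ) := pathEdges (P ++ P.head?.toList)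

theorem tourEdges_eq {P : List ℕ} {a b : ℕ} (h : Ends P a b) :
    tourEdges P = pathEdges P + {s(b, a)} := by
  rw [tourEdges, h.1, Option.toList_some, pathEdges_append h (ends_singleton a)]
  simp [pathEdges]

theorem tourEdges_append {P Q : List ℕ} {a b c d : ℕ} (hP : Ends P a b) (hQ : Ends Q c d) :
    tourEdges (P ++ Q) = pathEdges P + {s(b, c)} + pathEdges Q + {s(d, a)} := by
  rw [tourEdges_eq (hP.append hQ), pathEdges_append hP hQ]

/-- Cutting the path at the edge also fixes the direction `a` to `b` in which the edge is traversed;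
this direction decides how a crossing may be resolved. -/
theorem exists_of_mem_pathEdges {c : List ℕ} {e : Sym2 ℕ} (h : e ∈ pathEdges c) :
    ∃ P Q a b p q, c = P ++ Q ∧ Ends P p a ∧ Ends Q b q ∧ e = s(a, b) := by
  induction c with
  | nil => simp [pathEdges] at h
  | cons x t ih =>
    cases t with
    | nil => simp [pathEdges] at h
    | cons y t =>
      rw [pathEdges, Multiset.mem_add, Multiset.mem_singleton] at h
      rcases h with rfl | h
      · obtain ⟨p, q, hpq⟩ := exists_ends (P := y :: t) (by simp)
        have hx : p = y := by have := hpq.1; simpa using this.symm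
        subst hx
        exact ⟨[x], p :: t, x, p, x, q, rfl, ends_singleton x, hpq, rfl⟩
      · obtain ⟨P, Q, a, b, p, q, h₁, h₂, h₃, rfl⟩ := ih h
        have := (ends_singleton x).append h₂
        exact ⟨x :: P, Q, a, b, x, q, by simp [h₁], this, h₃, rfl⟩

theorem mem_of_mem_pathEdges {c : List ℕ} {a b : ℕ} (h : s(a, b) ∈ pathEdges c) :
    a ∈ c ∧ b ∈ c := by
  obtain ⟨P, Q, a', b', p, q, rfl, hP, hQ, he⟩ := exists_of_mem_pathEdges h
  have h₁ : a' ∈ P ++ Q := List.mem_append_left _ hP.right_mem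
  have h₂ : b' ∈ P ++ Q := List.mem_append_right _ hQ.left_mem
  rcases Sym2.eq_iff.1 he with ⟨rfl, rfl⟩ | ⟨rfl, rfl⟩ <;> exact ⟨‹_›, ‹_›⟩

theorem mem_of_mem_tourEdges {c : List ℕ} {a b : ℕ} (h : s(a, b) ∈ tourEdges c) :
    a ∈ c ∧ b ∈ c := by
  have := mem_of_mem_pathEdges h
  simp only [List.mem_append, Option.mem_toList] at this
  have hc : ∀ x, c.head? = some x → x ∈ c := fun x hx => List.mem_of_mem_head? hx
  exact ⟨this.1.elim id (hc a), this.2.elim id (hc b)⟩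

/-- Any edge can be made the closing one, so the exchanges below may assume this of one of their
edges. -/
theorem exists_rotation {c : List ℕ} {e : Sym2 ℕ} (h : e ∈ tourEdges c) :
    ∃ c' x y, c'.Perm c ∧ tourEdges c' = tourEdges c ∧ Ends c' y x ∧ e = s(x, y) := by
  have hc : c ≠ [] := by rintro rfl; simp [tourEdges, pathEdges] at h
  obtain ⟨a, b, hab⟩ := exists_ends hc
  have h' := h
  rw [tourEdges_eq hab, Multiset.mem_add, Multiset.mem_singleton] at h'
  rcases h' with h' | rfl
  · obtain ⟨P, Q, x, y, p, q, rfl, hP, hQ, rfl⟩ := exists_of_mem_pathEdges h'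
    refine ⟨Q ++ P, x, y, List.perm_append_comm, ?_, hQ.append hP, rfl⟩
    rw [tourEdges_append hP hQ, tourEdges_append hQ hP]
    abel
  · exact ⟨c, b, a, List.Perm.refl _, rfl, hab, rfl⟩

/-! ### Tours, and their uncrossing, splitting and merging -/

/-- A closed polygon with distinct vertices whose edges join points of different colors. -/
structure IsTour (col : ℕ → Bool) (c : List ℕ) : Prop where
  ne_nil : c ≠ []
  nodup : c.Nodup
  bichromatic : Bichromatic col (tourEdges c)

/-- Some tour on the same points has fewer crossings. -/
def Improvable (col : ℕ → Bool) (c : List ℕ) : Prop :=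
  ∃ c', c'.Perm c ∧ IsTour col c' ∧ total (tourEdges c') < total (tourEdges c)

theorem IsTour.of_perm {col : ℕ → Bool} {c c' : List ℕ} (h : IsTour col c) (hp : c'.Perm c)
    (hb : Bichromatic col (tourEdges c')) : IsTour col c' where
  ne_nil := by rintro rfl; exact h.ne_nil hp.symm.eq_nil
  nodup := hp.nodup_iff.2 h.nodup
  bichromatic := hb

theorem IsTour.of_edges {col : ℕ → Bool} {c c' : List ℕ} (h : IsTour col c) (hp : c'.Perm c)
    (he : tourEdges c' = tourEdges c) : IsTour col c' :=
  h.of_perm hp (he ▸ h.bichromatic)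

theorem Improvable.of_edges {col : ℕ → Bool} {c c' : List ℕ} (h : Improvable col c')
    (hp : c'.Perm c) (he : tourEdges c' = tourEdges c) : Improvable col c := by
  obtain ⟨d, h₁, h₂, h₃⟩ := h
  exact ⟨d, h₁.trans hp, h₂, he ▸ h₃⟩

theorem bool_ne_of_ne {a b c d : Bool} (h₁ : a ≠ b) (h₂ : c ≠ d) (h₃ : a ≠ c) : d ≠ b := by
  revert a b c d; decide

/-- Two crossing edges that are traversed in such a way that their starting points have different
colors. -/
theorem improvable_of_antiparallel {col : ℕ → Bool} {P Q : List ℕ} {x₁ y₁ x₂ y₂ : ℕ}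
    (hP : Ends P y₁ x₂) (hQ : Ends Q y₂ x₁) (h : IsTour col (P ++ Q))
    (hx : Crosses s(x₁, y₁) s(x₂, y₂)) (hc : col x₁ ≠ col x₂) : Improvable col (P ++ Q) := by
  have hb := h.bichromatic
  have hp : (P ++ Q.reverse).Perm (P ++ Q) := (List.reverse_perm Q).append_left P
  have hE := tourEdges_append hP hQ.reverse
  rw [pathEdges_reverse] at hE
  rw [tourEdges_append hP hQ] at hb
  simp only [bichromatic_add, bichromatic_singleton] at hb
  refine ⟨P ++ Q.reverse, hp, h.of_perm hp ?_, ?_⟩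
  · rw [hE]
    simp only [bichromatic_add, bichromatic_singleton]
    exact ⟨⟨⟨hb.1.1.1, hc.symm⟩, hb.1.2⟩, bool_ne_of_ne hb.2 hb.1.1.2 hc⟩
  · rw [hE, tourEdges_append hP hQ]
    -- `total_uncross` joins the first end of one chord to the second end of the other, so the
    -- second chord is turned around to obtain `x₁x₂`.
    rw [Sym2.eq_swap (a := x₂) (b := y₂)] at hx
    have := total_uncross hx (pathEdges P + pathEdges Q)
    rw [show pathEdges P + {s(x₂, x₁)} + pathEdges Q + {s(y₂, y₁)} =
      {s(x₁, x₂)} + {s(y₂, y₁)} + (pathEdges P + pathEdges Q) by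
        rw [Sym2.eq_swap (a := x₂)]; abel,
      show pathEdges P + {s(x₂, y₂)} + pathEdges Q + {s(x₁, y₁)} =
      {s(x₁, y₁)} + {s(y₂, x₂)} + (pathEdges P + pathEdges Q) by
        rw [Sym2.eq_swap (a := x₂)]; abel]
    omega

/-- Two crossing edges that are traversed in such a way that their starting points have the same
color: uncrossing them splits the tour. -/
theorem split_of_parallel {col : ℕ → Bool} {P Q : List ℕ} {x₁ y₁ x₂ y₂ : ℕ}
    (hP : Ends P y₁ x₂) (hQ : Ends Q y₂ x₁) (h : IsTour col (P ++ Q))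
    (hx : Crosses s(x₁, y₁) s(x₂, y₂)) (hc : col x₁ = col x₂) :
    IsTour col P ∧ IsTour col Q ∧
      total (tourEdges P + tourEdges Q) + 2 ≤ total (tourEdges (P ++ Q)) := by
  have hb := h.bichromatic
  have hn := List.nodup_append.1 h.nodup
  rw [tourEdges_append hP hQ] at hb
  simp only [bichromatic_add, bichromatic_singleton] at hb
  refine ⟨⟨hP.ne_nil, hn.1, ?_⟩, ⟨hQ.ne_nil, hn.2.1, ?_⟩, ?_⟩
  · rw [tourEdges_eq hP]
    simp only [bichromatic_add, bichromatic_singleton]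
    exact ⟨hb.1.1.1, hc ▸ hb.2⟩
  · rw [tourEdges_eq hQ]
    simp only [bichromatic_add, bichromatic_singleton]
    exact ⟨hb.1.2, hc ▸ hb.1.1.2⟩
  · rw [tourEdges_append hP hQ, tourEdges_eq hP, tourEdges_eq hQ]
    have := total_uncross hx (pathEdges P + pathEdges Q)
    rw [show pathEdges P + {s(x₂, y₁)} + (pathEdges Q + {s(x₁, y₂)}) =
      {s(x₁, y₂)} + {s(x₂, y₁)} + (pathEdges P + pathEdges Q) by abel,
      show pathEdges P + {s(x₂, y₂)} + pathEdges Q + {s(x₁, y₁)} =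
      {s(x₁, y₁)} + {s(x₂, y₂)} + (pathEdges P + pathEdges Q) by abel]
    omega

/-- Two disjoint tours, one of which crosses the other, can be merged. -/
theorem exists_merge {col : ℕ → Bool} {P Q : List ℕ} (hP : IsTour col P) (hQ : IsTour col Q)
    (hd : P.Disjoint Q) {e f : Sym2 ℕ} (he : e ∈ tourEdges P) (hf : f ∈ tourEdges Q)
    (hx : Crosses e f) : ∃ c, c.Perm (P ++ Q) ∧ IsTour col c ∧
      total (tourEdges c) < total (tourEdges P + tourEdges Q) := by
  obtain ⟨P', x₁, y₁, hp, hpE, hP', rfl⟩ := exists_rotation he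
  obtain ⟨Q', x₂, y₂, hq, hqE, hQ', rfl⟩ := exists_rotation hf
  have hn : (P ++ Q).Nodup := List.nodup_append.2 ⟨hP.nodup, hQ.nodup, fun a ha b hb hab =>
    hd ha (hab ▸ hb)⟩
  have hbP := hP.bichromatic
  have hbQ := hQ.bichromatic
  rw [← hpE, tourEdges_eq hP', bichromatic_add, bichromatic_singleton] at hbP
  rw [← hqE, tourEdges_eq hQ', bichromatic_add, bichromatic_singleton] at hbQ
  rw [← hpE, ← hqE, tourEdges_eq hP', tourEdges_eq hQ']
  have hne : ∀ R : List ℕ, P' ++ R ≠ [] := fun R => by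
    simp [hP'.ne_nil]
  -- Both tours are cut open at the crossing edges. The second one is reversed if this is needed for
  -- the new edges to be bichromatic.
  by_cases hc : col x₁ = col x₂
  · have hp' : (P' ++ Q').Perm (P ++ Q) := hp.append hq
    refine ⟨P' ++ Q', hp', ⟨hne _, hp'.nodup_iff.2 hn, ?_⟩, ?_⟩
    · rw [tourEdges_append hP' hQ']
      simp only [bichromatic_add, bichromatic_singleton]
      exact ⟨⟨⟨hbP.1, hc ▸ hbQ.2⟩, hbQ.1⟩, hc ▸ hbP.2⟩
    · rw [tourEdges_append hP' hQ']
      have := total_uncross hx (pathEdges P' + pathEdges Q')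
      rw [show pathEdges P' + {s(x₁, y₂)} + pathEdges Q' + {s(x₂, y₁)} =
        {s(x₁, y₂)} + {s(x₂, y₁)} + (pathEdges P' + pathEdges Q') by abel,
        show pathEdges P' + {s(x₁, y₁)} + (pathEdges Q' + {s(x₂, y₂)}) =
        {s(x₁, y₁)} + {s(x₂, y₂)} + (pathEdges P' + pathEdges Q') by abel]
      omega
  · have hp' : (P' ++ Q'.reverse).Perm (P ++ Q) :=
      hp.append ((List.reverse_perm Q').trans hq)
    have hE := tourEdges_append hP' hQ'.reverse
    rw [pathEdges_reverse] at hE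
    refine ⟨P' ++ Q'.reverse, hp', ⟨hne _, hp'.nodup_iff.2 hn, ?_⟩, ?_⟩
    · rw [hE]
      simp only [bichromatic_add, bichromatic_singleton]
      exact ⟨⟨⟨hbP.1, hc⟩, hbQ.1⟩, bool_ne_of_ne hbP.2 hbQ.2 hc⟩
    · rw [hE]
      rw [Sym2.eq_swap (a := x₂) (b := y₂)] at hx
      have := total_uncross hx (pathEdges P' + pathEdges Q')
      rw [show pathEdges P' + {s(x₁, x₂)} + pathEdges Q' + {s(y₂, y₁)} =
        {s(x₁, x₂)} + {s(y₂, y₁)} + (pathEdges P' + pathEdges Q') by abel,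
        show pathEdges P' + {s(x₁, y₁)} + (pathEdges Q' + {s(x₂, y₂)}) =
        {s(x₁, y₁)} + {s(y₂, x₂)} + (pathEdges P' + pathEdges Q') by
          rw [Sym2.eq_swap (a := x₂)]; abel]
      omega

/-! ### Paths that meet both sides of a chord -/

/-- A path from one side to the other has an edge that leads from the one to the other. -/
theorem exists_step {p : ℕ → Prop} {P : List ℕ} {a b : ℕ} (h : Ends P a b) (ha : p a)
    (hb : ¬ p b) :
    ∃ A B u v, P = A ++ B ∧ Ends A a u ∧ Ends B v b ∧ p u ∧ ¬ p v := by
  induction P generalizing a with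
  | nil => exact absurd rfl h.ne_nil
  | cons x t ih =>
    have hx : x = a := by have := h.1; simpa using this
    subst hx
    cases t with
    | nil =>
      have : x = b := by have := h.2; simpa using this
      exact absurd (this ▸ ha) hb
    | cons y t =>
      have h' : Ends (y :: t) y b := ends_cons.1 h
      by_cases hy : p y
      · obtain ⟨A, B, u, v, h₁, h₂, h₃, h₄⟩ := ih h' hy
        exact ⟨x :: A, B, u, v, by simp [h₁], (ends_singleton x).append h₂, h₃, h₄⟩
      · exact ⟨[x], y :: t, x, y, rfl, ends_singleton x, h', ha, hy⟩

theorem mem_pathEdges_append {A B : List ℕ} {a u v b : ℕ} (hA : Ends A a u) (hB : Ends B v b) :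
    s(u, v) ∈ pathEdges (A ++ B) := by
  rw [pathEdges_append hA hB]; simp

theorem pathEdges_sublist {A B C : List ℕ} {e : Sym2 ℕ} (h : e ∈ pathEdges B) :
    e ∈ pathEdges (A ++ B ++ C) := by
  obtain ⟨P, Q, a, b, p, q, rfl, hP, hQ, rfl⟩ := exists_of_mem_pathEdges h
  obtain ⟨p', hp'⟩ : ∃ p', Ends (A ++ P) p' a := by
    rcases eq_or_ne A [] with rfl | hA
    · exact ⟨p, hP⟩
    · obtain ⟨x, y, hxy⟩ := exists_ends hA
      exact ⟨x, hxy.append hP⟩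
  obtain ⟨q', hq'⟩ : ∃ q', Ends (Q ++ C) b q' := by
    rcases eq_or_ne C [] with rfl | hC
    · exact ⟨q, by simpa using hQ⟩
    · obtain ⟨x, y, hxy⟩ := exists_ends hC
      exact ⟨y, hQ.append hxy⟩
  have := mem_pathEdges_append hp' hq'
  simpa [List.append_assoc] using this

/-- A path that joins points on different sides of a chord, and avoids the endpoints of the chord,
crosses it. -/
theorem exists_crossing {P : List ℕ} {a b x y : ℕ} (h : Ends P a b) (hx : x ∉ P) (hy : y ∉ P)
    (hab : ¬ (Inside s(x, y) a ↔ Inside s(x, y) b)) :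
    ∃ A B u v, P = A ++ B ∧ Ends A a u ∧ Ends B v b ∧ Crosses s(x, y) s(u, v) ∧
      (Inside s(x, y) u ↔ Inside s(x, y) a) ∧ (Inside s(x, y) v ↔ Inside s(x, y) b) := by
  obtain ⟨A, B, u, v, rfl, hA, hB, hu, hv⟩ :=
    -- The property followed along the path is to lie on the same side of the chord as the starting
    -- point.
    exists_step (p := fun v => Inside s(x, y) v ↔ Inside s(x, y) a) h Iff.rfl (by grind)
  have hu' : u ∈ A ++ B := List.mem_append_left _ hA.right_mem
  have hv' : v ∈ A ++ B := List.mem_append_right _ hB.left_mem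
  refine ⟨A, B, u, v, rfl, hA, hB, ?_, hu, by grind⟩
  rw [crosses_iff_inside (by grind) (by grind) (by grind) (by grind)]
  grind

end Chord

/-! ## A lower bound for the number of crossings of a tour -/

namespace Chord

/-- The number of pairs of successive entries of the same color. -/
def monoCount (col : ℕ → Bool) : List ℕ → ℕ
  | [] => 0
  | [_] => 0
  | a :: b :: l => (if col a = col b then 1 else 0) + monoCount col (b :: l)

/-- The number of pairs of cyclically successive entries of the same color. -/
def cyclicMonoCount (col : ℕ → Bool) (V : List ℕ) : ℕ := monoCount col (V ++ V.head?.toList)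

theorem monoCount_append {col : ℕ → Bool} {P Q : List ℕ} {a b c d : ℕ} (hP : Ends P a b)
    (hQ : Ends Q c d) : monoCount col (P ++ Q) =
      monoCount col P + (if col b = col c then 1 else 0) + monoCount col Q := by
  induction P generalizing a with
  | nil => exact absurd rfl hP.ne_nil
  | cons x t ih =>
    cases t with
    | nil =>
      obtain ⟨q, hq⟩ : ∃ q, Q = c :: q := by
        cases Q with
        | nil => exact absurd rfl hQ.ne_nil
        | cons y q => exact ⟨q, by have := hQ.1; simp at this; rw [this]⟩
      have hx : x = b := by have := hP.2; simpa using this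
      subst hq hx
      simp [monoCount]
    | cons y t =>
      have hP' : Ends (y :: t) y b := by
        refine ⟨rfl, ?_⟩
        have := hP.2
        rwa [List.getLast?_cons_cons] at this
      have := ih hP'
      simp only [List.cons_append, monoCount] at this ⊢
      omega

theorem exists_of_monoCount_ne_zero {col : ℕ → Bool} {L : List ℕ} (h : monoCount col L ≠ 0) :
    ∃ A v w C, L = A ++ v :: w :: C ∧ col v = col w := by
  induction L with
  | nil => exact absurd rfl h
  | cons x t ih =>
    cases t with
    | nil => exact absurd rfl h
    | cons y t =>
      by_cases hc : col x = col y
      · exact ⟨[], x, y, t, rfl, hc⟩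
      · rw [monoCount, if_neg hc, zero_add] at h
        obtain ⟨A, v, w, C, h₁, h₂⟩ := ih h
        exact ⟨x :: A, v, w, C, by rw [h₁]; rfl, h₂⟩

/-- Cutting out `B` destroys only the pair that enters `B` and the pair that leaves it; the pairs
created by closing up can only increase the right side. -/
theorem cyclicMonoCount_interval_le {col : ℕ → Bool} {A B C : List ℕ} (hA : A ≠ []) (hB : B ≠ []) :
    cyclicMonoCount col (A ++ B ++ C) ≤
      cyclicMonoCount col (A ++ C) + cyclicMonoCount col B + 2 := by
  obtain ⟨a, a', ha⟩ := exists_ends hA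
  obtain ⟨b, b', hb⟩ := exists_ends hB
  -- With the closing entry `a` attached, the part after `B` is nonempty even if `C` is empty.
  have hD : C ++ [a] ≠ [] := by simp
  obtain ⟨d, d', hd⟩ := exists_ends hD
  have h₁ : (A ++ B ++ C).head?.toList = [a] := by
    simp [List.head?_append, ha.1]
  have h₂ : (A ++ C).head?.toList = [a] := by
    simp [List.head?_append, ha.1]
  have h₃ : B.head?.toList = [b] := by simp [hb.1]
  rw [cyclicMonoCount, cyclicMonoCount, cyclicMonoCount, h₁, h₂, h₃,
    show A ++ B ++ C ++ [a] = A ++ (B ++ (C ++ [a])) by simp,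
    show A ++ C ++ [a] = A ++ (C ++ [a]) by simp, monoCount_append ha (hb.append hd),
    monoCount_append hb hd, monoCount_append ha hd, monoCount_append hb (ends_singleton b)]
  split_ifs <;> omega

/-- A list in which two classes do not interleave consists of an interval of the one class and
its complement. -/
theorem exists_interval {p : ℕ → Bool} {V : List ℕ} (hV : V.Pairwise (· < ·))
    (h : ∀ a ∈ V, ∀ b ∈ V, ∀ c ∈ V, ∀ d ∈ V, a < b → b < c → c < d → p a = p c → p b = p d →
      p a = p b) :
    ∃ A B C t, V = A ++ B ++ C ∧ (∀ x ∈ A, p x = t) ∧ (∀ x ∈ B, p x = !t) ∧ (∀ x ∈ C, p x = t) := by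
  cases V with
  | nil => exact ⟨[], [], [], true, by simp⟩
  | cons v V =>
    -- The first entry determines the outer class: `B` is the first maximal run of the other class.
    set t := p v with ht
    set q : ℕ → Bool := fun x => p x == t with hq
    set r : ℕ → Bool := fun x => p x != t with hr
    set D := V.dropWhile q with hD
    have hVD : V = V.takeWhile q ++ D := (List.takeWhile_append_dropWhile).symm
    have hDD : D = D.takeWhile r ++ D.dropWhile r := (List.takeWhile_append_dropWhile).symm
    have htk : ∀ (f : ℕ → Bool) (L : List ℕ), ∀ x ∈ L.takeWhile f, f x = true :=
      fun f L x hx => List.mem_takeWhile_imp hx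
    refine ⟨v :: V.takeWhile q, D.takeWhile r, D.dropWhile r, t, ?_, ?_, ?_, ?_⟩
    · rw [List.append_assoc, ← hDD, List.cons_append, ← hVD]
    · intro x hx
      rcases List.mem_cons.1 hx with rfl | hx
      · rfl
      · simpa [hq] using htk _ _ x hx
    · intro x hx
      have : ¬ p x = t := by simpa [hr] using htk _ _ x hx
      revert this; cases p x <;> cases t <;> simp
    · intro d hd
      -- An entry `d` of the inner class after the run would give the interleaved entries `v < b < c
      -- < d`, with `c` the first one after the run.
      by_contra hdt
      have hne : D.dropWhile r ≠ [] := List.ne_nil_of_mem hd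
      obtain ⟨c, C', hcC⟩ := List.exists_cons_of_ne_nil hne
      have hc : p c = t := by
        have := List.head_dropWhile_not r (l := D) hne
        simp only [hcC, List.head_cons] at this
        simpa [hr] using this
      have hDne : D ≠ [] := by
        intro h0; rw [h0] at hne; simp at hne
      obtain ⟨b, B', hbB⟩ := List.exists_cons_of_ne_nil hDne
      have hb : ¬ p b = t := by
        have := List.head_dropWhile_not q (l := V) hDne
        simp only [← hD, hbB, List.head_cons] at this
        simpa [hq] using this
      have hbr : r b = true := by simpa [hr] using hb
      have hB' : D.takeWhile r = b :: B'.takeWhile r := by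
        rw [hbB, List.takeWhile_cons, if_pos hbr]
      have hdC : d ∈ C' := by
        rw [hcC] at hd
        rcases List.mem_cons.1 hd with rfl | hd
        · exact absurd hc hdt
        · exact hd
      have hVeq : v :: V = v :: (V.takeWhile q ++ ((b :: B'.takeWhile r) ++ (c :: C'))) := by
        rw [← hB', ← hcC, ← hDD, ← hVD]
      rw [hVeq] at hV
      have hord : v < b ∧ b < c ∧ c < d := by
        simp only [List.pairwise_cons, List.pairwise_append, List.mem_append, List.mem_cons] at hV
        refine ⟨hV.1 b (by simp), hV.2.2.1.2.2 b (by simp) c (by simp),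
          hV.2.2.1.2.1.1 d hdC⟩
      refine hb ((h v (by simp) b ?_ c ?_ d ?_ hord.1 hord.2.1 hord.2.2 hc.symm ?_).symm)
      · rw [hVeq]; simp
      · rw [hVeq]; simp
      · rw [hVeq]; simp [hdC]
      · revert hb hdt; cases p b <;> cases p d <;> cases t <;> simp

theorem filter_outer {p : ℕ → Bool} {A B C : List ℕ} (hA : ∀ x ∈ A, p x = true)
    (hB : ∀ x ∈ B, p x = false) (hC : ∀ x ∈ C, p x = true) :
    (A ++ B ++ C).filter p = A ++ C := by
  rw [List.filter_append, List.filter_append, List.filter_eq_self.2 hA, List.filter_eq_self.2 hC,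
    List.filter_eq_nil_iff.2 fun a ha => by simp [hB a ha], List.append_nil]

theorem filter_inner {p : ℕ → Bool} {A B C : List ℕ} (hA : ∀ x ∈ A, p x = false)
    (hB : ∀ x ∈ B, p x = true) (hC : ∀ x ∈ C, p x = false) :
    (A ++ B ++ C).filter p = B := by
  rw [List.filter_append, List.filter_append, List.filter_eq_self.2 hB,
    List.filter_eq_nil_iff.2 fun a ha => by simp [hA a ha],
    List.filter_eq_nil_iff.2 fun a ha => by simp [hC a ha], List.append_nil, List.nil_append]

theorem exists_subpath {P : List ℕ} {a c : ℕ} (ha : a ∈ P) (hc : c ∈ P) (hac : a ≠ c) :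
    ∃ X Y Z, P = X ++ Y ++ Z ∧ (Ends Y a c ∨ Ends Y c a) := by
  obtain ⟨X, Z, rfl⟩ := List.append_of_mem ha
  simp only [List.mem_append, List.mem_cons] at hc
  rcases hc with hc | rfl | hc
  · obtain ⟨X₁, X₂, rfl⟩ := List.append_of_mem hc
    exact ⟨X₁, c :: X₂ ++ [a], Z, by simp, Or.inr (by simp [Ends, List.getLast?_cons])⟩
  · exact absurd rfl hac
  · obtain ⟨Z₁, Z₂, rfl⟩ := List.append_of_mem hc
    exact ⟨X, a :: Z₁ ++ [c], Z₂, by simp, Or.inl (by simp [Ends, List.getLast?_cons])⟩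

/-- A path that contains points on different sides of a chord has an edge that crosses it. -/
theorem exists_crossing_of_mem {P : List ℕ} {a c x y : ℕ} (ha : a ∈ P) (hc : c ∈ P)
    (hx : x ∉ P) (hy : y ∉ P) (h : Crosses s(x, y) s(a, c)) :
    ∃ u v, s(u, v) ∈ pathEdges P ∧ Crosses s(x, y) s(u, v) := by
  have hac : a ≠ c := by rintro rfl; rw [crosses_mk] at h; omega
  rw [crosses_iff_inside (by grind) (by grind) (by grind) (by grind)] at h
  obtain ⟨X, Y, Z, rfl, hY⟩ := exists_subpath ha hc hac
  have hxY : x ∉ Y := by grind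
  have hyY : y ∉ Y := by grind
  obtain ⟨A, B, u, v, rfl, huv⟩ : ∃ A B u v, Y = A ++ B ∧ Crosses s(x, y) s(u, v) ∧
      ∃ a' b', Ends A a' u ∧ Ends B v b' := by
    rcases hY with hY | hY
    · obtain ⟨A, B, u, v, h₁, h₂, h₃, h₄, -⟩ := exists_crossing hY hxY hyY h
      exact ⟨A, B, u, v, h₁, h₄, _, _, h₂, h₃⟩
    · obtain ⟨A, B, u, v, h₁, h₂, h₃, h₄, -⟩ := exists_crossing hY hxY hyY (by tauto)
      exact ⟨A, B, u, v, h₁, h₄, _, _, h₂, h₃⟩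
  obtain ⟨h₁, a', b', h₂, h₃⟩ := huv
  exact ⟨u, v, pathEdges_sublist (mem_pathEdges_append h₂ h₃), h₁⟩

/-- The auxiliary chord `bd` separates `a` from `c`, so an edge `uv` of `P` crosses it. This edge in
turn separates `b` from `d`, so an edge of `Q` crosses it. -/
theorem not_interleaved {P Q : List ℕ} (hd : P.Disjoint Q)
    (h : ∀ e ∈ pathEdges P, ∀ f ∈ pathEdges Q, ¬ Crosses e f) {a b c d : ℕ} (ha : a ∈ P)
    (hc : c ∈ P) (hb : b ∈ Q) (hd' : d ∈ Q) : ¬ Crosses s(b, d) s(a, c) := by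
  intro hx
  obtain ⟨u, v, huv, hx'⟩ := exists_crossing_of_mem ha hc (fun h => hd h hb) (fun h => hd h hd') hx
  have := mem_of_mem_pathEdges huv
  obtain ⟨z, w, hzw, hx''⟩ := exists_crossing_of_mem hb hd' (fun h => hd this.1 h)
    (fun h => hd this.2 h) hx'.symm
  exact h _ huv _ hzw hx''

theorem tourEdges_comm (P Q : List ℕ) : tourEdges (P ++ Q) = tourEdges (Q ++ P) := by
  rcases eq_or_ne P [] with rfl | hP
  · simp
  rcases eq_or_ne Q [] with rfl | hQ
  · simp
  obtain ⟨a, b, h⟩ := exists_ends hP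
  obtain ⟨c, d, h'⟩ := exists_ends hQ
  rw [tourEdges_append h h', tourEdges_append h' h]
  abel

theorem mem_tourEdges_of_mem_pathEdges {c : List ℕ} {e : Sym2 ℕ} (h : e ∈ pathEdges c) :
    e ∈ tourEdges c := by
  have : c ≠ [] := by rintro rfl; simp [pathEdges] at h
  obtain ⟨a, b, hab⟩ := exists_ends this
  rw [tourEdges_eq hab]
  exact Multiset.mem_add.2 (Or.inl h)

/-- In a tour without crossings, points that are consecutive on the convex hull have different
colors. -/
theorem col_ne_of_consecutive {col : ℕ → Bool} {c : List ℕ} (h : IsTour col c)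
    (h₀ : total (tourEdges c) = 0) {v w : ℕ} (hv : v ∈ c) (hw : w ∈ c) (hvw : v ≠ w)
    (hs : ∀ y ∈ c, ∀ z ∈ c, y ≠ v → y ≠ w → z ≠ v → z ≠ w →
      (Inside s(v, w) y ↔ Inside s(v, w) z)) : col v ≠ col w := by
  intro hcol
  obtain ⟨X, Z, rfl⟩ := List.append_of_mem hv
  have hp : (v :: Z ++ X).Perm (X ++ v :: Z) := List.perm_append_comm
  have hE := tourEdges_comm X (v :: Z)
  have h' := h.of_edges hp hE.symm
  rw [hE] at h₀
  have hw' : w ∈ Z ++ X := by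
    simp only [List.mem_append, List.mem_cons] at hw ⊢
    rcases hw with h | h | h
    · exact Or.inr h
    · exact absurd h.symm hvw
    · exact Or.inl h
  replace hs : ∀ y ∈ Z ++ X, ∀ z ∈ Z ++ X, y ≠ v → y ≠ w → z ≠ v → z ≠ w →
      (Inside s(v, w) y ↔ Inside s(v, w) z) := fun y hy z hz =>
    hs y (hp.mem_iff.1 (List.mem_cons_of_mem v hy)) z (hp.mem_iff.1 (List.mem_cons_of_mem v hz))
  rw [List.cons_append] at h' h₀
  generalize Z ++ X = R at *
  obtain ⟨A, B, rfl⟩ := List.append_of_mem hw'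
  have hno : ∀ e ∈ tourEdges (v :: (A ++ w :: B)), ∀ f ∈ tourEdges (v :: (A ++ w :: B)),
      ¬ Crosses e f := by
    intro e he f hf hx
    obtain ⟨E, hEe⟩ := Multiset.exists_cons_of_mem he
    rw [hEe, ← Multiset.singleton_add, total_add] at h₀
    rw [hEe, Multiset.mem_cons] at hf
    rcases hf with rfl | hf
    · exact not_crosses_self _ hx
    · obtain ⟨F, rfl⟩ := Multiset.exists_cons_of_mem hf
      rw [← Multiset.singleton_add, crSum_add_right, crSum_singleton, cr, if_pos hx] at h₀
      omega
  have hn := h'.nodup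
  have hb := h'.bichromatic
  -- If `w` comes directly after or directly before `v` in the tour, then `vw` is a tour edge and
  -- bichromatic. The remaining case is impossible.
  rcases eq_or_ne A [] with rfl | hA
  · refine hb v w (mem_tourEdges_of_mem_pathEdges ?_) hcol
    simp [pathEdges]
  rcases eq_or_ne B [] with rfl | hB
  · refine hb w v ?_ hcol.symm
    rw [tourEdges_eq (a := v) (b := w) (by simp [Ends, List.getLast?_cons])]
    simp
  obtain ⟨y, z, hyz⟩ := exists_ends hA
  obtain ⟨z', y', hyz'⟩ := exists_ends hB
  have hyA := hyz.left_mem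
  have hyB := hyz'.right_mem
  have hnn : v ∉ A ∧ v ≠ w ∧ v ∉ B ∧ w ∉ A ∧ w ∉ B ∧ A.Disjoint B := by
    simp only [List.nodup_cons, List.nodup_append, List.mem_append, List.mem_cons] at hn
    refine ⟨by tauto, hvw, by tauto, ?_, by tauto, ?_⟩
    · intro hwA; exact hn.2.2.2 w hwA w (Or.inl rfl) rfl
    · intro x hx hx'; exact hn.2.2.2 x hx x (Or.inr hx') rfl
  obtain ⟨hvA, -, hvB, hwA, hwB, hAB⟩ := hnn
  have hwBe : Ends (w :: B) w y' := (ends_singleton w).append hyz'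
  have hAwe : Ends (A ++ [w]) y w := hyz.append (ends_singleton w)
  have e₁ : s(v, y) ∈ tourEdges (v :: (A ++ w :: B)) := by
    refine mem_tourEdges_of_mem_pathEdges ?_
    exact mem_pathEdges_append (ends_singleton v) (hyz.append hwBe)
  have e₂ : s(v, y') ∈ tourEdges (v :: (A ++ w :: B)) := by
    have he : Ends (v :: (A ++ w :: B)) v y' := (ends_singleton v).append (hyz.append hwBe)
    rw [tourEdges_eq he, Sym2.eq_swap]
    simp
  have hyv : y ≠ v := fun h => hvA (h ▸ hyA)
  have hyv' : y' ≠ v := fun h => hvB (h ▸ hyB)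
  have hyw : y ≠ w := fun h => hwA (h ▸ hyA)
  have hyw' : y' ≠ w := fun h => hwB (h ▸ hyB)
  have hyy : y ≠ y' := fun h => hAB hyA (h ▸ hyB)
  -- Here `y` and `y'` are the tour neighbors of `v`. Seen from `v`, one of `y`, `w`, `y'` lies
  -- between the other two, so the chord from `v` to it separates them. For `vy` and `vy'` this
  -- would force a crossing with a part of the tour; for `vw` it contradicts `hs`.
  have c₁ : Inside s(v, y) w ↔ Inside s(v, y) y' := by
    by_contra hc
    obtain ⟨A', B', p, q, hpq, hA', hB', hx, -⟩ := exists_crossing hwBe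
      (x := v) (y := y) (by simp [hvw, hvB]) (by simp [hyw]; exact fun h => hAB hyA h) hc
    refine hno _ e₁ s(p, q) (mem_tourEdges_of_mem_pathEdges ?_) hx
    have := pathEdges_sublist (A := v :: A) (C := []) (mem_pathEdges_append hA' hB')
    simpa [← hpq] using this
  have c₂ : Inside s(v, y') y ↔ Inside s(v, y') w := by
    by_contra hc
    obtain ⟨A', B', p, q, hpq, hA', hB', hx, -⟩ := exists_crossing hAwe
      (x := v) (y := y') (by simp [hvw, hvA]) (by simp [hyw']; exact fun h => hAB h hyB) hc
    refine hno _ e₂ s(p, q) (mem_tourEdges_of_mem_pathEdges ?_) hx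
    have := pathEdges_sublist (A := [v]) (C := B) (mem_pathEdges_append hA' hB')
    simpa [← hpq] using this
  have c₃ := hs y (by simp [hyA]) y' (by simp [hyB]) hyv hyw hyv' hyw'
  simp only [inside_mk] at c₁ c₂ c₃
  omega

/-- A tour has at least half as many crossings as there are consecutive points of the same
color. -/
theorem cyclicMonoCount_le_total {col : ℕ → Bool} {c V : List ℕ} (h : IsTour col c)
    (hV : V.Pairwise (· < ·)) (hp : V.Perm c) :
    cyclicMonoCount col V ≤ total (tourEdges c) := by
  -- Splitting shortens both lists without making `total` larger; reversal and merging keep the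
  -- length and decrease `total`.
  induction hn : c.length + total (tourEdges c) using Nat.strong_induction_on
    generalizing c V with
  | _ n ih
  subst hn
  by_cases h₀ : total (tourEdges c) = 0
  · rw [h₀, Nat.le_zero]
    by_contra hm
    obtain ⟨x, y, hxy⟩ := exists_ends (fun hV0 => h.ne_nil (hV0 ▸ hp).symm.eq_nil : V ≠ [])
    rw [cyclicMonoCount, hxy.1, Option.toList_some] at hm
    obtain ⟨A, v, w, C, hVC, hvw⟩ := exists_of_monoCount_ne_zero hm
    -- If nothing follows, the monochromatic pair consists of the last and the first point, and all
    -- others lie inside the chord. Otherwise the pair is successive in `V`, and no point lies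
    -- inside.
    rcases List.eq_nil_or_concat C with rfl | ⟨C, z, rfl⟩
    · obtain ⟨rfl, hw⟩ : V = A ++ [v] ∧ x = w := by
        have : V ++ [x] = (A ++ [v]) ++ [w] := by simp [hVC]
        simpa using List.append_inj' this rfl
      subst hw
      have hvA : ∀ a ∈ A, a < v := by
        intro a ha
        exact (List.pairwise_append.1 hV).2.2 a ha v (by simp)
      -- On a single point the closing edge would be a loop, which is not bichromatic.
      rcases A with _ | ⟨a, A⟩
      · have hx : v = x := by simpa [Ends] using hxy.1
        have hc : c = [v] := (List.perm_singleton.1 (by simpa using hp.symm))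
        have := h.bichromatic v v (by simp [hc, tourEdges, pathEdges])
        exact this rfl
      · have hx : a = x := by simpa [Ends] using hxy.1
        subst hx
        have hav : a < v := hvA a (by simp)
        refine col_ne_of_consecutive h h₀ (v := v) (w := a) (hp.mem_iff.1 (by simp))
          (hp.mem_iff.1 (by simp)) (by omega) ?_ hvw
        have key : ∀ y ∈ c, y ≠ v → y ≠ a → Inside s(v, a) y := by
          intro y hy hyv hya
          have hy' := hp.mem_iff.2 hy
          simp only [List.cons_append, List.mem_cons, List.mem_append, List.not_mem_nil,
            or_false] at hy'
          have hyA : y ∈ A := by tauto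
          have h₁ := hvA y (by simp [hyA])
          rw [List.cons_append, List.pairwise_cons] at hV
          have h₂ := hV.1 y (by simp [hyA])
          rw [inside_mk]
          omega
        intro y hy z hz h₁ h₂ h₃ h₄
        exact ⟨fun _ => key z hz h₃ h₄, fun _ => key y hy h₁ h₂⟩
    · obtain ⟨rfl, hz⟩ : V = A ++ v :: w :: C ∧ x = z := by
        have : V ++ [x] = (A ++ v :: w :: C) ++ [z] := by simp [hVC]
        simpa using List.append_inj' this rfl
      have hV' := hV
      simp only [List.pairwise_append, List.pairwise_cons, List.mem_cons] at hV'
      have hlt : v < w := hV'.2.1.1 w (by simp)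
      refine col_ne_of_consecutive h h₀ (v := v) (w := w) (hp.mem_iff.1 (by simp))
        (hp.mem_iff.1 (by simp)) (by omega) ?_ hvw
      have key : ∀ y ∈ c, y ≠ v → y ≠ w → ¬ Inside s(v, w) y := by
        intro y hy hyv hyw
        have hy' := hp.mem_iff.2 hy
        simp only [List.mem_cons, List.mem_append] at hy'
        rw [inside_mk]
        rcases hy' with hy' | hy' | hy' | hy'
        · have := hV'.2.2 y hy' v (by simp)
          omega
        · exact absurd hy' hyv
        · exact absurd hy' hyw
        · have := hV'.2.1.2.1 y hy'
          omega
      intro y hy z hz h₁ h₂ h₃ h₄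
      exact ⟨fun hh => absurd hh (key y hy h₁ h₂), fun hh => absurd hh (key z hz h₃ h₄)⟩
  · obtain ⟨e, he, f, hf, hef⟩ := crSum_pos h₀
    obtain ⟨c', x₁, y₁, hcp, hcE, hc', rfl⟩ := exists_rotation he
    have hfp : f ∈ pathEdges c' := by
      rw [← hcE, tourEdges_eq hc', Multiset.mem_add, Multiset.mem_singleton] at hf
      rcases hf with hf | rfl
      · exact hf
      · exact absurd hef (not_crosses_self _)
    have h' := h.of_edges hcp hcE
    obtain ⟨P, Q, x₂, y₂, p, q, rfl, hP, hQ, rfl⟩ := exists_of_mem_pathEdges hfp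
    obtain rfl : p = y₁ := by
      have := (hP.append hQ).1; rw [hc'.1] at this; simpa using this.symm
    obtain rfl : q = x₁ := by
      have := (hP.append hQ).2; rw [hc'.2] at this; simpa using this.symm
    have hlen : (P ++ Q).length = c.length := hcp.length_eq
    by_cases hcol : col q = col x₂
    · obtain ⟨tP, tQ, hT⟩ := split_of_parallel hP hQ h' hef hcol
      have hdis : P.Disjoint Q := (List.nodup_append'.1 h'.nodup).2.2
      rw [hcE] at hT
      by_cases hPQ : crSum (tourEdges P) (tourEdges Q) = 0
      · rw [total_add, hPQ] at hT
        have hno : ∀ e ∈ pathEdges P, ∀ f ∈ pathEdges Q, ¬ Crosses e f := by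
          intro e he f hf hx
          obtain ⟨E, hE⟩ := Multiset.exists_cons_of_mem (mem_tourEdges_of_mem_pathEdges he)
          obtain ⟨F, hF⟩ := Multiset.exists_cons_of_mem (mem_tourEdges_of_mem_pathEdges hf)
          rw [hE, hF, ← Multiset.singleton_add, ← Multiset.singleton_add, crSum_add_left,
            crSum_add_right, crSum_singleton, cr, if_pos hx] at hPQ
          omega
        have hmem : ∀ x ∈ V, x ∈ P ∨ x ∈ Q := fun x hx =>
          List.mem_append.1 (hcp.mem_iff.2 (hp.mem_iff.1 hx))
        -- Two tours that do not cross have vertex sets that do not interleave, so one of the sets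
        -- is an interval of `V`.
        obtain ⟨A, B, C, t, rfl, hA, hB, hC⟩ := exists_interval (p := fun x => decide (x ∈ P)) hV (by
          intro a ha b hb x hx d hd hab hbc hcd hac hbd
          by_contra hne
          by_cases haP : a ∈ P
          · have hxP : x ∈ P := by simpa [haP] using hac
            have hbQ : b ∈ Q := (hmem b hb).resolve_left (by simpa [haP] using hne)
            have hdQ : d ∈ Q := (hmem d hd).resolve_left (by
              have h1 : b ∉ P := by simpa [haP] using hne
              simpa [h1] using hbd)
            exact not_interleaved hdis hno haP hxP hbQ hdQ (by rw [crosses_mk]; omega)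
          · have hxQ : x ∈ Q := (hmem x hx).resolve_left (by simpa [haP] using hac)
            have haQ : a ∈ Q := (hmem a ha).resolve_left haP
            have hbP : b ∈ P := by simpa [haP] using hne
            have hdP : d ∈ P := by simpa [hbP] using hbd
            exact not_interleaved hdis hno hbP hdP haQ hxQ (by rw [crosses_mk]; omega))
        have hperm : (A ++ B ++ C).Perm (P ++ Q) := hp.trans hcp.symm
        have hfP : (P ++ Q).filter (fun x => decide (x ∈ P)) = P := by
          rw [List.filter_append, List.filter_eq_self.2 (by simp),
            List.filter_eq_nil_iff.2 (fun a ha => by simpa using fun h => hdis h ha)]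
          simp
        have hfQ : (P ++ Q).filter (fun x => !decide (x ∈ P)) = Q := by
          rw [List.filter_append, List.filter_eq_nil_iff.2 (by simp),
            List.filter_eq_self.2 (fun a ha => by simpa using fun h => hdis h ha)]
          simp
        have hsub₁ : (A ++ C).Sublist (A ++ B ++ C) :=
          (List.sublist_append_left A B).append (List.Sublist.refl C)
        have hsub₂ : B.Sublist (A ++ B ++ C) :=
          (List.sublist_append_right A B).trans (List.sublist_append_left _ C)
        have hlenPQ : P.length + Q.length = c.length := by rw [← hlen, List.length_append]
        have hlP := List.length_pos_iff.2 hP.ne_nil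
        have hlQ := List.length_pos_iff.2 hQ.ne_nil
        have hf₁ := hperm.filter (fun x => decide (x ∈ P))
        have hf₂ := hperm.filter (fun x => !decide (x ∈ P))
        rw [hfP] at hf₁
        rw [hfQ] at hf₂
        cases t with
        | true =>
          have hAC : (A ++ B ++ C).filter (fun x => decide (x ∈ P)) = A ++ C :=
            filter_outer hA hB hC
          have hBB : (A ++ B ++ C).filter (fun x => !decide (x ∈ P)) = B :=
            filter_inner (fun a ha => by rw [hA a ha]; rfl) (fun a ha => by rw [hB a ha]; rfl)
              (fun a ha => by rw [hC a ha]; rfl)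
          rw [hAC] at hf₁
          rw [hBB] at hf₂
          have i₁ := ih _ (by omega) tP (hV.sublist hsub₁) hf₁ rfl
          have i₂ := ih _ (by omega) tQ (hV.sublist hsub₂) hf₂ rfl
          have hBne : B ≠ [] := by rintro rfl; exact hQ.ne_nil hf₂.symm.eq_nil
          -- If `A` is empty, `B` comes first and `C` is regarded as the interval that is cut out.
          rcases eq_or_ne A [] with rfl | hAne
          · have := cyclicMonoCount_interval_le (col := col) (A := B) (B := C) (C := []) hBne
              (by rintro rfl; exact hP.ne_nil hf₁.symm.eq_nil)
            simp only [List.append_nil, List.nil_append] at this i₁ ⊢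
            omega
          · have := cyclicMonoCount_interval_le (col := col) (C := C) hAne hBne
            omega
        | false =>
          have hAC : (A ++ B ++ C).filter (fun x => !decide (x ∈ P)) = A ++ C :=
            filter_outer (fun a ha => by rw [hA a ha]; rfl) (fun a ha => by rw [hB a ha]; rfl)
              (fun a ha => by rw [hC a ha]; rfl)
          have hBB : (A ++ B ++ C).filter (fun x => decide (x ∈ P)) = B :=
            filter_inner hA hB hC
          rw [hAC] at hf₂
          rw [hBB] at hf₁
          have i₁ := ih _ (by omega) tQ (hV.sublist hsub₁) hf₂ rfl
          have i₂ := ih _ (by omega) tP (hV.sublist hsub₂) hf₁ rfl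
          have hBne : B ≠ [] := by rintro rfl; exact hP.ne_nil hf₁.symm.eq_nil
          rcases eq_or_ne A [] with rfl | hAne
          · have := cyclicMonoCount_interval_le (col := col) (A := B) (B := C) (C := []) hBne
              (by rintro rfl; exact hQ.ne_nil hf₂.symm.eq_nil)
            simp only [List.append_nil, List.nil_append] at this i₁ ⊢
            omega
          · have := cyclicMonoCount_interval_le (col := col) (C := C) hAne hBne
            omega
      -- Merging the two crossing parts restores a tour on all points with smaller `total` than the
      -- original.
      · obtain ⟨a, ha, b, hb, hab⟩ := crSum_pos hPQ
        obtain ⟨d, hd₁, hd₂, hd₃⟩ := exists_merge tP tQ hdis ha hb hab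
        have hdc := hd₁.trans hcp
        have := ih _ (by rw [hdc.length_eq]; omega) hd₂ hV (hp.trans hdc.symm) rfl
        omega
    · obtain ⟨d, hd₁, hd₂, hd₃⟩ := improvable_of_antiparallel hP hQ h' hef hcol
      rw [hcE] at hd₃
      have hdc := hd₁.trans hcp
      have := ih _ (by rw [hdc.length_eq]; omega) hd₂ hV (hp.trans hdc.symm) rfl
      omega

end Chord

/-! ## Rotations -/

namespace Chord

/-- The rotation of the circular order of `0, …, M - 1` by `s` places. -/
def rot (M s v : ℕ) : ℕ := if v + s < M then v + s else v + s - M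

theorem rot_lt {M s v : ℕ} (hs : s ≤ M) (hv : v < M) : rot M s v < M := by
  unfold rot; split_ifs <;> omega

theorem rot_injOn {M s v w : ℕ} (hv : v < M) (hw : w < M)
    (h : rot M s v = rot M s w) : v = w := by
  unfold rot at h; split_ifs at h <;> omega

theorem rot_rot {M s v : ℕ} (hs : s ≤ M) (hv : v < M) : rot M (M - s) (rot M s v) = v := by
  unfold rot; split_ifs <;> omega

/-- Interleaving depends only on the circular order. Hence one endpoint may be assumed to be `0`,
which turns circular case distinctions into linear ones. -/
theorem crosses_rot {M s a b c d : ℕ} (ha : a < M) (hb : b < M) (hc : c < M)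
    (hd : d < M) : Crosses s(rot M s a, rot M s b) s(rot M s c, rot M s d) ↔
      Crosses s(a, b) s(c, d) := by
  wlog hab : a ≤ b generalizing a b
  · rw [Sym2.eq_swap, Sym2.eq_swap (a := a)]; exact this hb ha (by omega)
  wlog hcd : c ≤ d generalizing c d
  · rw [Sym2.eq_swap (a := rot M s c), Sym2.eq_swap (a := c)]; exact this hd hc (by omega)
  rw [crosses_mk_of_le hab hcd, crosses_mk]
  unfold rot
  by_cases h₁ : a + s < M <;> by_cases h₂ : b + s < M <;> by_cases h₃ : c + s < M <;>
    by_cases h₄ : d + s < M <;> simp only [h₁, h₂, h₃, h₄, if_true, if_false] <;> omega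

theorem cr_rot {M s a b c d : ℕ} (ha : a < M) (hb : b < M) (hc : c < M)
    (hd : d < M) : cr s(rot M s a, rot M s b) s(rot M s c, rot M s d) = cr s(a, b) s(c, d) := by
  unfold cr; simp only [crosses_rot ha hb hc hd]

/-- By `c₁`, `c₂` and `c₄`, none of the three sequences of uncrossings that realize the exchange is
available; by `hs`, the points `x₂` and `x₃` lie on different sides of `s(0, y₁)`. Of all orders of
the six points, just one and its mirror image survive. -/
theorem order_of_zero {y₁ x₂ y₂ x₃ y₃ : ℕ}
    (h₂ : x₂ ≠ x₃ ∧ x₂ ≠ y₃ ∧ y₂ ≠ x₃ ∧ y₂ ≠ y₃)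
    (hf : Crosses s(0, y₁) s(x₂, y₂)) (hg : Crosses s(0, y₁) s(x₃, y₃))
    (hs : Crosses s(0, y₁) s(x₂, x₃))
    (c₁ : ¬ Crosses s(x₂, y₁) s(x₃, y₃)) (c₂ : ¬ Crosses s(0, y₃) s(x₂, y₂))
    (c₄ : ¬ (Crosses s(y₂, y₁) s(x₃, y₃) ∧ Crosses s(0, x₂) s(y₃, y₂))) :
    (0 < x₃ ∧ x₃ < y₂ ∧ y₂ < y₁ ∧ y₁ < x₂ ∧ x₂ < y₃) ∨
      (0 < y₃ ∧ y₃ < x₂ ∧ x₂ < y₁ ∧ y₁ < y₂ ∧ y₂ < x₃) := by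
  have h0 : 0 < y₁ := by rw [crosses_mk] at hf; omega
  have hf := hf.order h0
  have hg := hg.order h0
  have hs := hs.order h0
  rcases hf with h | h | h | h <;> rcases hg with h' | h' | h' | h' <;> try omega
  all_goals
    by_contra hcon
    simp only [crosses_mk] at c₁ c₂ c₄
    omega

/-- A hexagon whose chords `w₀w₃`, `w₂w₄`, `w₁w₅` are exchanged for `w₀w₂`, `w₄w₅`, `w₁w₃`. The only
chords that meet more of the new ones lead from the arc `w₁w₂` to the arc `w₄w₅`, thus cross `w₀w₃`
between the two other old chords. -/
theorem between_of_sides_lt {w₀ w₁ w₂ w₃ w₄ w₅ p q : ℕ} (hpq : p ≤ q) (h₀ : w₀ < w₁)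
    (h₁ : w₁ < w₂) (h₂ : w₂ < w₃) (h₃ : w₃ < w₄) (h₄ : w₄ < w₅)
    (hk : cr s(p, q) s(w₀, w₃) + cr s(p, q) s(w₂, w₄) + cr s(p, q) s(w₁, w₅) <
      cr s(p, q) s(w₀, w₂) + cr s(p, q) s(w₄, w₅) + cr s(p, q) s(w₁, w₃)) :
    w₁ ≤ p ∧ p ≤ w₂ ∧ w₄ ≤ q ∧ q ≤ w₅ := by
  rw [cr_mk_of_le hpq (by omega), cr_mk_of_le hpq (by omega), cr_mk_of_le hpq (by omega),
    cr_mk_of_le hpq (by omega), cr_mk_of_le hpq (by omega), cr_mk_of_le hpq (by omega)] at hk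
  split_ifs at hk <;> omega

/-- The mirror image of the previous lemma, with `wᵢ` and `w₆₋ᵢ` interchanged for positive `i`. -/
theorem between_of_sides_lt' {w₀ w₁ w₂ w₃ w₄ w₅ p q : ℕ} (hpq : p ≤ q) (h₀ : w₀ < w₁)
    (h₁ : w₁ < w₂) (h₂ : w₂ < w₃) (h₃ : w₃ < w₄) (h₄ : w₄ < w₅)
    (hk : cr s(p, q) s(w₀, w₃) + cr s(p, q) s(w₂, w₄) + cr s(p, q) s(w₁, w₅) <
      cr s(p, q) s(w₀, w₄) + cr s(p, q) s(w₁, w₂) + cr s(p, q) s(w₃, w₅)) :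
    w₁ ≤ p ∧ p ≤ w₂ ∧ w₄ ≤ q ∧ q ≤ w₅ := by
  rw [cr_mk_of_le hpq (by omega), cr_mk_of_le hpq (by omega), cr_mk_of_le hpq (by omega),
    cr_mk_of_le hpq (by omega), cr_mk_of_le hpq (by omega), cr_mk_of_le hpq (by omega)] at hk
  split_ifs at hk <;> omega

/-- Two chords `s(x₂, y₂)` and `s(x₃, y₃)` that cross `s(0, y₁)` in opposite directions, in the
situation in which no sequence of uncrossings leads to the chords `s(0, y₂)`, `s(x₂, y₃)` and
`s(x₃, y₁)`: an exchange of the three chords for these is nevertheless an improvement, unless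
there is another chord that crosses `s(0, y₁)` between the two given ones. -/
theorem exchange_zero {y₁ x₂ y₂ x₃ y₃ : ℕ}
    (h₂ : x₂ ≠ x₃ ∧ x₂ ≠ y₃ ∧ y₂ ≠ x₃ ∧ y₂ ≠ y₃)
    (hf : Crosses s(0, y₁) s(x₂, y₂)) (hg : Crosses s(0, y₁) s(x₃, y₃))
    (hs : Crosses s(0, y₁) s(x₂, x₃))
    (c₁ : ¬ Crosses s(x₂, y₁) s(x₃, y₃)) (c₂ : ¬ Crosses s(0, y₃) s(x₂, y₂))
    (c₄ : ¬ (Crosses s(y₂, y₁) s(x₃, y₃) ∧ Crosses s(0, x₂) s(y₃, y₂))) :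
    cr s(0, y₂) s(x₂, y₃) + cr s(0, y₂) s(x₃, y₁) + cr s(x₂, y₃) s(x₃, y₁) <
      cr s(0, y₁) s(x₂, y₂) + cr s(0, y₁) s(x₃, y₃) + cr s(x₂, y₂) s(x₃, y₃) ∧
    ∀ u v, cr s(u, v) s(0, y₁) + cr s(u, v) s(x₂, y₂) + cr s(u, v) s(x₃, y₃) <
        cr s(u, v) s(0, y₂) + cr s(u, v) s(x₂, y₃) + cr s(u, v) s(x₃, y₁) →
      Crosses s(0, y₁) s(u, v) ∧ (u ≠ x₂ → u ≠ y₂ → u ≠ x₃ → u ≠ y₃ → v ≠ x₂ → v ≠ y₂ → v ≠ x₃ →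
        v ≠ y₃ → Crosses s(u, y₁) s(x₂, y₂) ∧ Crosses s(x₃, y₁) s(u, v)) := by
  have hord := order_of_zero h₂ hf hg hs c₁ c₂ c₄
  have h₁ : cr s(0, y₁) s(x₂, y₂) = 1 := if_pos hf
  have h₃ : cr s(0, y₁) s(x₃, y₃) = 1 := if_pos hg
  refine ⟨?_, ?_⟩
  -- The old chords have at least their two crossings with `s(0, y₁)`; of the new ones, only `s(0,
  -- y₂)` and `s(x₃, y₁)` can cross.
  · rcases hord with ⟨o₁, o₂, o₃, o₄, o₅⟩ | ⟨o₁, o₂, o₃, o₄, o₅⟩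
    · have n₁ : cr s(0, y₂) s(x₂, y₃) = 0 := if_neg (by rw [crosses_mk]; omega)
      have n₂ : cr s(x₂, y₃) s(x₃, y₁) = 0 := if_neg (by rw [crosses_mk]; omega)
      have n₃ : cr s(0, y₂) s(x₃, y₁) ≤ 1 := by unfold cr; split_ifs <;> omega
      omega
    · have n₁ : cr s(0, y₂) s(x₂, y₃) = 0 := if_neg (by rw [crosses_mk]; omega)
      have n₂ : cr s(x₂, y₃) s(x₃, y₁) = 0 := if_neg (by rw [crosses_mk]; omega)
      have n₃ : cr s(0, y₂) s(x₃, y₁) ≤ 1 := by unfold cr; split_ifs <;> omega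
      omega
  · intro u v hk
    have key : ∀ p q, p ≤ q → cr s(p, q) s(0, y₁) + cr s(p, q) s(x₂, y₂) + cr s(p, q) s(x₃, y₃) <
        cr s(p, q) s(0, y₂) + cr s(p, q) s(x₂, y₃) + cr s(p, q) s(x₃, y₁) →
        (0 < x₃ ∧ x₃ < y₂ ∧ y₂ < y₁ ∧ y₁ < x₂ ∧ x₂ < y₃ ∧ x₃ ≤ p ∧ p ≤ y₂ ∧ x₂ ≤ q ∧ q ≤ y₃) ∨
        (0 < y₃ ∧ y₃ < x₂ ∧ x₂ < y₁ ∧ y₁ < y₂ ∧ y₂ < x₃ ∧ y₃ ≤ p ∧ p ≤ x₂ ∧ y₂ ≤ q ∧ q ≤ x₃) := by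
      intro p q hpq hk
      rcases hord with ⟨o₁, o₂, o₃, o₄, o₅⟩ | ⟨o₁, o₂, o₃, o₄, o₅⟩
      · rw [Sym2.eq_swap (a := x₂) (b := y₂)] at hk
        exact Or.inl ⟨o₁, o₂, o₃, o₄, o₅, between_of_sides_lt hpq o₁ o₂ o₃ o₄ o₅ hk⟩
      · rw [Sym2.eq_swap (a := x₃) (b := y₃), Sym2.eq_swap (a := x₂) (b := y₃),
          Sym2.eq_swap (a := x₃) (b := y₁)] at hk
        exact Or.inr ⟨o₁, o₂, o₃, o₄, o₅, between_of_sides_lt' hpq o₁ o₂ o₃ o₄ o₅ hk⟩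
    -- The conclusion about `s(p, y₁)` is proved for `s(q, y₁)` too, since it is not known which of
    -- `u` and `v` is the smaller endpoint.
    have fin : ∀ p q, p ≤ q → cr s(p, q) s(0, y₁) + cr s(p, q) s(x₂, y₂) + cr s(p, q) s(x₃, y₃) <
        cr s(p, q) s(0, y₂) + cr s(p, q) s(x₂, y₃) + cr s(p, q) s(x₃, y₁) →
        Crosses s(0, y₁) s(p, q) ∧ (p ≠ x₂ → p ≠ y₂ → p ≠ x₃ → p ≠ y₃ → q ≠ x₂ → q ≠ y₂ →
          q ≠ x₃ → q ≠ y₃ → Crosses s(p, y₁) s(x₂, y₂) ∧ Crosses s(q, y₁) s(x₂, y₂) ∧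
            Crosses s(x₃, y₁) s(p, q)) := by
      intro p q hpq hk
      rcases key p q hpq hk with ⟨o₁, o₂, o₃, o₄, o₅, r₁, r₂, r₃, r₄⟩ |
        ⟨o₁, o₂, o₃, o₄, o₅, r₁, r₂, r₃, r₄⟩
      · refine ⟨(crosses_mk_of_le (by omega) hpq).2 (by omega), fun _ h₁ h₂ _ h₃ _ _ h₄ => ?_⟩
        have r₁ := lt_of_le_of_ne r₁ h₂.symm
        have r₂ := lt_of_le_of_ne r₂ h₁
        have r₃ := lt_of_le_of_ne r₃ h₃.symm
        have r₄ := lt_of_le_of_ne r₄ h₄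
        rw [Sym2.eq_swap (a := x₂), Sym2.eq_swap (a := q)]
        exact ⟨(crosses_mk_of_le (by omega) (by omega)).2 (by omega),
          (crosses_mk_of_le (by omega) (by omega)).2 (by omega),
          (crosses_mk_of_le (by omega) (by omega)).2 (by omega)⟩
      · refine ⟨(crosses_mk_of_le (by omega) hpq).2 (by omega), fun h₁ _ _ h₂ _ h₃ h₄ _ => ?_⟩
        have r₁ := lt_of_le_of_ne r₁ h₂.symm
        have r₂ := lt_of_le_of_ne r₂ h₁
        have r₃ := lt_of_le_of_ne r₃ h₃.symm
        have r₄ := lt_of_le_of_ne r₄ h₄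
        rw [Sym2.eq_swap (a := x₃), Sym2.eq_swap (a := q)]
        exact ⟨(crosses_mk_of_le (by omega) (by omega)).2 (by omega),
          (crosses_mk_of_le (by omega) (by omega)).2 (by omega),
          (crosses_mk_of_le (by omega) (by omega)).2 (by omega)⟩
    rcases le_total u v with huv | huv
    · obtain ⟨h, h'⟩ := fin u v huv hk
      exact ⟨h, fun a b c d e f g i => ⟨(h' a b c d e f g i).1, (h' a b c d e f g i).2.2⟩⟩
    · rw [Sym2.eq_swap (a := u) (b := v)] at hk ⊢
      obtain ⟨h, h'⟩ := fin v u huv hk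
      exact ⟨h, fun a b c d e f g i => ⟨(h' e f g i a b c d).2.1, (h' e f g i a b c d).2.2⟩⟩

theorem exchange_facts {x₁ y₁ x₂ y₂ x₃ y₃ : ℕ}
    (h₂ : x₂ ≠ x₃ ∧ x₂ ≠ y₃ ∧ y₂ ≠ x₃ ∧ y₂ ≠ y₃)
    (hf : Crosses s(x₁, y₁) s(x₂, y₂)) (hg : Crosses s(x₁, y₁) s(x₃, y₃))
    (hs : Crosses s(x₁, y₁) s(x₂, x₃))
    (c₁ : ¬ Crosses s(x₂, y₁) s(x₃, y₃)) (c₂ : ¬ Crosses s(x₁, y₃) s(x₂, y₂))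
    (c₄ : ¬ (Crosses s(y₂, y₁) s(x₃, y₃) ∧ Crosses s(x₁, x₂) s(y₃, y₂))) :
    cr s(x₁, y₂) s(x₂, y₃) + cr s(x₁, y₂) s(x₃, y₁) + cr s(x₂, y₃) s(x₃, y₁) <
      cr s(x₁, y₁) s(x₂, y₂) + cr s(x₁, y₁) s(x₃, y₃) + cr s(x₂, y₂) s(x₃, y₃) ∧
    ∀ u v, cr s(u, v) s(x₁, y₁) + cr s(u, v) s(x₂, y₂) + cr s(u, v) s(x₃, y₃) <
        cr s(u, v) s(x₁, y₂) + cr s(u, v) s(x₂, y₃) + cr s(u, v) s(x₃, y₁) →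
      Crosses s(x₁, y₁) s(u, v) ∧ (u ≠ x₂ → u ≠ y₂ → u ≠ x₃ → u ≠ y₃ → v ≠ x₂ → v ≠ y₂ → v ≠ x₃ →
        v ≠ y₃ → Crosses s(u, y₁) s(x₂, y₂) ∧ Crosses s(x₃, y₁) s(u, v)) := by
  have main : ∀ u v,
      cr s(x₁, y₂) s(x₂, y₃) + cr s(x₁, y₂) s(x₃, y₁) + cr s(x₂, y₃) s(x₃, y₁) <
      cr s(x₁, y₁) s(x₂, y₂) + cr s(x₁, y₁) s(x₃, y₃) + cr s(x₂, y₂) s(x₃, y₃) ∧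
    (cr s(u, v) s(x₁, y₁) + cr s(u, v) s(x₂, y₂) + cr s(u, v) s(x₃, y₃) <
        cr s(u, v) s(x₁, y₂) + cr s(u, v) s(x₂, y₃) + cr s(u, v) s(x₃, y₁) →
      Crosses s(x₁, y₁) s(u, v) ∧ (u ≠ x₂ → u ≠ y₂ → u ≠ x₃ → u ≠ y₃ → v ≠ x₂ → v ≠ y₂ → v ≠ x₃ →
        v ≠ y₃ → Crosses s(u, y₁) s(x₂, y₂) ∧ Crosses s(x₃, y₁) s(u, v))) := by
    intro u v
    -- Any modulus above all the labels will do; the rotation by `M - x₁` moves `x₁` to `0`.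
    obtain ⟨M, hM⟩ : ∃ M, M = x₁ + y₁ + x₂ + y₂ + x₃ + y₃ + u + v + 1 := ⟨_, rfl⟩
    have l₁ : x₁ < M := by omega
    have m₁ : y₁ < M := by omega
    have l₂ : x₂ < M := by omega
    have m₂ : y₂ < M := by omega
    have l₃ : x₃ < M := by omega
    have m₃ : y₃ < M := by omega
    have hu : u < M := by omega
    have hv : v < M := by omega
    have hsM : M - x₁ ≤ M := by omega
    have h0 : rot M (M - x₁) x₁ = 0 := by unfold rot; split_ifs <;> omega
    have hne : ∀ a b, a < M → b < M → a ≠ b → rot M (M - x₁) a ≠ rot M (M - x₁) b :=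
      fun a b ha hb h h' => h (rot_injOn ha hb h')
    have := exchange_zero (y₁ := rot M (M - x₁) y₁) (x₂ := rot M (M - x₁) x₂)
      (y₂ := rot M (M - x₁) y₂) (x₃ := rot M (M - x₁) x₃) (y₃ := rot M (M - x₁) y₃)
      ⟨hne _ _ l₂ l₃ h₂.1, hne _ _ l₂ m₃ h₂.2.1, hne _ _ m₂ l₃ h₂.2.2.1, hne _ _ m₂ m₃ h₂.2.2.2⟩
    rw [← h0, crosses_rot l₁ m₁ l₂ m₂, crosses_rot l₁ m₁ l₃ m₃,
      crosses_rot l₁ m₁ l₂ l₃, crosses_rot l₂ m₁ l₃ m₃, crosses_rot l₁ m₃ l₂ m₂,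
      crosses_rot m₂ m₁ l₃ m₃, crosses_rot l₁ l₂ m₃ m₂, cr_rot l₁ m₂ l₂ m₃,
      cr_rot l₁ m₂ l₃ m₁, cr_rot l₂ m₃ l₃ m₁, cr_rot l₁ m₁ l₂ m₂,
      cr_rot l₁ m₁ l₃ m₃, cr_rot l₂ m₂ l₃ m₃] at this
    have := this hf hg hs c₁ c₂ c₄
    refine ⟨this.1, fun hk => ?_⟩
    have := this.2 (rot M (M - x₁) u) (rot M (M - x₁) v)
    rw [cr_rot hu hv l₁ m₁, cr_rot hu hv l₂ m₂, cr_rot hu hv l₃ m₃,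
      cr_rot hu hv l₁ m₂, cr_rot hu hv l₂ m₃, cr_rot hu hv l₃ m₁,
      crosses_rot l₁ m₁ hu hv, crosses_rot hu m₁ l₂ m₂,
      crosses_rot l₃ m₁ hu hv] at this
    exact ⟨(this hk).1, fun d₁ d₂ d₃ d₄ d₅ d₆ d₇ d₈ => (this hk).2 (hne _ _ hu l₂ d₁)
      (hne _ _ hu m₂ d₂) (hne _ _ hu l₃ d₃) (hne _ _ hu m₃ d₄) (hne _ _ hv l₂ d₅)
      (hne _ _ hv m₂ d₆) (hne _ _ hv l₃ d₇) (hne _ _ hv m₃ d₈)⟩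
  exact ⟨(main 0 0).1, fun u v => (main u v).2⟩

end Chord

/-! ## Tours with the minimum number of crossings are 1-plane -/

namespace Chord

/-- Exchange of two successive segments of a tour. -/
theorem improvable_of_exchange {col : ℕ → Bool} {P₁ P₂ P₃ : List ℕ} {x₁ y₁ x₂ y₂ x₃ y₃ : ℕ}
    (h₁ : Ends P₁ y₁ x₂) (h₂ : Ends P₂ y₂ x₃) (h₃ : Ends P₃ y₃ x₁)
    (h : IsTour col (P₁ ++ (P₂ ++ P₃))) (c₂ : col x₁ = col x₂) (c₃ : col x₁ = col x₃)
    (hlt : total ({s(x₁, y₂)} + {s(x₂, y₃)} + {s(x₃, y₁)} +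
        (pathEdges P₁ + pathEdges P₂ + pathEdges P₃)) <
      total ({s(x₁, y₁)} + {s(x₂, y₂)} + {s(x₃, y₃)} +
        (pathEdges P₁ + pathEdges P₂ + pathEdges P₃))) :
    Improvable col (P₁ ++ (P₂ ++ P₃)) := by
  have hE : tourEdges (P₁ ++ (P₂ ++ P₃)) = {s(x₁, y₁)} + {s(x₂, y₂)} + {s(x₃, y₃)} +
        (pathEdges P₁ + pathEdges P₂ + pathEdges P₃) := by
    rw [tourEdges_append h₁ (h₂.append h₃), pathEdges_append h₂ h₃]; abel
  have hE' : tourEdges (P₁ ++ (P₃ ++ P₂)) = {s(x₁, y₂)} + {s(x₂, y₃)} + {s(x₃, y₁)} +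
        (pathEdges P₁ + pathEdges P₂ + pathEdges P₃) := by
    rw [tourEdges_append h₁ (h₃.append h₂), pathEdges_append h₃ h₂]; abel
  have hp : (P₁ ++ (P₃ ++ P₂)).Perm (P₁ ++ (P₂ ++ P₃)) :=
    (List.perm_append_comm).append_left P₁
  have hb := h.bichromatic
  refine ⟨_, hp, h.of_perm hp ?_, by rwa [hE, hE']⟩
  rw [hE] at hb
  rw [hE']
  simp only [bichromatic_add, bichromatic_singleton] at hb ⊢
  obtain ⟨⟨⟨b₁, b₂⟩, b₃⟩, b₄⟩ := hb
  exact ⟨⟨⟨c₂ ▸ b₂, by rw [← c₂, c₃]; exact b₃⟩, c₃ ▸ b₁⟩, b₄⟩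

section

variable {col : ℕ → Bool} {P₁ P₂ P₃ : List ℕ} {x₁ y₁ x₂ y₂ x₃ y₃ : ℕ}

/-- If the crossings of an edge with two others are not both traversed in a parallel way, the tour
can be improved. -/
theorem improvable_of_col_ne (h₁ : Ends P₁ y₁ x₂) (h₂ : Ends P₂ y₂ x₃) (h₃ : Ends P₃ y₃ x₁)
    (h : IsTour col (P₁ ++ (P₂ ++ P₃)))
    (hf : Crosses s(x₁, y₁) s(x₂, y₂)) (hg : Crosses s(x₁, y₁) s(x₃, y₃))
    (hc : ¬ (col x₁ = col x₂ ∧ col x₁ = col x₃)) : Improvable col (P₁ ++ (P₂ ++ P₃)) := by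
  by_cases c₂ : col x₁ = col x₂
  · rw [← List.append_assoc] at h ⊢
    exact improvable_of_antiparallel (h₁.append h₂) h₃ h hg (fun c₃ => hc ⟨c₂, c₃⟩)
  · exact improvable_of_antiparallel h₁ (h₂.append h₃) h hf c₂

/-- Uncrossing `x₁y₁` and `x₂y₂` splits the tour and creates `x₂y₁`; uncrossing this with `x₃y₃`
reconnects the tour. The result is the exchange of the two segments. -/
theorem improvable_of_uncross_left (h₁ : Ends P₁ y₁ x₂) (h₂ : Ends P₂ y₂ x₃) (h₃ : Ends P₃ y₃ x₁)
    (h : IsTour col (P₁ ++ (P₂ ++ P₃)))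
    (hf : Crosses s(x₁, y₁) s(x₂, y₂)) (hg : Crosses s(x₁, y₁) s(x₃, y₃))
    (hx : Crosses s(x₂, y₁) s(x₃, y₃)) : Improvable col (P₁ ++ (P₂ ++ P₃)) := by
  by_cases hc : col x₁ = col x₂ ∧ col x₁ = col x₃
  · refine improvable_of_exchange h₁ h₂ h₃ h hc.1 hc.2 ?_
    generalize pathEdges P₁ + pathEdges P₂ + pathEdges P₃ = R
    have i₁ := total_uncross hf ({s(x₃, y₃)} + R)
    have i₂ := total_uncross hx ({s(x₁, y₂)} + R)
    rw [show {s(x₁, y₂)} + {s(x₂, y₁)} + ({s(x₃, y₃)} + R) =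
      {s(x₂, y₁)} + {s(x₃, y₃)} + ({s(x₁, y₂)} + R) by abel] at i₁
    rw [show {s(x₁, y₂)} + {s(x₂, y₃)} + {s(x₃, y₁)} + R =
      {s(x₂, y₃)} + {s(x₃, y₁)} + ({s(x₁, y₂)} + R) by abel, add_assoc ({s(x₁, y₁)} + _)]
    omega
  · exact improvable_of_col_ne h₁ h₂ h₃ h hf hg hc

/-- The same exchange, reached by uncrossing `x₁y₁` with `x₃y₃` and the resulting chord `x₁y₃` with
`x₂y₂`. -/
theorem improvable_of_uncross_right (h₁ : Ends P₁ y₁ x₂) (h₂ : Ends P₂ y₂ x₃)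
    (h₃ : Ends P₃ y₃ x₁) (h : IsTour col (P₁ ++ (P₂ ++ P₃)))
    (hf : Crosses s(x₁, y₁) s(x₂, y₂)) (hg : Crosses s(x₁, y₁) s(x₃, y₃))
    (hx : Crosses s(x₁, y₃) s(x₂, y₂)) : Improvable col (P₁ ++ (P₂ ++ P₃)) := by
  by_cases hc : col x₁ = col x₂ ∧ col x₁ = col x₃
  · refine improvable_of_exchange h₁ h₂ h₃ h hc.1 hc.2 ?_
    generalize pathEdges P₁ + pathEdges P₂ + pathEdges P₃ = R
    have i₁ := total_uncross hg ({s(x₂, y₂)} + R)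
    have i₂ := total_uncross hx ({s(x₃, y₁)} + R)
    rw [show {s(x₁, y₃)} + {s(x₃, y₁)} + ({s(x₂, y₂)} + R) =
      {s(x₁, y₃)} + {s(x₂, y₂)} + ({s(x₃, y₁)} + R) by abel] at i₁
    rw [show {s(x₁, y₂)} + {s(x₂, y₃)} + {s(x₃, y₁)} + R =
      {s(x₁, y₂)} + {s(x₂, y₃)} + ({s(x₃, y₁)} + R) by abel,
      show {s(x₁, y₁)} + {s(x₂, y₂)} + {s(x₃, y₃)} + R =
      {s(x₁, y₁)} + {s(x₃, y₃)} + ({s(x₂, y₂)} + R) by abel]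
    omega
  · exact improvable_of_col_ne h₁ h₂ h₃ h hf hg hc

/-- The same exchange by three uncrossings: the first gives `x₁x₂` and `y₂y₁`, the second replaces
`y₂y₁`, `x₃y₃` by `y₂y₃`, `x₃y₁`, and the third replaces `x₁x₂`, `y₃y₂` by `x₁y₂`, `y₃x₂`.
Intermediate chords may be monochromatic; only the final ones have to belong to a tour. -/
theorem improvable_of_hexagon (h₁ : Ends P₁ y₁ x₂) (h₂ : Ends P₂ y₂ x₃)
    (h₃ : Ends P₃ y₃ x₁) (h : IsTour col (P₁ ++ (P₂ ++ P₃)))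
    (hf : Crosses s(x₁, y₁) s(x₂, y₂)) (hg : Crosses s(x₁, y₁) s(x₃, y₃))
    (hx : Crosses s(y₂, y₁) s(x₃, y₃)) (hx' : Crosses s(x₁, x₂) s(y₃, y₂)) :
    Improvable col (P₁ ++ (P₂ ++ P₃)) := by
  by_cases hc : col x₁ = col x₂ ∧ col x₁ = col x₃
  · refine improvable_of_exchange h₁ h₂ h₃ h hc.1 hc.2 ?_
    generalize pathEdges P₁ + pathEdges P₂ + pathEdges P₃ = R
    rw [Sym2.eq_swap (a := x₂) (b := y₂)] at hf ⊢
    have i₁ := total_uncross hf ({s(x₃, y₃)} + R)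
    have i₂ := total_uncross hx ({s(x₁, x₂)} + R)
    have i₃ := total_uncross hx' ({s(x₃, y₁)} + R)
    rw [show {s(x₁, x₂)} + {s(y₂, y₁)} + ({s(x₃, y₃)} + R) =
      {s(y₂, y₁)} + {s(x₃, y₃)} + ({s(x₁, x₂)} + R) by abel] at i₁
    rw [show {s(y₂, y₃)} + {s(x₃, y₁)} + ({s(x₁, x₂)} + R) =
      {s(x₁, x₂)} + {s(y₃, y₂)} + ({s(x₃, y₁)} + R) by rw [Sym2.eq_swap (a := y₂)]; abel] at i₂
    rw [show {s(x₁, y₂)} + {s(x₂, y₃)} + {s(x₃, y₁)} + R =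
      {s(x₁, y₂)} + {s(y₃, x₂)} + ({s(x₃, y₁)} + R) by rw [Sym2.eq_swap (a := x₂)]; abel,
      add_assoc ({s(x₁, y₁)} + _)]
    omega
  · exact improvable_of_col_ne h₁ h₂ h₃ h hf hg hc

end

/-- A tour can be improved if one of its edges crosses two others. -/
theorem improvable_of_two_crossings {col : ℕ → Bool} {P₁ P₂ P₃ : List ℕ}
    {x₁ y₁ x₂ y₂ x₃ y₃ : ℕ} (h₁ : Ends P₁ y₁ x₂) (h₂ : Ends P₂ y₂ x₃) (h₃ : Ends P₃ y₃ x₁)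
    (h : IsTour col (P₁ ++ (P₂ ++ P₃)))
    (hf : Crosses s(x₁, y₁) s(x₂, y₂)) (hg : Crosses s(x₁, y₁) s(x₃, y₃)) :
    Improvable col (P₁ ++ (P₂ ++ P₃)) := by
  -- Induction on the length of the segment between the two crossing edges: a third edge there that
  -- crosses `x₁y₁` replaces `x₃y₃`.
  induction hn : P₂.length using Nat.strong_induction_on generalizing P₂ P₃ x₃ y₃ with
  | _ n ih
  subst hn
  by_cases hc : col x₁ = col x₂ ∧ col x₁ = col x₃
  swap
  · exact improvable_of_col_ne h₁ h₂ h₃ h hf hg hc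
  by_cases c₁ : Crosses s(x₂, y₁) s(x₃, y₃)
  · exact improvable_of_uncross_left h₁ h₂ h₃ h hf hg c₁
  by_cases c₂ : Crosses s(x₁, y₃) s(x₂, y₂)
  · exact improvable_of_uncross_right h₁ h₂ h₃ h hf hg c₂
  by_cases c₄ : Crosses s(y₂, y₁) s(x₃, y₃) ∧ Crosses s(x₁, x₂) s(y₃, y₂)
  · exact improvable_of_hexagon h₁ h₂ h₃ h hf hg c₄.1 c₄.2
  -- a crossing of the first edge inside the middle segment gives a shorter middle segment
  have hmid : ∀ A B u v, P₂ = A ++ B → Ends A y₂ u → Ends B v x₃ → Crosses s(x₁, y₁) s(u, v) →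
      Improvable col (P₁ ++ (P₂ ++ P₃)) := by
    rintro A B u v rfl hA hB hx
    rw [List.append_assoc] at h ⊢
    refine ih A.length ?_ hA (hB.append h₃) h hx rfl
    have := List.length_pos_iff.2 hB.ne_nil
    rw [List.length_append]; omega
  have hb := h.bichromatic
  rw [tourEdges_append h₁ (h₂.append h₃), pathEdges_append h₂ h₃] at hb
  simp only [bichromatic_add, bichromatic_singleton] at hb
  obtain ⟨⟨⟨hb₁, b₂⟩, ⟨hb₂, b₃⟩, hb₃⟩, b₁⟩ := hb
  obtain ⟨n₁, n₂₃, d₁⟩ := List.nodup_append.1 h.nodup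
  obtain ⟨n₂, n₃, d₂⟩ := List.nodup_append.1 n₂₃
  have mem₁ : ∀ {z}, z ∈ P₃ → z ∈ P₂ ++ P₃ := fun hz => List.mem_append_right _ hz
  have mem₂ : ∀ {z}, z ∈ P₂ → z ∈ P₂ ++ P₃ := fun hz => List.mem_append_left _ hz
  have dx₁₂ : x₂ ≠ x₁ := d₁ _ h₁.right_mem _ (mem₁ h₃.right_mem)
  have dx₂₃ : x₂ ≠ x₃ := d₁ _ h₁.right_mem _ (mem₂ h₂.right_mem)
  have dx₁₃ : x₃ ≠ x₁ := d₂ _ h₂.right_mem _ h₃.right_mem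
  have dy₁₂ : y₁ ≠ y₂ := d₁ _ h₁.left_mem _ (mem₂ h₂.left_mem)
  have dy₁₃ : y₁ ≠ y₃ := d₁ _ h₁.left_mem _ (mem₁ h₃.left_mem)
  have dy₂₃ : y₂ ≠ y₃ := d₂ _ h₂.left_mem _ h₃.left_mem
  have cxy : ∀ x y z w, col x = col x₁ → col z = col x₁ → col z ≠ col w → y = w → x ≠ y := by
    rintro x y z w hx hz hzw rfl rfl
    exact hzw (hz.trans hx.symm)
  have x₂y₃ : x₂ ≠ y₃ := cxy _ _ x₃ _ hc.1.symm hc.2.symm b₃ rfl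
  have x₃y₂ : y₂ ≠ x₃ := (cxy _ _ x₂ _ hc.2.symm hc.1.symm b₂ rfl).symm
  have x₃y₁ : x₃ ≠ y₁ := cxy _ _ x₁ _ hc.2.symm rfl b₁ rfl
  have x₂y₁ : x₂ ≠ y₁ := cxy _ _ x₁ _ hc.1.symm rfl b₁ rfl
  have x₁y₂ : x₁ ≠ y₂ := cxy _ _ x₂ _ rfl hc.1.symm b₂ rfl
  -- If `x₂` and `x₃` lie on the same side of `x₁y₁`, then `y₂` and `x₃` lie on different sides, and
  -- the middle segment contains a further crossing.
  by_cases hs : Crosses s(x₁, y₁) s(x₂, x₃)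
  swap
  · have hy : ¬ (Inside s(x₁, y₁) y₂ ↔ Inside s(x₁, y₁) x₃) := by
      rw [crosses_iff_inside dx₁₂ x₂y₁ x₁y₂.symm dy₁₂.symm] at hf
      rw [crosses_iff_inside dx₁₂ x₂y₁ dx₁₃ x₃y₁] at hs
      tauto
    obtain ⟨A, B, u, v, hP, hA, hB, hx, -⟩ := exists_crossing h₂
      (fun hm => d₂ _ hm _ h₃.right_mem rfl) (fun hm => d₁ _ h₁.left_mem _ (mem₂ hm) rfl) hy
    exact hmid A B u v hP hA hB hx
  obtain ⟨hint, hext⟩ := exchange_facts ⟨dx₂₃, x₂y₃, x₃y₂, dy₂₃⟩ hf hg hs c₁ c₂ c₄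
  by_cases hR : ∀ k ∈ pathEdges P₁ + pathEdges P₂ + pathEdges P₃,
      crSum {k} ({s(x₁, y₂)} + {s(x₂, y₃)} + {s(x₃, y₁)}) ≤
        crSum {k} ({s(x₁, y₁)} + {s(x₂, y₂)} + {s(x₃, y₃)})
  · refine improvable_of_exchange h₁ h₂ h₃ h hc.1 hc.2 (total_replace_lt hR ?_)
    simp only [total_add, total_singleton, crSum_add_left, crSum_singleton]
    omega
  push Not at hR
  -- Some remaining edge `k` loses by the exchange. By `exchange_facts` it crosses `x₁y₁`, so it can
  -- take the place of one of the two given crossing edges.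
  obtain ⟨k, hk, hlt⟩ := hR
  simp only [crSum_add_right, crSum_singleton] at hlt
  rw [Multiset.mem_add, Multiset.mem_add] at hk
  rcases hk with (hk | hk) | hk
  · obtain ⟨A, B, u, v, p, q, rfl, hA, hB, rfl⟩ := exists_of_mem_pathEdges hk
    obtain rfl : p = y₁ := by
      have := (hA.append hB).1; rw [h₁.1] at this; simpa using this.symm
    obtain rfl : q = x₂ := by
      have := (hA.append hB).2; rw [h₁.2] at this; simpa using this.symm
    obtain ⟨hke, hkd⟩ := hext u v hlt
    rw [List.append_assoc] at h ⊢
    -- The triple is now `x₁y₁`, `uv`, `x₂y₂`. Colors and distinctness show that `u`, `v` differ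
    -- from the ends of the other edges, so the crossing needed by `improvable_of_uncross_left` is
    -- available.
    by_cases hcu : col x₁ = col u
    · have hu : u ∈ A ++ B := List.mem_append_left _ hA.right_mem
      have hv : v ∈ A ++ B := List.mem_append_right _ hB.left_mem
      have huv : col u ≠ col v := hb₁ u v hk
      have hvx : ∀ w, col x₁ = col w → v ≠ w := by
        rintro w hw rfl; exact huv (hcu.symm.trans hw)
      have huy : ∀ z w, col x₁ = col z → col z ≠ col w → u ≠ w := by
        rintro z w hz hzw rfl; exact hzw (hz.symm.trans hcu)
      have := (hkd (fun h' => (List.nodup_append.1 n₁).2.2 _ hA.right_mem _ hB.right_mem h')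
        (huy _ _ hc.1 b₂) (d₁ _ hu _ (mem₂ h₂.right_mem)) (huy _ _ hc.2 b₃) (hvx _ hc.1)
        (d₁ _ hv _ (mem₂ h₂.left_mem)) (hvx _ hc.2) (d₁ _ hv _ (mem₁ h₃.left_mem))).1
      exact improvable_of_uncross_left hA hB (h₂.append h₃) h hke hf this
    · exact improvable_of_antiparallel hA (hB.append (h₂.append h₃)) h hke hcu
  · obtain ⟨A, B, u, v, p, q, hP, hA, hB, rfl⟩ := exists_of_mem_pathEdges hk
    obtain rfl : p = y₂ := by
      have := (hA.append hB).1; rw [← hP, h₂.1] at this; simpa using this.symm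
    obtain rfl : q = x₃ := by
      have := (hA.append hB).2; rw [← hP, h₂.2] at this; simpa using this.symm
    exact hmid A B u v hP hA hB (hext u v hlt).1
  · obtain ⟨A, B, u, v, p, q, rfl, hA, hB, rfl⟩ := exists_of_mem_pathEdges hk
    obtain rfl : p = y₃ := by
      have := (hA.append hB).1; rw [h₃.1] at this; simpa using this.symm
    obtain rfl : q = x₁ := by
      have := (hA.append hB).2; rw [h₃.2] at this; simpa using this.symm
    obtain ⟨hke, hkd⟩ := hext u v hlt
    -- Here the edge lies in the last segment, and the triple is `x₁y₁`, `x₃y₃`, `uv`.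
    by_cases hcu : col q = col u
    · have hu : u ∈ A ++ B := List.mem_append_left _ hA.right_mem
      have hv : v ∈ A ++ B := List.mem_append_right _ hB.left_mem
      have huv : col u ≠ col v := hb₃ u v hk
      have hvx : ∀ w, col q = col w → v ≠ w := by
        rintro w hw rfl; exact huv (hcu.symm.trans hw)
      have huy : ∀ z w, col q = col z → col z ≠ col w → u ≠ w := by
        rintro z w hz hzw rfl; exact hzw (hz.symm.trans hcu)
      have := (hkd (d₁ _ h₁.right_mem _ (mem₁ hu)).symm (huy _ _ hc.1 b₂)
        (d₂ _ h₂.right_mem _ hu).symm (huy _ _ hc.2 b₃) (hvx _ hc.1)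
        (d₂ _ h₂.left_mem _ hv).symm (hvx _ hc.2)
        (fun h' => (List.nodup_append.1 n₃).2.2 _ hA.left_mem _ hB.left_mem h'.symm)).2
      have e : P₁ ++ (P₂ ++ (A ++ B)) = (P₁ ++ P₂) ++ (A ++ B) := by simp
      rw [e] at h ⊢
      exact improvable_of_uncross_left (h₁.append h₂) hA hB h hg hke this
    · have e : P₁ ++ (P₂ ++ (A ++ B)) = (P₁ ++ (P₂ ++ A)) ++ B := by simp
      rw [e] at h ⊢
      exact improvable_of_antiparallel (h₁.append (h₂.append hA)) hB h hke hcu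

theorem improvable_of_crosses_of_crosses {col : ℕ → Bool} {c : List ℕ} (h : IsTour col c)
    {e f g : Sym2 ℕ} (he : e ∈ tourEdges c) (hf : f ∈ tourEdges c) (hg : g ∈ tourEdges c)
    (hfg : f ≠ g) (hef : Crosses e f) (heg : Crosses e g) : Improvable col c := by
  obtain ⟨c', x₁, y₁, hcp, hcE, hc', rfl⟩ := exists_rotation he
  refine Improvable.of_edges ?_ hcp hcE
  have h' := h.of_edges hcp hcE
  have key : ∀ f, f ∈ tourEdges c → Crosses s(x₁, y₁) f → f ∈ pathEdges c' := by
    intro f hf hx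
    rw [← hcE, tourEdges_eq hc', Multiset.mem_add, Multiset.mem_singleton] at hf
    rcases hf with hf | rfl
    · exact hf
    · exact absurd hx (not_crosses_self _)
  have hf := key f hf hef
  have hg := key g hg heg
  obtain ⟨P, Q, x₂, y₂, p, q, rfl, hP, hQ, rfl⟩ := exists_of_mem_pathEdges hf
  obtain rfl : p = y₁ := by
    have := (hP.append hQ).1; rw [hc'.1] at this; simpa using this.symm
  obtain rfl : q = x₁ := by
    have := (hP.append hQ).2; rw [hc'.2] at this; simpa using this.symm
  rw [pathEdges_append hP hQ, Multiset.mem_add, Multiset.mem_add, Multiset.mem_singleton] at hg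
  rcases hg with (hg | hg) | hg
  · obtain ⟨A, B, x₃, y₃, p', q', rfl, hA, hB, rfl⟩ := exists_of_mem_pathEdges hg
    obtain rfl : p' = p := by
      have := (hA.append hB).1; rw [hP.1] at this; simpa using this.symm
    obtain rfl : q' = x₂ := by
      have := (hA.append hB).2; rw [hP.2] at this; simpa using this.symm
    rw [List.append_assoc] at h' ⊢
    exact improvable_of_two_crossings hA hB hQ h' heg hef
  · exact absurd hg.symm hfg
  · obtain ⟨A, B, x₃, y₃, p', q', rfl, hA, hB, rfl⟩ := exists_of_mem_pathEdges hg
    obtain rfl : p' = y₂ := by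
      have := (hA.append hB).1; rw [hQ.1] at this; simpa using this.symm
    obtain rfl : q' = q := by
      have := (hA.append hB).2; rw [hQ.2] at this; simpa using this.symm
    exact improvable_of_two_crossings hP hA hB h' hef heg

end Chord

/-! ## Ordered forests and the tours that they define -/

namespace Chord

theorem not_crosses_succ (k : ℕ) (f : Sym2 ℕ) : ¬ Crosses s(k, k + 1) f := by
  induction f with | _ a b
  rw [crosses_mk]; omega

/-- Ordered forests; `node u v` consists of a root, the forest `u` of its descendants, and the
forest `v` on its right. -/
inductive Forest where
  | nil
  | node (u v : Forest)
  deriving DecidableEq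

namespace Forest

/-- The length of the corresponding word of parentheses. -/
def len : Forest → ℕ
  | nil => 0
  | node u v => u.len + v.len + 2

/-- The word of parentheses, read in such a way that the direction is reversed at each level. The
positions of the word start with `o`. -/
def order : ℕ → Forest → List ℕ
  | _, nil => []
  | o, node u v => o :: (order (o + 1) u).reverse ++ (o + 1 + u.len) :: order (o + 2 + u.len) v

/-- Opening parentheses have the color `true`, closing ones have the color `false`. -/
def Colored (col : ℕ → Bool) : Forest → ℕ → Prop
  | nil, _ => True
  | node u v, o => col o = true ∧ col (o + 1 + u.len) = false ∧ Colored col u (o + 1) ∧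
      Colored col v (o + 2 + u.len)

theorem len_pos {t : Forest} (h : t ≠ nil) : 0 < t.len := by
  cases t with
  | nil => exact absurd rfl h
  | node u v => simp [len]

theorem order_perm (t : Forest) (o : ℕ) : (order o t).Perm (List.range' o t.len) := by
  induction t generalizing o with
  | nil => simp [order, len]
  | node u v ihu ihv =>
    have e : List.range' o (node u v).len = o :: (List.range' (o + 1) u.len ++
        (o + 1 + u.len) :: List.range' (o + 2 + u.len) v.len) := by
      rw [len, show u.len + v.len + 2 = (u.len + (v.len + 1)) + 1 by ring, List.range'_succ,
        ← List.range'_append_1, List.range'_succ]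
      congr 4
      ring
    rw [e, order, List.cons_append]
    exact (((List.reverse_perm _).trans (ihu _)).append ((ihv _).cons _)).cons _

theorem length_order (t : Forest) (o : ℕ) : (order o t).length = t.len := by
  rw [(order_perm t o).length_eq, List.length_range']

theorem mem_order {t : Forest} {o k : ℕ} : k ∈ order o t ↔ o ≤ k ∧ k < o + t.len := by
  rw [(order_perm t o).mem_iff, List.mem_range'_1]

theorem ends_order {t : Forest} (h : t ≠ nil) (o : ℕ) : Ends (order o t) o (o + t.len - 1) := by
  induction t generalizing o with
  | nil => exact absurd rfl h
  | node u v _ ihv =>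
    have h₁ : Ends (o :: (order (o + 1) u).reverse ++ [o + 1 + u.len]) o (o + 1 + u.len) :=
      ⟨rfl, List.getLast?_concat⟩
    cases v with
    | nil =>
      rw [order, order, len, len, show o + (u.len + 0 + 2) - 1 = o + 1 + u.len by omega]
      exact h₁
    | node u' v' =>
      have h₂ := ihv (by simp) (o + 2 + u.len)
      have := h₁.append h₂
      rw [order, len, show o + (u.len + (node u' v').len + 2) - 1 =
        o + 2 + u.len + (node u' v').len - 1 by omega]
      simpa using this

theorem Colored.first {col : ℕ → Bool} {t : Forest} {o : ℕ} (h : t.Colored col o) (ht : t ≠ nil) :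
    col o = true := by
  cases t with
  | nil => exact absurd rfl ht
  | node u v => exact h.1

theorem Colored.last {col : ℕ → Bool} {t : Forest} {o : ℕ} (h : t.Colored col o) (ht : t ≠ nil) :
    col (o + t.len - 1) = false := by
  induction t generalizing o with
  | nil => exact absurd rfl ht
  | node u v _ ihv =>
    obtain ⟨-, h₂, -, h₄⟩ := h
    by_cases hv : v = nil
    · subst hv
      rw [len, len, show o + (u.len + 0 + 2) - 1 = o + 1 + u.len by omega]
      exact h₂
    · rw [len, show o + (u.len + v.len + 2) - 1 = o + 2 + u.len + v.len - 1 by omega]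
      exact ihv h₄ hv

/-- The part of the traversal that belongs to one tree. -/
theorem pathEdges_tree (u : Forest) (o : ℕ) :
    pathEdges (o :: (order (o + 1) u).reverse ++ [o + 1 + u.len]) =
      if u = nil then {s(o, o + 1)}
      else {s(o, o + u.len)} + pathEdges (order (o + 1) u) + {s(o + 1, o + 1 + u.len)} := by
  split_ifs with hu
  · subst hu; simp [order, len, pathEdges]
  · have h := (ends_order hu (o + 1)).reverse
    have h' := (ends_singleton o).append h
    have e := pathEdges_append h' (ends_singleton (o + 1 + u.len))
    rw [pathEdges_append (ends_singleton o) h, pathEdges_reverse] at e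
    rw [List.singleton_append] at e
    rw [e]
    have := len_pos hu
    simp only [pathEdges, zero_add, add_zero]
    rw [show o + 1 + u.len - 1 = o + u.len by omega]

theorem ends_tree (u : Forest) (o : ℕ) :
    Ends (o :: (order (o + 1) u).reverse ++ [o + 1 + u.len]) o (o + 1 + u.len) :=
  ⟨rfl, List.getLast?_concat⟩

/-- The traversal of a tree ends at its closing parenthesis, so the step to the next sibling is a
hull edge. -/
theorem pathEdges_order_node (u v : Forest) (o : ℕ) :
    pathEdges (order o (node u v)) =
      pathEdges (o :: (order (o + 1) u).reverse ++ [o + 1 + u.len]) +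
        if v = nil then 0
        else {s(o + 1 + u.len, o + 1 + u.len + 1)} + pathEdges (order (o + 2 + u.len) v) := by
  have e : order o (node u v) = (o :: (order (o + 1) u).reverse ++ [o + 1 + u.len]) ++
      order (o + 2 + u.len) v := by simp [order]
  split_ifs with hv
  · subst hv; rw [e]; simp [order]
  · rw [e, pathEdges_append (ends_tree u o) (ends_order hv _), add_assoc]
    rw [show o + 2 + u.len = o + 1 + u.len + 1 by ring]

theorem mem_Icc_of_mem_pathEdges {t : Forest} {o a b : ℕ} (h : s(a, b) ∈ pathEdges (order o t)) :
    o ≤ a ∧ a < o + t.len ∧ o ≤ b ∧ b < o + t.len := by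
  have := mem_of_mem_pathEdges h
  rw [mem_order, mem_order] at this
  tauto

theorem bichromatic_order {col : ℕ → Bool} {t : Forest} {o : ℕ} (h : t.Colored col o) :
    Bichromatic col (pathEdges (order o t)) := by
  induction t generalizing o with
  | nil => intro a b hab; simp [order, pathEdges] at hab
  | node u v ihu ihv =>
    obtain ⟨h₁, h₂, h₃, h₄⟩ := h
    rw [pathEdges_order_node, pathEdges_tree, bichromatic_add]
    constructor
    · split_ifs with hu
      · subst hu
        rw [bichromatic_singleton, h₁]
        simp only [len, add_zero] at h₂
        rw [h₂]; simp
      · simp only [bichromatic_add, bichromatic_singleton]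
        have hf := h₃.first hu
        have hl := h₃.last hu
        have := len_pos hu
        rw [show o + 1 + u.len - 1 = o + u.len by omega] at hl
        refine ⟨⟨?_, ihu h₃⟩, ?_⟩
        · rw [h₁, hl]; simp
        · rw [hf, h₂]; simp
    · split_ifs with hv
      · intro a b hab; simp at hab
      · rw [bichromatic_add, bichromatic_singleton, h₂]
        refine ⟨?_, ihv h₄⟩
        rw [show o + 1 + u.len + 1 = o + 2 + u.len by ring, h₄.first hv]; simp

theorem ends_range' {n : ℕ} (h : 0 < n) (o : ℕ) : Ends (List.range' o n) o (o + n - 1) := by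
  obtain ⟨m, rfl⟩ : ∃ m, n = m + 1 := ⟨n - 1, by omega⟩
  constructor
  · simp [List.range'_succ]
  · rw [List.range'_1_concat]; simp

/-- The two edges that join the root parentheses to the subforest cross at most each other, since
the subforest lies within the range of both. This possible crossing, counted twice, is paid for by
two monochromatic pairs: the two opening parentheses at the beginning and the two closing ones at
the end. -/
theorem total_tree_le {col : ℕ → Bool} {u : Forest} {o : ℕ} (h₁ : col o = true)
    (h₂ : col (o + 1 + u.len) = false) (h₃ : u.Colored col (o + 1))
    (ih : total (pathEdges (order (o + 1) u)) ≤ monoCount col (List.range' (o + 1) u.len)) :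
    total (pathEdges (o :: (order (o + 1) u).reverse ++ [o + 1 + u.len])) ≤
      monoCount col (List.range' o (u.len + 2)) := by
  rw [pathEdges_tree]
  split_ifs with hu
  · rw [total_singleton]; exact Nat.zero_le _
  · have hl := len_pos hu
    have e : List.range' o (u.len + 2) = [o] ++ (List.range' (o + 1) u.len ++ [o + 1 + u.len]) := by
      rw [List.range'_succ, List.range'_1_concat]
      rfl
    have hr := ends_range' hl (o + 1)
    have c₁ := h₃.first hu
    have c₂ := h₃.last hu
    rw [e, monoCount_append (ends_singleton o) (hr.append (ends_singleton _)),
      monoCount_append hr (ends_singleton _), h₁, h₂, c₁, c₂, if_pos rfl, if_pos rfl]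
    have z₁ : crSum {s(o, o + u.len)} (pathEdges (order (o + 1) u)) = 0 := by
      refine crSum_eq_zero fun x hx f hf => ?_
      rw [Multiset.mem_singleton.1 hx]
      induction f with | _ a b
      have := mem_Icc_of_mem_pathEdges hf
      rw [crosses_mk]; omega
    have z₂ : crSum (pathEdges (order (o + 1) u)) {s(o + 1, o + 1 + u.len)} = 0 := by
      refine crSum_eq_zero fun f hf x hx => ?_
      rw [Multiset.mem_singleton.1 hx]
      induction f with | _ a b
      have := mem_Icc_of_mem_pathEdges hf
      rw [crosses_mk]; omega
    rw [total_add, total_add, total_singleton, total_singleton, crSum_add_left, z₁, z₂,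
      crSum_singleton]
    have : cr s(o, o + u.len) s(o + 1, o + 1 + u.len) ≤ 1 := by unfold cr; split_ifs <;> omega
    omega

/-- Siblings occupy disjoint intervals and are joined by hull edges, so crossings occur only within
the trees. -/
theorem total_order_le {col : ℕ → Bool} {t : Forest} {o : ℕ} (h : t.Colored col o) :
    total (pathEdges (order o t)) ≤ monoCount col (List.range' o t.len) := by
  induction t generalizing o with
  | nil => simp [order, pathEdges, total, crSum]
  | node u v ihu ihv =>
    obtain ⟨h₁, h₂, h₃, h₄⟩ := h
    have hT := total_tree_le h₁ h₂ h₃ (ihu h₃)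
    rw [pathEdges_order_node]
    have e : (node u v).len = u.len + 2 + v.len := by rw [len]; ring
    split_ifs with hv
    · subst hv
      rw [add_zero, e, len, add_zero]
      exact hT
    · have hl := len_pos hv
      have hE := ends_range' (n := u.len + 2) (by omega) o
      have hE' := ends_range' hl (o + (u.len + 2))
      rw [e, ← List.range'_append_1, monoCount_append hE hE']
      have hV := ihv h₄
      rw [show o + 2 + u.len = o + (u.len + 2) by ring] at hV ⊢
      have z₁ : crSum (pathEdges (o :: (order (o + 1) u).reverse ++ [o + 1 + u.len]))
          (pathEdges (order (o + (u.len + 2)) v)) = 0 := by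
        refine crSum_eq_zero fun f hf g hg => ?_
        induction f with | _ a b
        induction g with | _ c d
        have i₁ := mem_Icc_of_mem_pathEdges hg
        have i₂ := mem_of_mem_pathEdges hf
        have i₃ : ∀ k, k ∈ o :: (order (o + 1) u).reverse ++ [o + 1 + u.len] →
            k ≤ o + 1 + u.len := by
          intro k hk
          simp only [List.cons_append, List.mem_cons, List.mem_append, List.mem_reverse, mem_order,
            List.not_mem_nil, or_false] at hk
          omega
        have := i₃ a i₂.1
        have := i₃ b i₂.2
        rw [crosses_mk]; omega
      have z₂ : ∀ E, crSum E {s(o + 1 + u.len, o + 1 + u.len + 1)} = 0 := by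
        intro E
        refine crSum_eq_zero fun f _ g hg => ?_
        rw [Multiset.mem_singleton.1 hg, crosses_comm]
        exact not_crosses_succ _ _
      rw [total_add, total_add, total_singleton, crSum_add_right, crSum_comm {_}, z₁, z₂, z₂]
      omega

/-- Successive parentheses of different kinds are either a leaf `()` or the border `)(` between
siblings. In both cases the traversal goes directly from one to the other, in some direction. -/
theorem mem_pathEdges_of_ne {col : ℕ → Bool} {t : Forest} {o : ℕ} (h : t.Colored col o) {k : ℕ}
    (hk : o ≤ k) (hk' : k + 1 < o + t.len) (hc : col k ≠ col (k + 1)) :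
    s(k, k + 1) ∈ pathEdges (order o t) := by
  induction t generalizing o with
  | nil => simp only [len] at hk'; omega
  | node u v ihu ihv =>
    obtain ⟨h₁, h₂, h₃, h₄⟩ := h
    rw [pathEdges_order_node, pathEdges_tree, Multiset.mem_add]
    rw [len] at hk'
    by_cases hu : u = nil
    · subst hu
      simp only [len] at h₂ h₄ hk' ⊢
      rcases Nat.lt_or_ge k (o + 1) with hlt | hge
      · obtain rfl : k = o := by omega
        left; simp
      · right
        have hv : v ≠ nil := by rintro rfl; simp only [len] at hk'; omega
        rw [if_neg hv, Multiset.mem_add]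
        rcases Nat.eq_or_lt_of_le hge with rfl | hlt
        · left; simp
        · right; exact ihv h₄ (by omega) (by omega)
    · have hl := len_pos hu
      have c₁ := h₃.first hu
      have c₂ := h₃.last hu
      rw [if_neg hu, Multiset.mem_add, Multiset.mem_add]
      rcases Nat.lt_or_ge k (o + 1 + u.len) with hlt | hge
      · left; left; right
        refine ihu h₃ ?_ ?_
        · rcases Nat.eq_or_lt_of_le hk with rfl | h
          · rw [h₁, c₁] at hc; exact absurd rfl hc
          · exact h
        · by_contra hcon
          rw [show k = o + 1 + u.len - 1 by omega, c₂,
            show o + 1 + u.len - 1 + 1 = o + 1 + u.len by omega, h₂] at hc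
          exact hc rfl
      · right
        have hv : v ≠ nil := by rintro rfl; simp only [len] at hk'; omega
        rw [if_neg hv, Multiset.mem_add]
        rcases Nat.eq_or_lt_of_le hge with rfl | hlt
        · left; simp
        · right; exact ihv h₄ (by omega) (by omega)

end Forest

/-! ### Heights, balanced words and their rotations -/

/-- The excess of the color `true` among the first `k` points. -/
def height (col : ℕ → Bool) (k : ℕ) : ℤ := ∑ i ∈ Finset.range k, if col i then 1 else -1

theorem height_succ (col : ℕ → Bool) (k : ℕ) :
    height col (k + 1) = height col k + if col k then 1 else -1 := by
  rw [height, Finset.sum_range_succ, ← height]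

/-- The usual decomposition of a Dyck path at its first return to the initial height. -/
theorem exists_forest {col : ℕ → Bool} {L o : ℕ}
    (h : ∀ k, o ≤ k → k ≤ o + L → height col o ≤ height col k)
    (h' : height col (o + L) = height col o) : ∃ t : Forest, t.len = L ∧ t.Colored col o := by
  induction L using Nat.strong_induction_on generalizing o with
  | _ L ih
  rcases Nat.eq_zero_or_pos L with rfl | hL
  · exact ⟨.nil, rfl, trivial⟩
  have ho : col o = true := by
    by_contra hc
    have := h (o + 1) (by omega) (by omega)
    rw [height_succ, if_neg hc] at this
    omega
  have ho' : height col (o + 1) = height col o + 1 := by rw [height_succ, if_pos ho]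
  -- The first return `m` closes the parenthesis that opens at `o`; between them the height stays at
  -- least one higher, which makes the inner word balanced.
  have hex : ∃ m, 0 < m ∧ m ≤ L ∧ height col (o + m) = height col o := ⟨L, hL, le_rfl, h'⟩
  classical
  obtain ⟨m, ⟨hm, hmL, hmh⟩, hmin⟩ :
      ∃ m, (0 < m ∧ m ≤ L ∧ height col (o + m) = height col o) ∧
        ∀ k, k < m → ¬ (0 < k ∧ k ≤ L ∧ height col (o + k) = height col o) :=
    ⟨Nat.find hex, Nat.find_spec hex, fun k hk => Nat.find_min hex hk⟩
  have hm2 : 2 ≤ m := by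
    by_contra hc
    rw [show m = 1 by omega, ho'] at hmh
    omega
  obtain ⟨a, rfl⟩ : ∃ a, m = a + 2 := ⟨m - 2, by omega⟩
  have hge : ∀ k, o + 1 ≤ k → k ≤ o + 1 + a → height col o + 1 ≤ height col k := by
    intro k hk hk'
    have h₁ := h k (by omega) (by omega)
    have h₂ := hmin (k - o) (by omega)
    rw [show o + (k - o) = k by omega] at h₂
    by_contra hc
    exact h₂ ⟨by omega, by omega, by omega⟩
  have hlast := height_succ col (o + 1 + a)
  rw [show o + 1 + a + 1 = o + (a + 2) by ring, hmh] at hlast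
  have hlast' := hge (o + 1 + a) (by omega) le_rfl
  have hcol : col (o + 1 + a) = false := by
    by_contra hc
    rw [Bool.not_eq_false] at hc
    rw [if_pos hc] at hlast
    omega
  rw [hcol] at hlast
  simp only [Bool.false_eq_true, if_false] at hlast
  obtain ⟨u, hu, huc⟩ := ih a (by omega) (o := o + 1)
    (fun k hk hk' => by rw [ho']; exact hge k hk hk') (by rw [ho']; omega)
  obtain ⟨v, hv, hvc⟩ := ih (L - (a + 2)) (by omega) (o := o + (a + 2))
    (fun k hk hk' => by rw [hmh]; exact h k (by omega) (by omega))
    (by rw [hmh, show o + (a + 2) + (L - (a + 2)) = o + L by omega]; exact h')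
  refine ⟨.node u v, by rw [Forest.len, hu, hv]; omega, ho, by rw [hu]; exact hcol, huc, ?_⟩
  rw [hu, show o + 2 + a = o + (a + 2) by ring]
  exact hvc

theorem height_rot {col : ℕ → Bool} {M s : ℕ} (hs : s ≤ M) (h : height col M = 0) {k : ℕ}
    (hk : k ≤ M) : height (fun i => col (rot M s i)) k =
      height col (if k + s ≤ M then k + s else k + s - M) - height col s := by
  induction k with
  | zero => simp [height, hs]
  | succ k ih =>
    rw [height_succ, ih (by omega)]
    rcases lt_trichotomy (k + s + 1) (M + 1) with hlt | heq | hgt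
    · have hr : rot M s k = k + s := if_pos (by omega)
      rw [hr, if_pos (show k + s ≤ M by omega), if_pos (show k + 1 + s ≤ M by omega),
        show k + 1 + s = k + s + 1 by ring, height_succ]
      ring
    · have : k + s = M := by omega
      have hr : rot M s k = 0 := by unfold rot; split_ifs <;> omega
      rw [hr, if_pos (show k + s ≤ M by omega), if_neg (show ¬ k + 1 + s ≤ M by omega), this, h,
        show k + 1 + s - M = 0 + 1 by omega, height_succ, show height col 0 = 0 by simp [height]]
      ring
    · have hr : rot M s k = k + s - M := if_neg (by omega)
      rw [hr, if_neg (show ¬ k + s ≤ M by omega), if_neg (show ¬ k + 1 + s ≤ M by omega),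
        show k + 1 + s - M = (k + s - M) + 1 by omega, height_succ]
      ring

/-- As the total excess is zero, the heights of the rotated word are differences to the height at
`s`; if that is the minimum, they are nonnegative. -/
theorem exists_forest_rot {col : ℕ → Bool} {M s : ℕ} (hs : s ≤ M) (h : height col M = 0)
    (hmin : ∀ k, k ≤ M → height col s ≤ height col k) :
    ∃ t : Forest, t.len = M ∧ t.Colored (fun i => col (rot M s i)) 0 := by
  have h0 : height (fun i => col (rot M s i)) 0 = 0 := by simp [height]
  refine exists_forest (fun k _ hk => ?_) ?_
  · rw [h0, height_rot hs h (by omega)]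
    have := hmin (if k + s ≤ M then k + s else k + s - M) (by split_ifs <;> omega)
    omega
  · rw [h0, zero_add, height_rot hs h le_rfl]
    rcases Nat.eq_zero_or_pos s with rfl | hs'
    · simpa [height] using h
    · rw [if_neg (by omega), show M + s - M = s by omega, sub_self]

/-! ### Renumbering of tours, and tours that attain the lower bound -/

theorem pathEdges_map (g : ℕ → ℕ) (c : List ℕ) :
    pathEdges (c.map g) = (pathEdges c).map (Sym2.map g) := by
  induction c with
  | nil => rfl
  | cons a t ih =>
    cases t with
    | nil => rfl
    | cons b t =>
      simp only [List.map_cons, pathEdges, Multiset.map_add, Multiset.map_singleton] at ih ⊢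
      rw [ih]; rfl

theorem tourEdges_map (g : ℕ → ℕ) (c : List ℕ) :
    tourEdges (c.map g) = (tourEdges c).map (Sym2.map g) := by
  rw [tourEdges, tourEdges, ← pathEdges_map]
  cases c with
  | nil => rfl
  | cons a t => rw [List.map_append]; rfl

theorem total_map {g : ℕ → ℕ} {E : Multiset (Sym2 ℕ)}
    (h : ∀ e ∈ E, ∀ f ∈ E, cr (e.map g) (f.map g) = cr e f) :
    total (E.map (Sym2.map g)) = total E := by
  unfold total crSum
  rw [Multiset.map_map]
  refine congrArg _ (Multiset.map_congr rfl fun e he => ?_)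
  simp only [Function.comp, Multiset.map_map]
  exact congrArg _ (Multiset.map_congr rfl fun f hf => h e he f hf)

theorem total_tourEdges_map_rot {M s : ℕ} {c : List ℕ} (hc : ∀ x ∈ c, x < M) :
    total (tourEdges (c.map (rot M s))) = total (tourEdges c) := by
  rw [tourEdges_map]
  refine total_map fun e he f hf => ?_
  induction e with | _ a b
  induction f with | _ d e
  have h₁ := mem_of_mem_tourEdges he
  have h₂ := mem_of_mem_tourEdges hf
  exact cr_rot (hc _ h₁.1) (hc _ h₁.2) (hc _ h₂.1) (hc _ h₂.2)

theorem IsTour.map {col col' : ℕ → Bool} {c : List ℕ} {g : ℕ → ℕ} (h : IsTour col c)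
    (hg : ∀ x ∈ c, ∀ y ∈ c, g x = g y → x = y) (hc : ∀ x ∈ c, col' (g x) = col x) :
    IsTour col' (c.map g) where
  ne_nil := by simpa using h.ne_nil
  nodup := h.nodup.map_on hg
  bichromatic := by
    intro a b hab
    rw [tourEdges_map, Multiset.mem_map] at hab
    obtain ⟨e, he, hee⟩ := hab
    induction e with | _ x y
    have hxy := mem_of_mem_tourEdges he
    have := h.bichromatic x y he
    rw [← hc x hxy.1, ← hc y hxy.2] at this
    rcases Sym2.eq_iff.1 hee with ⟨rfl, rfl⟩ | ⟨rfl, rfl⟩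
    · exact this
    · exact this.symm

theorem map_rot_perm {M s : ℕ} (hs : s ≤ M) {c : List ℕ} (hc : c.Perm (List.range M)) :
    (c.map (rot M s)).Perm (List.range M) := by
  have hlt : ∀ x ∈ c, x < M := fun x hx => List.mem_range.1 (hc.mem_iff.1 hx)
  have hn : (c.map (rot M s)).Nodup := (hc.nodup_iff.2 List.nodup_range).map_on
    fun x hx y hy h => rot_injOn (hlt x hx) (hlt y hy) h
  refine (List.subperm_of_subset hn ?_).perm_of_length_le ?_
  · intro x hx
    obtain ⟨y, hy, rfl⟩ := List.mem_map.1 hx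
    exact List.mem_range.2 (rot_lt hs (hlt y hy))
  · simp [hc.length_eq]

/-- A tour on the points `0, …, M - 1` with the minimum number of crossings, which contains all
the edges of the convex hull that join points of different colors. -/
structure BestTour (col : ℕ → Bool) (M : ℕ) (c : List ℕ) : Prop where
  isTour : IsTour col c
  perm : c.Perm (List.range M)
  le_total : ∀ c', IsTour col c' → c'.Perm (List.range M) →
    total (tourEdges c) ≤ total (tourEdges c')
  mem_of_ne : ∀ k, k + 1 < M → col k ≠ col (k + 1) → s(k, k + 1) ∈ tourEdges c
  last_mem : col (M - 1) ≠ col 0 → s(M - 1, 0) ∈ tourEdges c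

theorem BestTour.of_edges {col : ℕ → Bool} {M : ℕ} {c c' : List ℕ} (h : BestTour col M c)
    (hp : c'.Perm c) (he : tourEdges c' = tourEdges c) : BestTour col M c' where
  isTour := h.isTour.of_edges hp he
  perm := hp.trans h.perm
  le_total := by rw [he]; exact h.le_total
  mem_of_ne := by rw [he]; exact h.mem_of_ne
  last_mem := by rw [he]; exact h.last_mem

/-- The closing edge of the traversal crosses nothing, so its `total` is at most the number of
monochromatic pairs, which is a lower bound for all tours. -/
theorem bestTour_map_rot {col : ℕ → Bool} {M s : ℕ} (hM : 0 < M) (hs : s ≤ M) {t : Forest}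
    (ht : t.len = M) (hc : t.Colored (fun i => col (rot M s i)) 0) :
    BestTour col M ((t.order 0).map (rot M s)) := by
  have hnil : t ≠ .nil := by rintro rfl; simp [Forest.len] at ht; omega
  have hperm := Forest.order_perm t 0
  rw [ht, ← List.range_eq_range'] at hperm
  have hlt : ∀ x ∈ t.order 0, x < M := fun x hx => List.mem_range.1 (hperm.mem_iff.1 hx)
  have hends := Forest.ends_order hnil 0
  rw [ht, zero_add] at hends
  have hE : tourEdges (t.order 0) = pathEdges (t.order 0) + {s(M - 1, 0)} := tourEdges_eq hends
  have hT : IsTour (fun i => col (rot M s i)) (t.order 0) := by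
    refine ⟨hends.ne_nil, hperm.nodup_iff.2 List.nodup_range, ?_⟩
    rw [hE, bichromatic_add, bichromatic_singleton]
    refine ⟨Forest.bichromatic_order hc, ?_⟩
    have h₁ := hc.first hnil
    have h₂ := hc.last hnil
    rw [ht, zero_add] at h₂
    rw [h₁, h₂]; simp
  have hmem : ∀ k, k + 1 < M → col (rot M s k) ≠ col (rot M s (k + 1)) →
      s(rot M s k, rot M s (k + 1)) ∈ tourEdges ((t.order 0).map (rot M s)) := by
    intro k hk hne
    rw [tourEdges_map]
    refine Multiset.mem_map.2 ⟨s(k, k + 1), ?_, rfl⟩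
    exact mem_tourEdges_of_mem_pathEdges
      (Forest.mem_pathEdges_of_ne hc (Nat.zero_le _) (by rw [ht, zero_add]; exact hk) hne)
  have hmem' : s(rot M s (M - 1), rot M s 0) ∈ tourEdges ((t.order 0).map (rot M s)) := by
    rw [tourEdges_map]
    refine Multiset.mem_map.2 ⟨s(M - 1, 0), ?_, rfl⟩
    rw [hE]; simp
  refine ⟨hT.map (fun x hx y hy h => rot_injOn (hlt x hx) (hlt y hy) h) (fun _ _ => rfl),
    map_rot_perm hs hperm, ?_, ?_, ?_⟩
  · intro c' hc' hp'
    rw [total_tourEdges_map_rot hlt]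
    have hlt' : ∀ x ∈ c', x < M := fun x hx => List.mem_range.1 (hp'.mem_iff.1 hx)
    -- A competing tour is rotated back, so that the lower bound speaks of the same coloring as the
    -- forest.
    have hs' : M - s ≤ M := Nat.sub_le _ _
    have hback : ∀ x, x < M → rot M s (rot M (M - s) x) = x := by
      intro x hx
      have := rot_rot hs' hx
      rwa [show M - (M - s) = s by omega] at this
    have hT' : IsTour (fun i => col (rot M s i)) (c'.map (rot M (M - s))) :=
      hc'.map (fun x hx y hy h => rot_injOn (hlt' x hx) (hlt' y hy) h)
        (fun x hx => by rw [hback x (hlt' x hx)])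
    have hlow := cyclicMonoCount_le_total hT' (V := List.range M) List.pairwise_lt_range
      (map_rot_perm hs' hp').symm
    rw [total_tourEdges_map_rot hlt'] at hlow
    refine le_trans ?_ hlow
    have hz : crSum (pathEdges (t.order 0)) {s(M - 1, 0)} = 0 := by
      refine crSum_eq_zero fun f hf x hx => ?_
      rw [Multiset.mem_singleton.1 hx]
      induction f with | _ a b
      have h₁ := Forest.mem_Icc_of_mem_pathEdges hf
      rw [crosses_mk]; omega
    rw [hE, total_add, total_singleton, hz]
    have h₁ := Forest.total_order_le hc
    obtain ⟨m, rfl⟩ : ∃ m, M = m + 1 := ⟨M - 1, by omega⟩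
    have h₂ : cyclicMonoCount (fun i => col (rot (m + 1) s i)) (List.range (m + 1)) =
        monoCount (fun i => col (rot (m + 1) s i)) (List.range (m + 1) ++ [0]) := by
      rw [cyclicMonoCount, List.range_succ_eq_map]; rfl
    have h₃ : Ends (List.range (m + 1)) 0 m := by
      have := Forest.ends_range' hM 0
      rwa [← List.range_eq_range', zero_add, Nat.add_sub_cancel] at this
    rw [h₂, monoCount_append h₃ (ends_singleton 0)]
    rw [ht, ← List.range_eq_range'] at h₁
    omega
  · intro k hk hne
    -- The hull edge at `k` comes from position `j` of the word. It is an edge inside the word, or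
    -- the closing edge if `j` is the last position.
    have hj : rot M s (rot M (M - s) k) = k := by
      have := rot_rot (Nat.sub_le M s) (show k < M by omega)
      rwa [show M - (M - s) = s by omega] at this
    have hjlt : rot M (M - s) k < M := rot_lt (Nat.sub_le M s) (by omega)
    generalize rot M (M - s) k = j at hj hjlt
    by_cases hj1 : j + 1 < M
    · have hj' : rot M s (j + 1) = k + 1 := by
        unfold rot at hj ⊢; split_ifs at hj ⊢ <;> omega
      have := hmem j hj1
      rw [hj, hj'] at this
      exact this hne
    · obtain rfl : j = M - 1 := by omega
      have hj' : rot M s 0 = k + 1 := by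
        unfold rot at hj ⊢; split_ifs at hj ⊢ <;> omega
      rwa [hj, hj'] at hmem'
  · intro hne
    have hj : rot M s (rot M (M - s) (M - 1)) = M - 1 := by
      have := rot_rot (Nat.sub_le M s) (show M - 1 < M by omega)
      rwa [show M - (M - s) = s by omega] at this
    have hjlt : rot M (M - s) (M - 1) < M := rot_lt (Nat.sub_le M s) (by omega)
    generalize rot M (M - s) (M - 1) = j at hj hjlt
    by_cases hj1 : j + 1 < M
    · have hj' : rot M s (j + 1) = 0 := by
        unfold rot at hj ⊢; split_ifs at hj ⊢ <;> omega
      have := hmem j hj1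
      rw [hj, hj'] at this
      exact this hne
    · obtain rfl : j = M - 1 := by omega
      have hj' : rot M s 0 = 0 := by
        unfold rot at hj ⊢; split_ifs at hj ⊢ <;> omega
      rwa [hj, hj'] at hmem'

end Chord

/-! ## Matching the parentheses with a stack, and the traversal of a forest -/

namespace Chord

open Forest

/-- A stack height, the contents of the stack, and a partial matching. -/
structure Stack where
  height : ℕ
  cell : ℕ → ℕ
  mate : ℕ → ℕ

/-- An opening parenthesis is pushed; a closing one is matched with the top of the stack. -/
def Stack.read (col : ℕ → Bool) (i : ℕ) (σ : Stack) : Stack :=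
  if col i then ⟨σ.height + 1, Function.update σ.cell σ.height i, σ.mate⟩
  else ⟨σ.height - 1, σ.cell, Function.update (Function.update σ.mate i (σ.cell (σ.height - 1)))
    (σ.cell (σ.height - 1)) i⟩

/-- Read the positions `o, …, o + k - 1`. -/
def Stack.run (col : ℕ → Bool) (o : ℕ) (σ : Stack) : ℕ → Stack
  | 0 => σ
  | k + 1 => (Stack.run col o σ k).read col (o + k)

theorem Stack.run_add (col : ℕ → Bool) (o : ℕ) (σ : Stack) (a b : ℕ) :
    σ.run col o (a + b) = (σ.run col o a).run col (o + a) b := by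
  induction b with
  | zero => rfl
  | succ b ih => rw [← add_assoc, Stack.run, ih, Stack.run, add_assoc]

theorem Stack.run_one (col : ℕ → Bool) (o : ℕ) (σ : Stack) : σ.run col o 1 = σ.read col o := rfl

/-- These bounds guarantee that everything the machine stores during the matching is a legal word or
index. -/
theorem Stack.run_le (col : ℕ → Bool) (k : ℕ) :
    let σ := Stack.run col 0 ⟨0, fun _ => 0, fun _ => 0⟩ k
    σ.height ≤ k ∧ (∀ x, σ.cell x ≤ k) ∧ ∀ x, σ.mate x ≤ k := by
  induction k with
  | zero => simp [Stack.run]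
  | succ k ih =>
    obtain ⟨h₁, h₂, h₃⟩ := ih
    simp only [Stack.run, zero_add, Stack.read] at *
    split_ifs with hc
    · refine ⟨by simpa using h₁, fun x => ?_, fun x => (h₃ x).trans (Nat.le_succ k)⟩
      simp only [Function.update_apply]
      split_ifs
      · omega
      · exact (h₂ x).trans (Nat.le_succ k)
    · refine ⟨by simp only; omega, fun x => (h₂ x).trans (Nat.le_succ k), fun x => ?_⟩
      simp only [Function.update_apply]
      split_ifs
      · omega
      · exact (h₂ _).trans (Nat.le_succ k)
      · exact (h₃ x).trans (Nat.le_succ k)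

/-- The matching of the parentheses of the word of a forest. -/
def Forest.Matched (mate : ℕ → ℕ) : Forest → ℕ → Prop
  | nil, _ => True
  | node u v, o => mate o = o + 1 + u.len ∧ mate (o + 1 + u.len) = o ∧ Matched mate u (o + 1) ∧
      Matched mate v (o + 2 + u.len)

theorem Forest.Matched.congr {mate mate' : ℕ → ℕ} {t : Forest} {o : ℕ}
    (h : ∀ k, o ≤ k → k < o + t.len → mate' k = mate k) (hc : t.Matched mate o) :
    t.Matched mate' o := by
  induction t generalizing o with
  | nil => trivial
  | node u v ihu ihv =>
    simp only [len] at h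
    obtain ⟨h₁, h₂, h₃, h₄⟩ := hc
    refine ⟨?_, ?_, ihu (fun k hk hk' => h k (by omega) (by omega)) h₃,
      ihv (fun k hk hk' => h k (by omega) (by omega)) h₄⟩
    · rw [h _ (by omega) (by omega), h₁]
    · rw [h _ (by omega) (by omega), h₂]

/-- A balanced word only works above the initial stack height. Hence the opening position of a tree
is again on top of the stack when its closing parenthesis is read. -/
theorem Stack.run_forest {col : ℕ → Bool} {t : Forest} {o : ℕ} (hc : t.Colored col o) (σ : Stack) :
    let τ := σ.run col o t.len
    τ.height = σ.height ∧ (∀ x, x < σ.height → τ.cell x = σ.cell x) ∧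
      (∀ x, x < o ∨ o + t.len ≤ x → τ.mate x = σ.mate x) ∧ t.Matched τ.mate o := by
  induction t generalizing o σ with
  | nil => exact ⟨rfl, fun _ _ => rfl, fun _ _ => rfl, trivial⟩
  | node u v ihu ihv =>
    obtain ⟨h₁, h₂, h₃, h₄⟩ := hc
    intro τ
    have e : τ = ((((σ.read col o).run col (o + 1) u.len).read col (o + 1 + u.len)).run col
        (o + 2 + u.len) v.len) := by
      simp only [τ, len]
      rw [show u.len + v.len + 2 = 1 + (u.len + (1 + v.len)) by ring, Stack.run_add, Stack.run_one,
        Stack.run_add, Stack.run_add, Stack.run_one,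
        show o + 1 + u.len + 1 = o + 2 + u.len by ring]
    obtain ⟨a₁, a₂, a₃, a₄⟩ := ihu h₃ (σ.read col o)
    have r₁ : (σ.read col o).height = σ.height + 1 := by simp [Stack.read, h₁]
    have r₂ : (σ.read col o).cell = Function.update σ.cell σ.height o := by simp [Stack.read, h₁]
    have r₃ : (σ.read col o).mate = σ.mate := by simp [Stack.read, h₁]
    generalize (σ.read col o).run col (o + 1) u.len = ρ at *
    rw [r₁] at a₁ a₂
    rw [r₂] at a₂
    rw [r₃] at a₃
    have q : ρ.cell (ρ.height - 1) = o := by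
      rw [a₁, Nat.add_sub_cancel, a₂ _ (Nat.lt_succ_self _), Function.update_self]
    have s₁ : (ρ.read col (o + 1 + u.len)).height = σ.height := by simp [Stack.read, h₂, a₁]
    have s₂ : (ρ.read col (o + 1 + u.len)).cell = ρ.cell := by simp [Stack.read, h₂]
    have s₃ : (ρ.read col (o + 1 + u.len)).mate =
        Function.update (Function.update ρ.mate (o + 1 + u.len) o) o (o + 1 + u.len) := by
      simp [Stack.read, h₂, q]
    obtain ⟨b₁, b₂, b₃, b₄⟩ := ihv h₄ (ρ.read col (o + 1 + u.len))
    rw [← e] at b₁ b₂ b₃ b₄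
    rw [s₁] at b₁ b₂
    rw [s₂] at b₂
    rw [s₃] at b₃
    refine ⟨b₁, fun x hx => ?_, fun x hx => ?_, ?_, ?_, ?_, b₄⟩
    · rw [b₂ x hx, a₂ x (by omega), Function.update_of_ne (by omega)]
    · rw [len] at hx
      rw [b₃ x (by omega), Function.update_of_ne (by omega), Function.update_of_ne (by omega),
        a₃ x (by omega)]
    · rw [b₃ o (by omega), Function.update_self]
    · rw [b₃ _ (by omega), Function.update_of_ne (by omega), Function.update_self]
    · refine a₄.congr fun k hk hk' => ?_
      rw [b₃ k (by omega), Function.update_of_ne (by omega), Function.update_of_ne (by omega)]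

/-- The state of the traversal: the direction (`true` is backward), and a position. -/
def advance (mate : ℕ → ℕ) (σ : Bool × ℕ) : Bool × ℕ :=
  if σ.1 then (false, mate σ.2 + 1) else (true, mate σ.2 - 1)

/-- The vertex that is visited. -/
def visit (mate : ℕ → ℕ) (σ : Bool × ℕ) : ℕ :=
  if σ.1 then max σ.2 (mate σ.2) else min σ.2 (mate σ.2)

/-- The list of the first vertices that are visited. -/
def visits (mate : ℕ → ℕ) : ℕ → Bool × ℕ → List ℕ
  | 0, _ => []
  | k + 1, σ => visit mate σ :: visits mate k (advance mate σ)

theorem visits_add (mate : ℕ → ℕ) (a b : ℕ) (σ : Bool × ℕ) :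
    visits mate (a + b) σ = visits mate a σ ++ visits mate b ((advance mate)^[a] σ) := by
  induction a generalizing σ with
  | zero => simp [visits]
  | succ a ih => rw [Nat.succ_add, visits, ih, visits, Function.iterate_succ_apply]; rfl

theorem visits_eq_map (mate : ℕ → ℕ) (k : ℕ) (σ : Bool × ℕ) :
    visits mate k σ = (List.range k).map fun i => visit mate ((advance mate)^[i] σ) := by
  induction k with
  | zero => rfl
  | succ k ih => rw [visits_add, ih, List.range_succ, List.map_append]; rfl

/-- Why no recursion stack is needed. Going forward, a root visits its opening parenthesis, jumps to
just before the closing one and reads its children backward. This ends at the opening position with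
direction backward, where `max` yields the closing parenthesis and the jump leads to the next
sibling. Going backward is symmetric. The condition `0 < o` keeps the truncated `o - 1` meaningful.
-/
theorem visits_forest {mate : ℕ → ℕ} {t : Forest} {o : ℕ} (h : t.Matched mate o) :
    (visits mate t.len (false, o) = t.order o ∧
      (advance mate)^[t.len] (false, o) = (false, o + t.len)) ∧
    (0 < o → visits mate t.len (true, o + t.len - 1) = (t.order o).reverse ∧
      (advance mate)^[t.len] (true, o + t.len - 1) = (true, o - 1)) := by
  induction t generalizing o with
  | nil => simp [visits, len, order]
  | node u v ihu ihv =>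
    obtain ⟨h₁, h₂, h₃, h₄⟩ := h
    obtain ⟨⟨a₁, a₂⟩, a₃⟩ := ihu h₃
    obtain ⟨a₃, a₄⟩ := a₃ (by omega)
    obtain ⟨⟨b₁, b₂⟩, b₃⟩ := ihv h₄
    obtain ⟨b₃, b₄⟩ := b₃ (by omega)
    simp only [len]
    have v₁ : visit mate (false, o) = o := by simp [visit, h₁]; omega
    have v₂ : visit mate (true, o) = o + 1 + u.len := by simp [visit, h₁]; omega
    have v₃ : visit mate (true, o + 1 + u.len) = o + 1 + u.len := by simp [visit, h₂]; omega
    have v₄ : visit mate (false, o + 1 + u.len) = o := by simp [visit, h₂]; omega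
    have w₁ : advance mate (false, o) = (true, o + 1 + u.len - 1) := by simp [advance, h₁]
    have w₂ : advance mate (true, o) = (false, o + 2 + u.len) := by
      simp [advance, h₁]; omega
    have w₃ : advance mate (true, o + 1 + u.len) = (false, o + 1) := by simp [advance, h₂]
    have w₄ : advance mate (false, o + 1 + u.len) = (true, o - 1) := by simp [advance, h₂]
    constructor
    · rw [show u.len + v.len + 2 = (u.len + (v.len + 1)) + 1 by ring, visits,
        Function.iterate_succ_apply, v₁, w₁, visits_add, a₃, add_comm u.len (v.len + 1),
        Function.iterate_add_apply, a₄, Nat.add_sub_cancel, visits, Function.iterate_succ_apply,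
        v₂, w₂, b₁, b₂, order]
      refine ⟨rfl, ?_⟩
      rw [show o + 2 + u.len + v.len = o + (v.len + 1 + u.len + 1) by ring]
    · intro ho
      have e : o + (u.len + v.len + 2) - 1 = o + 2 + u.len + v.len - 1 := by omega
      have x₁ : visits mate (u.len + 2) (true, o + 1 + u.len) =
          (o + 1 + u.len) :: (order (o + 1) u ++ [o]) := by
        rw [visits, v₃, w₃, visits_add, a₁, a₂, visits, v₄]; rfl
      have x₂ : (advance mate)^[u.len + 2] (true, o + 1 + u.len) = (true, o - 1) := by
        rw [Function.iterate_succ_apply, w₃, Function.iterate_succ_apply', a₂, w₄]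
      rw [e, show u.len + v.len + 2 = v.len + (u.len + 2) by ring, visits_add, b₃,
        add_comm v.len, Function.iterate_add_apply, b₄,
        show o + 2 + u.len - 1 = o + 1 + u.len by omega, x₁, x₂, order]
      simp

/-- The vertices in the order of the traversal that starts forward at the position `0`. -/
theorem visits_run {col : ℕ → Bool} {t : Forest} (hc : t.Colored col 0) :
    visits (Stack.run col 0 ⟨0, fun _ => 0, fun _ => 0⟩ t.len).mate t.len (false, 0) =
      t.order 0 :=
  (visits_forest (Stack.run_forest hc _).2.2.2).1.1

theorem advance_le {mate : ℕ → ℕ} {M : ℕ} (h : ∀ x, mate x ≤ M) (k : ℕ) :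
    ((advance mate)^[k] (false, 0)).2 ≤ M + 1 := by
  cases k with
  | zero => exact Nat.zero_le _
  | succ k =>
    rw [Function.iterate_succ_apply']
    generalize (advance mate)^[k] (false, 0) = σ
    have := h σ.2
    unfold advance
    split_ifs <;> simp only <;> omega

/-! ### Reading a cyclic list from a given position in either direction -/

theorem tourEdges_rotate (c : List ℕ) (k : ℕ) : tourEdges (c.rotate k) = tourEdges c := by
  have : c.rotate k = c.drop (k % c.length) ++ c.take (k % c.length) := by
    rw [← List.rotate_mod]
    rcases Nat.eq_zero_or_pos c.length with h | h
    · rw [List.eq_nil_of_length_eq_zero h]; simp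
    · exact List.rotate_eq_drop_append_take (Nat.mod_lt _ h).le
  rw [this, tourEdges_comm, List.take_append_drop]

theorem tourEdges_reverse (c : List ℕ) : tourEdges c.reverse = tourEdges c := by
  rcases eq_or_ne c [] with rfl | h
  · rfl
  · obtain ⟨a, b, hab⟩ := exists_ends h
    rw [tourEdges_eq hab, tourEdges_eq hab.reverse, pathEdges_reverse, Sym2.eq_swap]

theorem iterate_rot_lt {M d j : ℕ} (hd : d ≤ M) (hj : j < M) (k : ℕ) : (rot M d)^[k] j < M := by
  induction k with
  | zero => exact hj
  | succ k ih => rw [Function.iterate_succ_apply']; exact rot_lt hd ih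

theorem iterate_rot_mod {M d j : ℕ} (hd : d ≤ M) (hj : j < M) (k : ℕ) :
    (rot M d)^[k] j = (j + k * d) % M := by
  induction k with
  | zero => simp [Nat.mod_eq_of_lt hj]
  | succ k ih =>
    have hlt := iterate_rot_lt hd hj k
    rw [Function.iterate_succ_apply', add_mul, one_mul, ← add_assoc, Nat.add_mod, ← ih]
    generalize (rot M d)^[k] j = x at hlt ⊢
    rcases Nat.eq_or_lt_of_le hd with rfl | h
    · rw [Nat.mod_self, add_zero, Nat.mod_eq_of_lt hlt]
      unfold rot; split_ifs <;> omega
    · rw [Nat.mod_eq_of_lt h]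
      unfold rot
      split_ifs with h'
      · rw [Nat.mod_eq_of_lt h']
      · rw [Nat.mod_eq_sub_mod (by omega), Nat.mod_eq_of_lt (by omega)]

/-- The list obtained from `Z` by starting at the index `j` and adding `d` to the index each time. -/
def readOff (Z : ℕ → ℕ) (M d j : ℕ) : List ℕ := (List.range M).map fun i => Z ((rot M d)^[i] j)

theorem readOff_forward {Z : ℕ → ℕ} {M j : ℕ} (hj : j < M) :
    readOff Z M 1 j = ((List.range M).map Z).rotate j := by
  refine List.ext_getElem (by simp [readOff]) fun i h₁ h₂ => ?_
  simp only [readOff, List.length_map, List.length_range] at h₁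
  simp only [readOff, List.getElem_map, List.getElem_range, List.getElem_rotate, List.length_map,
    List.length_range]
  rw [iterate_rot_mod (by omega) hj, mul_one, add_comm]

/-- Modulo `M`, adding `M - 1` means stepping back by one, which unsigned integers permit. -/
theorem readOff_backward {Z : ℕ → ℕ} {M j : ℕ} (hj : j < M) :
    readOff Z M (M - 1) j = ((List.range M).map Z).reverse.rotate (M - 1 - j) := by
  refine List.ext_getElem (by simp [readOff]) fun i h₁ h₂ => ?_
  simp only [readOff, List.length_map, List.length_range] at h₁
  simp only [readOff, List.getElem_map, List.getElem_range, List.getElem_rotate, List.length_map,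
    List.length_range, List.getElem_reverse, List.length_reverse]
  rw [iterate_rot_mod (by omega) hj]
  congr 1
  rcases Nat.lt_or_ge j i with h | h
  · rw [Nat.mod_eq_sub_mod (show M ≤ i + (M - 1 - j) by omega),
      Nat.mod_eq_of_lt (show i + (M - 1 - j) - M < M by omega)]
    obtain ⟨a, rfl⟩ : ∃ a, M = a + 1 := ⟨M - 1, by omega⟩
    obtain ⟨b, rfl⟩ : ∃ b, i = b + 1 := ⟨i - 1, by omega⟩
    rw [show j + (b + 1) * (a + 1 - 1) = (j + (a - b)) + (a + 1) * b by
      obtain ⟨c, rfl⟩ : ∃ c, a = b + c := ⟨a - b, by omega⟩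
      rw [Nat.add_sub_cancel, Nat.add_sub_cancel_left]; ring, Nat.add_mul_mod_self_left,
      Nat.mod_eq_of_lt (by omega)]
    omega
  · rw [Nat.mod_eq_of_lt (show i + (M - 1 - j) < M by omega)]
    obtain ⟨a, rfl⟩ : ∃ a, M = a + 1 := ⟨M - 1, by omega⟩
    rw [show j + i * (a + 1 - 1) = (j - i) + (a + 1) * i by
      obtain ⟨c, rfl⟩ : ∃ c, j = i + c := ⟨j - i, by omega⟩
      rw [Nat.add_sub_cancel, Nat.add_sub_cancel_left]; ring, Nat.add_mul_mod_self_left,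
      Nat.mod_eq_of_lt (by omega)]
    omega

theorem ends_readOff {Z : ℕ → ℕ} {M d j : ℕ} (hM : 0 < M) :
    Ends (readOff Z M d j) (Z j) (Z ((rot M d)^[M - 1] j)) := by
  obtain ⟨m, rfl⟩ : ∃ m, M = m + 1 := ⟨M - 1, by omega⟩
  constructor
  · rw [readOff, List.range_succ_eq_map]; rfl
  · rw [readOff, List.range_succ, List.map_append]
    exact List.getLast?_concat

/-- The two neighbors of the first vertex of a tour are the second and the last vertex. -/
theorem Ends.eq_of_mem_tourEdges {c : List ℕ} {a b x y : ℕ} (hn : (a :: x :: c).Nodup)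
    (hE : Ends (a :: x :: c) a b) (hy : s(a, y) ∈ tourEdges (a :: x :: c)) : y = x ∨ y = b := by
  have hne := List.nodup_cons.1 hn
  rw [tourEdges_eq hE, Multiset.mem_add, pathEdges, Multiset.mem_add, Multiset.mem_singleton,
    Multiset.mem_singleton] at hy
  rcases hy with (h | h) | h
  · rw [Sym2.eq_iff] at h
    rcases h with ⟨-, h⟩ | ⟨h, -⟩
    · exact Or.inl h
    · exact absurd (h ▸ List.mem_cons_self) hne.1
  · exact absurd (mem_of_mem_pathEdges h).1 hne.1
  · rw [Sym2.eq_iff] at h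
    rcases h with ⟨h, h'⟩ | ⟨-, h⟩
    · exact Or.inr (h'.trans h)
    · exact Or.inr h

/-- What is computed: from a shortest tour `Z`, the one that starts with `r` and, if possible, ends
with `b`. -/
theorem BestTour.tour_readOff {col : ℕ → Bool} {M j d r b : ℕ} {Z : ℕ → ℕ}
    (h : BestTour col M ((List.range M).map Z)) (hM : 2 ≤ M) (hj : j < M) (hr : Z j = r)
    (hd : d = if Z (rot M 1 j) = b then M - 1 else 1) :
    BestTour col M (readOff Z M d j) ∧ ∃ b', Ends (readOff Z M d j) r b' ∧
      (s(r, b) ∈ tourEdges ((List.range M).map Z) → b' = b) := by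
  have hB : BestTour col M (readOff Z M d j) := by
    split_ifs at hd
    · rw [hd, readOff_backward hj]
      exact h.of_edges ((List.rotate_perm _ _).trans (List.reverse_perm _))
        (by rw [tourEdges_rotate, tourEdges_reverse])
    · rw [hd, readOff_forward hj]
      exact h.of_edges (List.rotate_perm _ _) (tourEdges_rotate _ _)
  subst hr
  refine ⟨hB, _, ends_readOff (by omega), ?_⟩
  -- If `b` is the successor of `r`, the tour is read backward, and `b` comes last. Otherwise it is
  -- read forward; if `rb` is an edge, then `b` is the other neighbor of `r`, the last vertex.
  split_ifs at hd with hb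
  · intro _
    rw [← hb, hd, iterate_rot_mod (by omega) hj]
    congr 1
    obtain ⟨a, rfl⟩ : ∃ a, M = a + 2 := ⟨M - 2, by omega⟩
    -- Modulo `M`, the square of `M - 1` is `1`, so the last index read is `j + 1`.
    rw [show j + (a + 2 - 1) * (a + 2 - 1) = (j + 1) + (a + 2) * a by
      rw [show a + 2 - 1 = a + 1 by omega]; ring, Nat.add_mul_mod_self_left]
    have := iterate_rot_mod (M := a + 2) (d := 1) (by omega) hj 1
    rw [Function.iterate_one, one_mul] at this
    exact this.symm
  · intro hmem
    have hE := ends_readOff (Z := Z) (M := M) (d := d) (j := j) (by omega)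
    have hmem' : s(Z j, b) ∈ tourEdges (readOff Z M d j) := by
      rw [hd, readOff_forward hj, tourEdges_rotate]; exact hmem
    have hn := hB.isTour.nodup
    obtain ⟨m, rfl⟩ : ∃ m, M = m + 2 := ⟨M - 2, by omega⟩
    have e : ∃ c, readOff Z (m + 2) d j = Z j :: Z (rot (m + 2) 1 j) :: c := by
      rw [readOff, List.range_succ_eq_map, List.range_succ_eq_map, hd]
      exact ⟨_, rfl⟩
    obtain ⟨c, e⟩ := e
    rw [e] at hn hmem' hE
    rcases hE.eq_of_mem_tourEdges hn hmem' with h | h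
    · exact absurd h.symm hb
    · exact h.symm

end Chord

/-! ## Points in clockwise order -/

namespace BicoloredPoints

variable {N : ℕ} {S : BicoloredPoints N}

theorem orient_rotate (a b c : EuclideanSpace ℝ (Fin 2)) : orient a b c = orient b c a := by
  unfold orient; ring

theorem orient_swap (a b c : EuclideanSpace ℝ (Fin 2)) : orient a b c = - orient a c b := by
  unfold orient; ring

theorem orient_left (a b : EuclideanSpace ℝ (Fin 2)) : orient a b a = 0 := by
  unfold orient; ring

theorem orient_right (a b : EuclideanSpace ℝ (Fin 2)) : orient a b b = 0 := by
  unfold orient; ring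

theorem orient_comb (a b c d : EuclideanSpace ℝ (Fin 2)) {s t : ℝ} (h : s + t = 1) :
    orient a b (s • c + t • d) = s * orient a b c + t * orient a b d := by
  obtain rfl : s = 1 - t := by linarith
  simp only [orient, PiLp.add_apply, PiLp.smul_apply, smul_eq_mul]
  ring

/-- The three-term Grassmann–Plücker relation. -/
theorem orient_plucker (p a b c d : EuclideanSpace ℝ (Fin 2)) :
    orient p a c * orient p b d =
      orient p a b * orient p c d + orient p a d * orient p b c := by
  unfold orient; ring

/-- The hypothesis concerns hull edges only. The signs of the other triples follow by increasing `k`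
one step at a time. -/
theorem ClockwiseOrder.orient_neg (h : S.ClockwiseOrder) {i j k : Fin N} (hij : i < j)
    (hjk : j < k) : orient (S.pos i) (S.pos j) (S.pos k) < 0 := by
  have h₁ : ∀ a b : Fin N, (b : ℕ) = a + 1 → ∀ k, k ≠ a → k ≠ b →
      orient (S.pos a) (S.pos b) (S.pos k) < 0 := by
    intro a b hab k hka hkb
    refine h a b k ?_ hka hkb
    have := b.2
    rw [IsNext, hab, Nat.mod_eq_of_lt (by omega)]
  have h₂ : ∀ m (k : Fin N), (k : ℕ) = j + 1 + m →
      orient (S.pos i) (S.pos j) (S.pos k) < 0 := by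
    intro m
    induction m with
    | zero =>
      intro k hk
      rw [orient_rotate]
      exact h₁ j k (by omega) i (by omega) (by omega)
    | succ m ih =>
      intro k hk
      have hi : (i : ℕ) < j := hij
      have hjN := j.2
      have hkN := k.2
      by_cases hji : (j : ℕ) = i + 1
      · exact h₁ i j hji k (by omega) (by omega)
      let a : Fin N := ⟨i + 1, by omega⟩
      let k' : Fin N := ⟨j + 1 + m, by omega⟩
      have e₁ : orient (S.pos i) (S.pos a) (S.pos j) < 0 :=
        h₁ i a rfl j (by omega) (by simp only [a, ne_eq, Fin.ext_iff]; omega)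
      have e₂ : orient (S.pos i) (S.pos a) (S.pos k) < 0 :=
        h₁ i a rfl k (by omega) (by simp only [a, ne_eq, Fin.ext_iff]; omega)
      have e₃ : orient (S.pos i) (S.pos a) (S.pos k') < 0 :=
        h₁ i a rfl k' (by simp only [k', ne_eq, Fin.ext_iff]; omega)
          (by simp only [a, k', ne_eq, Fin.ext_iff]; omega)
      have e₄ : orient (S.pos i) (S.pos k') (S.pos k) < 0 := by
        rw [orient_rotate]
        exact h₁ k' k (by simp only [k']; omega) i (by simp only [k', ne_eq, Fin.ext_iff]; omega)
          (by omega)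
      have e₅ := ih k' rfl
      -- With base point `i` and the points `i + 1`, `j`, `k - 1`, `k`, both products on the right
      -- are positive. The first factor on the left is negative, so the other one, the orientation
      -- sought, is negative too.
      have e₆ := orient_plucker (S.pos i) (S.pos a) (S.pos j) (S.pos k') (S.pos k)
      by_contra hc
      rw [not_lt] at hc
      nlinarith [mul_pos_of_neg_of_neg e₁ e₄, mul_pos_of_neg_of_neg e₂ e₅,
        mul_nonpos_of_nonpos_of_nonneg e₃.le hc]
  exact h₂ (k - (j + 1)) k (by have : (j : ℕ) < k := hjk; omega)

theorem ClockwiseOrder.orient_pos_of_inside (h : S.ClockwiseOrder) {a b x : Fin N} (hax : a < x)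
    (hxb : x < b) : 0 < orient (S.pos a) (S.pos b) (S.pos x) := by
  rw [orient_swap]
  linarith [h.orient_neg hax hxb]

theorem ClockwiseOrder.orient_neg_of_outside (h : S.ClockwiseOrder) {a b x : Fin N} (hab : a < b)
    (hx : x < a ∨ b < x) : orient (S.pos a) (S.pos b) (S.pos x) < 0 := by
  rcases hx with hx | hx
  · rw [← orient_rotate]
    exact h.orient_neg hx hab
  · exact h.orient_neg hab hx

/-- The intersection point is given by Cramer's rule: its weights on each segment are proportional
to the distances of the ends from the line of the other segment. -/
theorem exists_mem_openSegment {a b c d : EuclideanSpace ℝ (Fin 2)} (hc : 0 < orient a b c)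
    (hd : orient a b d < 0) (ha : orient c d a < 0) (hb : 0 < orient c d b) :
    (openSegment ℝ a b ∩ openSegment ℝ c d).Nonempty := by
  have hD : orient a b c - orient a b d = orient c d b - orient c d a := by
    unfold orient; ring
  have hD₀ : 0 < orient a b c - orient a b d := by linarith
  set D := orient a b c - orient a b d with hDdef
  refine ⟨(orient c d b / D) • a + (-orient c d a / D) • b,
    ⟨_, _, by positivity, div_pos (by linarith) hD₀, ?_, rfl⟩,
    ⟨-orient a b d / D, orient a b c / D, div_pos (by linarith) hD₀, by positivity, ?_, ?_⟩⟩
  · field_simp; linarith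
  · field_simp; linarith
  · ext i
    simp only [PiLp.add_apply, PiLp.smul_apply, smul_eq_mul]
    field_simp
    fin_cases i <;> simp [orient] <;> ring

/-- One of `c` and `d` may lie on the line `ab`, which is what happens for edges with a common
endpoint; the sum excludes that both do. -/
theorem not_nonempty_of_same_side {a b c d : EuclideanSpace ℝ (Fin 2)}
    (h : (0 ≤ orient a b c ∧ 0 ≤ orient a b d ∧ 0 < orient a b c + orient a b d) ∨
      (orient a b c ≤ 0 ∧ orient a b d ≤ 0 ∧ orient a b c + orient a b d < 0)) :
    ¬ (openSegment ℝ a b ∩ openSegment ℝ c d).Nonempty := by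
  rintro ⟨x, ⟨s, t, hs, ht, hst, rfl⟩, ⟨s', t', hs', ht', hst', hx⟩⟩
  have h₁ := orient_comb a b a b hst
  rw [orient_left, orient_right, ← hx, orient_comb _ _ _ _ hst'] at h₁
  rcases h with ⟨h₂, h₃, h₄⟩ | ⟨h₂, h₃, h₄⟩
  · rcases lt_or_eq_of_le h₂ with h₅ | h₅
    · nlinarith [mul_pos hs' h₅, mul_nonneg ht'.le h₃]
    · nlinarith [mul_pos ht' (show 0 < orient a b d by linarith)]
  · rcases lt_or_eq_of_le h₂ with h₅ | h₅
    · nlinarith [mul_pos hs' (neg_pos.2 h₅), mul_nonneg ht'.le (neg_nonneg.2 h₃)]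
    · nlinarith [mul_pos ht' (show 0 < -orient a b d by linarith)]

theorem cross_mk {a b c d : Fin N} : S.Cross s(a, b) s(c, d) ↔
    (openSegment ℝ (S.pos a) (S.pos b) ∩ openSegment ℝ (S.pos c) (S.pos d)).Nonempty := by
  constructor
  · rintro ⟨a', b', c', d', h₁, h₂, h₃⟩
    rcases Sym2.eq_iff.1 h₁ with ⟨rfl, rfl⟩ | ⟨rfl, rfl⟩ <;>
    rcases Sym2.eq_iff.1 h₂ with ⟨rfl, rfl⟩ | ⟨rfl, rfl⟩
    · exact h₃
    · rwa [openSegment_symm ℝ (S.pos c)]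
    · rwa [openSegment_symm ℝ (S.pos a)]
    · rwa [openSegment_symm ℝ (S.pos a), openSegment_symm ℝ (S.pos c)]
  · exact fun h => ⟨a, b, c, d, rfl, rfl, h⟩

theorem ClockwiseOrder.cross_iff_of_lt (h : S.ClockwiseOrder) {a b c d : Fin N} (hab : a < b)
    (hcd : c < d) (hne : ¬ (a = c ∧ b = d)) :
    S.Cross s(a, b) s(c, d) ↔ (a < c ∧ c < b ∧ b < d) ∨ (c < a ∧ a < d ∧ d < b) := by
  rw [cross_mk]
  constructor
  · intro hx
    by_contra hcon
    refine not_nonempty_of_same_side ?_ hx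
    have key : ∀ x, (x = a ∨ x = b) ∧ orient (S.pos a) (S.pos b) (S.pos x) = 0 ∨
        (a < x ∧ x < b) ∧ 0 < orient (S.pos a) (S.pos b) (S.pos x) ∨
        (x < a ∨ b < x) ∧ orient (S.pos a) (S.pos b) (S.pos x) < 0 := by
      intro x
      rcases lt_trichotomy x a with h₁ | rfl | h₁
      · exact Or.inr (Or.inr ⟨Or.inl h₁, h.orient_neg_of_outside hab (Or.inl h₁)⟩)
      · exact Or.inl ⟨Or.inl rfl, orient_left _ _⟩
      · rcases lt_trichotomy x b with h₂ | rfl | h₂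
        · exact Or.inr (Or.inl ⟨⟨h₁, h₂⟩, h.orient_pos_of_inside h₁ h₂⟩)
        · exact Or.inl ⟨Or.inr rfl, orient_right _ _⟩
        · exact Or.inr (Or.inr ⟨Or.inr h₂, h.orient_neg_of_outside hab (Or.inr h₂)⟩)
    rcases key c with ⟨hc, hc'⟩ | ⟨hc, hc'⟩ | ⟨hc, hc'⟩ <;>
    rcases key d with ⟨hd, hd'⟩ | ⟨hd, hd'⟩ | ⟨hd, hd'⟩
    · exfalso; omega
    · left; exact ⟨hc'.ge, hd'.le, by linarith⟩
    · right; exact ⟨hc'.le, hd'.le, by linarith⟩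
    · left; exact ⟨hc'.le, hd'.ge, by linarith⟩
    · left; exact ⟨hc'.le, hd'.le, by linarith⟩
    · exfalso; omega
    · right; exact ⟨hc'.le, hd'.le, by linarith⟩
    · exfalso; omega
    · right; exact ⟨hc'.le, hd'.le, by linarith⟩
  · rintro (⟨h₁, h₂, h₃⟩ | ⟨h₁, h₂, h₃⟩)
    · exact exists_mem_openSegment (h.orient_pos_of_inside h₁ h₂)
        (h.orient_neg_of_outside hab (Or.inr h₃)) (h.orient_neg_of_outside hcd (Or.inl h₁))
        (h.orient_pos_of_inside h₂ h₃)
    · rw [Set.inter_comm]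
      exact exists_mem_openSegment (h.orient_pos_of_inside h₁ h₂)
        (h.orient_neg_of_outside hcd (Or.inr h₃)) (h.orient_neg_of_outside hab (Or.inl h₁))
        (h.orient_pos_of_inside h₂ h₃)

/-- The numbering `φ` need not be the identity: when a point is inserted, the original points keep
their order but get shifted numbers. -/
theorem ClockwiseOrder.cross_iff (h : S.ClockwiseOrder) {φ : Fin N → ℕ} (hφ : StrictMono φ)
    {e f : Sym2 (Fin N)} (he : ¬ e.IsDiag) (hf : ¬ f.IsDiag) (hef : e ≠ f) :
    S.Cross e f ↔ Chord.Crosses (e.map φ) (f.map φ) := by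
  have key : ∀ a b c d : Fin N, a < b → c < d → s(a, b) ≠ s(c, d) →
      (S.Cross s(a, b) s(c, d) ↔ Chord.Crosses s(φ a, φ b) s(φ c, φ d)) := by
    intro a b c d hab hcd hne
    rw [h.cross_iff_of_lt hab hcd (by rintro ⟨rfl, rfl⟩; exact hne rfl),
      Chord.crosses_mk_of_le (hφ hab).le (hφ hcd).le]
    simp only [hφ.lt_iff_lt]
  induction e with | _ a b
  induction f with | _ c d
  rw [Sym2.mk_isDiag_iff] at he hf
  rcases lt_or_gt_of_ne he with h₁ | h₁ <;> rcases lt_or_gt_of_ne hf with h₂ | h₂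
  · exact key a b c d h₁ h₂ hef
  · rw [Sym2.eq_swap (a := c)] at hef ⊢
    exact key a b d c h₁ h₂ hef
  · rw [Sym2.eq_swap (a := a)] at hef ⊢
    exact key b a c d h₁ h₂ hef
  · rw [Sym2.eq_swap (a := a), Sym2.eq_swap (a := c)] at hef ⊢
    exact key b a d c h₁ h₂ hef

/-- Counting crossings twice. -/
theorem ClockwiseOrder.two_mul_crossings (h : S.ClockwiseOrder) {φ : Fin N → ℕ} (hφ : StrictMono φ)
    {F : Finset (Sym2 (Fin N))} (hF : ∀ e ∈ F, ¬ e.IsDiag) :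
    2 * S.crossings F = Chord.total (F.val.map (Sym2.map φ)) := by
  classical
  -- The handshake lemma for the graph whose vertices are the edges and whose adjacency is crossing:
  -- `total` is its degree sum.
  let G : SimpleGraph (Sym2 (Fin N)) :=
    { Adj := fun e f => e ∈ F ∧ f ∈ F ∧ Chord.Crosses (e.map φ) (f.map φ)
      symm := ⟨fun e f ⟨h₁, h₂, h₃⟩ => ⟨h₂, h₁, h₃.symm⟩⟩
      loopless := ⟨fun e h => Chord.not_crosses_self _ h.2.2⟩ }
  have hG : S.crossings F = G.edgeFinset.card := by
    rw [crossings, ← Set.ncard_coe_finset, SimpleGraph.coe_edgeFinset]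
    congr 1
    ext q
    induction q with | _ x y
    simp only [Set.mem_ofPred_eq, SimpleGraph.mem_edgeSet, G, Finset.mem_coe]
    constructor
    · rintro ⟨e, he, f, hf, hef, hx, hq⟩
      rw [h.cross_iff hφ (hF e he) (hF f hf) hef] at hx
      rcases Sym2.eq_iff.1 hq with ⟨rfl, rfl⟩ | ⟨rfl, rfl⟩
      · exact ⟨he, hf, hx⟩
      · exact ⟨hf, he, hx.symm⟩
    · rintro ⟨he, hf, hx⟩
      have hef : x ≠ y := by rintro rfl; exact Chord.not_crosses_self _ hx
      exact ⟨x, he, y, hf, hef, (h.cross_iff hφ (hF x he) (hF y hf) hef).2 hx, rfl⟩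
  rw [hG, ← SimpleGraph.sum_degrees_eq_twice_card_edges, Chord.total, Chord.crSum,
    Multiset.map_map]
  have hdeg : ∀ e, G.degree e = if e ∈ F then
      ((F.val.map (Sym2.map φ)).map (Chord.cr (e.map φ))).sum else 0 := by
    intro e
    split_ifs with he
    · rw [Multiset.map_map]
      change _ = ∑ f ∈ F, Chord.cr (e.map φ) (f.map φ)
      rw [← SimpleGraph.card_neighborFinset_eq_degree, SimpleGraph.neighborFinset_eq_filter]
      simp only [Chord.cr, Finset.sum_boole, Nat.cast_id]
      congr 1
      ext f
      simp [G, he]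
    · rw [← SimpleGraph.card_neighborFinset_eq_degree, Finset.card_eq_zero,
        SimpleGraph.neighborFinset_eq_filter]
      simp [G, he]
  rw [Finset.sum_congr rfl fun e _ => hdeg e, ← Finset.sum_filter]
  simp only [Finset.filter_mem_eq_inter, Finset.univ_inter]
  rfl

end BicoloredPoints

/-! ## Hamiltonian paths and cycles as lists of indices -/

namespace Chord

/-- A tour with the minimum number of crossings that starts with `r` and, if it contains the edge
`rb`, ends with `b`. -/
structure IsSolution (col : ℕ → Bool) (M r b : ℕ) (c : List ℕ) : Prop where
  best : BestTour col M c
  ends : ∃ b', Ends c r b' ∧ (s(r, b) ∈ tourEdges c → b' = b)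

theorem exists_height_le (col : ℕ → Bool) (M : ℕ) :
    ∃ s, s ≤ M ∧ ∀ k, k ≤ M → height col s ≤ height col k := by
  obtain ⟨s, hs, h⟩ := Finset.exists_min_image (Finset.range (M + 1)) (height col) ⟨0, by simp⟩
  exact ⟨s, by simpa [Nat.lt_succ_iff] using hs,
    fun k hk => h k (by simpa [Nat.lt_succ_iff] using hk)⟩

theorem BestTour.exists_index {col : ℕ → Bool} {M r : ℕ} {Z : ℕ → ℕ}
    (h : BestTour col M ((List.range M).map Z)) (hr : r < M) : ∃ j, j < M ∧ Z j = r := by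
  have := h.perm.mem_iff.2 (List.mem_range.2 hr)
  obtain ⟨j, hj, hjr⟩ := List.mem_map.1 this
  exact ⟨j, List.mem_range.1 hj, hjr⟩

theorem BestTour.isSolution {col : ℕ → Bool} {M j d r b : ℕ} {Z : ℕ → ℕ}
    (h : BestTour col M ((List.range M).map Z)) (hM : 2 ≤ M) (hj : j < M) (hr : Z j = r)
    (hd : d = if Z (rot M 1 j) = b then M - 1 else 1) :
    IsSolution col M r b (readOff Z M d j) := by
  obtain ⟨h₁, b', h₂, h₃⟩ := h.tour_readOff hM hj hr hd
  refine ⟨h₁, b', h₂, fun hmem => h₃ ?_⟩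
  split_ifs at hd
  · rwa [hd, readOff_backward hj, tourEdges_rotate, tourEdges_reverse] at hmem
  · rwa [hd, readOff_forward hj, tourEdges_rotate] at hmem

theorem exists_isSolution {col : ℕ → Bool} {M r : ℕ} (h : height col M = 0) (hM : 2 ≤ M)
    (hr : r < M) (b : ℕ) : ∃ c, IsSolution col M r b c := by
  obtain ⟨s, hs, hmin⟩ := exists_height_le col M
  obtain ⟨t, ht, hc⟩ := exists_forest_rot hs h hmin
  have hB := bestTour_map_rot (by omega) hs ht hc
  have e : (List.range M).map (fun i => ((t.order 0).map (rot M s)).getD i 0) =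
      (t.order 0).map (rot M s) := by
    refine List.ext_getElem (by simp [Forest.length_order, ht]) fun i h₁ h₂ => ?_
    rw [List.getElem_map, List.getElem_range]
    exact List.getD_eq_getElem _ _ h₂
  rw [← e] at hB
  obtain ⟨j, hj, hjr⟩ := hB.exists_index hr
  exact ⟨_, hB.isSolution hM hj hjr rfl⟩

theorem BestTour.mem_of_next {col : ℕ → Bool} {M a b : ℕ} {c : List ℕ} (h : BestTour col M c)
    (ha : a < M) (hab : b = (a + 1) % M) (hc : col a ≠ col b) : s(a, b) ∈ tourEdges c := by
  rcases Nat.lt_or_ge (a + 1) M with hlt | hge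
  · rw [Nat.mod_eq_of_lt hlt] at hab
    subst hab
    exact h.mem_of_ne a hlt hc
  · obtain rfl : a = M - 1 := by omega
    rw [show M - 1 + 1 = M by omega, Nat.mod_self] at hab
    subst hab
    exact h.last_mem hc

theorem BestTour.not_improvable {col : ℕ → Bool} {M : ℕ} {c c' : List ℕ} (h : BestTour col M c)
    (hp : c'.Perm (List.range M)) (hle : total (tourEdges c') ≤ total (tourEdges c)) :
    ¬ Improvable col c' := by
  rintro ⟨d, h₁, h₂, h₃⟩
  have := h.le_total d h₂ (h₁.trans hp)
  omega

theorem not_crosses_last {M a b : ℕ} (ha : a < M) (hb : b < M) :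
    ¬ Crosses s(M - 1, 0) s(a, b) := by
  rw [crosses_mk]; omega

theorem not_crosses_next {M a b c d : ℕ} (ha : a < M) (hab : b = (a + 1) % M) (hc : c < M)
    (hd : d < M) : ¬ Crosses s(a, b) s(c, d) := by
  rcases Nat.lt_or_ge (a + 1) M with hlt | hge
  · rw [Nat.mod_eq_of_lt hlt] at hab
    subst hab
    exact not_crosses_succ _ _
  · obtain rfl : a = M - 1 := by omega
    rw [show M - 1 + 1 = M by omega, Nat.mod_self] at hab
    subst hab
    exact not_crosses_last hc hd

/-- Hull edges, including the one from `M - 1` to `0`, cross no chord. -/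
theorem total_add_singleton {M : ℕ} {E : Multiset (Sym2 ℕ)} {a b : ℕ}
    (hE : ∀ a b, s(a, b) ∈ E → a < M ∧ b < M) (ha : a < M) (hb : b < M)
    (hab : b = (a + 1) % M ∨ a = (b + 1) % M) : total (E + {s(a, b)}) = total E := by
  rw [total_add, total_singleton, crSum_comm, crSum_eq_zero (E := {s(a, b)})]
  · rfl
  · intro x hx f hf
    rw [Multiset.mem_singleton.1 hx]
    induction f with | _ c d
    obtain ⟨hc, hd⟩ := hE c d hf
    rcases hab with h | h
    · exact not_crosses_next ha h hc hd
    · rw [Sym2.eq_swap]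
      exact not_crosses_next hb h hc hd

end Chord

namespace BicoloredPoints

open Chord

variable {N : ℕ} {S : BicoloredPoints N} {φ : Fin N → ℕ} {col : ℕ → Bool}

theorem pathEdges_support {G : SimpleGraph (Fin N)} (φ : Fin N → ℕ) {u v : Fin N}
    (w : G.Walk u v) :
    pathEdges (w.support.map φ) = ((w.edges.map (Sym2.map φ) : List (Sym2 ℕ)) : Multiset _) := by
  induction w with
  | nil => rfl
  | @cons u v x h p ih =>
    cases p with
    | nil => rfl
    | cons h' p =>
      simp only [SimpleGraph.Walk.support_cons, List.map_cons, pathEdges,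
        SimpleGraph.Walk.edges_cons] at ih ⊢
      rw [ih]
      rfl

theorem mem_pathEdges_support {G : SimpleGraph (Fin N)} {u v : Fin N}
    {w : G.Walk u v} {e : Sym2 (Fin N)} (he : e ∈ w.edgeSet) :
    e.map φ ∈ pathEdges (w.support.map φ) := by
  rw [pathEdges_support, Multiset.mem_coe]
  exact List.mem_map_of_mem he

/-- Distinctness of the edges is needed because `edgeSet` forgets multiplicities, whereas
`pathEdges` does not. -/
theorem ClockwiseOrder.two_mul_crossings_edgeSet (h : S.ClockwiseOrder) (hφ : StrictMono φ)
    {u v : Fin N} {w : S.bichromatic.Walk u v} (hw : w.edges.Nodup) :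
    2 * S.crossings w.edgeSet = total (pathEdges (w.support.map φ)) := by
  rw [pathEdges_support, ← SimpleGraph.Walk.coe_edges_toFinset, h.two_mul_crossings hφ,
    List.toFinset_val, hw.dedup]
  · rfl
  · intro e he
    rw [List.mem_toFinset] at he
    exact S.bichromatic.not_isDiag_of_mem_edgeSet (w.edges_subset_edgeSet he)

theorem ClockwiseOrder.onePlane (h : S.ClockwiseOrder) (hφ : StrictMono φ) {u v : Fin N}
    {w : S.bichromatic.Walk u v} {c : List ℕ} (hc : IsTour col c)
    (hE : ∀ e ∈ pathEdges (w.support.map φ), e ∈ tourEdges c) (hI : ¬ Improvable col c) :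
    S.OnePlane w.edgeSet := by
  intro e he
  by_contra hcon
  rw [not_le, Set.one_lt_ncard (Set.toFinite _)] at hcon
  obtain ⟨f, ⟨hf, hfe, hfx⟩, g, ⟨hg, hge, hgx⟩, hfg⟩ := hcon
  have hd : ∀ x ∈ w.edgeSet, ¬ x.IsDiag := fun x hx =>
    S.bichromatic.not_isDiag_of_mem_edgeSet (w.edges_subset_edgeSet hx)
  refine hI (improvable_of_crosses_of_crosses hc (hE _ (mem_pathEdges_support he))
    (hE _ (mem_pathEdges_support hf)) (hE _ (mem_pathEdges_support hg))
    (fun h' => hfg (Sym2.map.injective hφ.injective h')) ?_ ?_)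
  · exact (h.cross_iff hφ (hd e he) (hd f hf) hfe.symm).1 hfx
  · exact (h.cross_iff hφ (hd e he) (hd g hg) hge.symm).1 hgx

theorem isChain_iff (hcol : ∀ i, col (φ i) = S.isRed i) {l : List (Fin N)} :
    l.IsChain S.bichromatic.Adj ↔ Bichromatic col (pathEdges (l.map φ)) := by
  induction l with
  | nil => simp [pathEdges, Bichromatic]
  | cons a t ih =>
    cases t with
    | nil => simp [pathEdges, Bichromatic]
    | cons b t =>
      simp only [List.isChain_cons_cons, List.map_cons, pathEdges, bichromatic_add,
        bichromatic_singleton, hcol] at ih ⊢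
      rw [ih]
      rfl

theorem exists_walk {G : SimpleGraph (Fin N)} {l : List (Fin N)} (h : l.IsChain G.Adj)
    {u v : Fin N} (hu : l.head? = some u) (hv : l.getLast? = some v) :
    ∃ w : G.Walk u v, w.support = l := by
  have hne : l ≠ [] := by rintro rfl; simp at hu
  rw [List.head?_eq_some_head hne, Option.some_inj] at hu
  rw [List.getLast?_eq_some_getLast hne, Option.some_inj] at hv
  subst hu hv
  exact ⟨_, SimpleGraph.Walk.support_ofSupport hne h⟩

theorem ends_support {G : SimpleGraph (Fin N)} (φ : Fin N → ℕ) {u v : Fin N} (w : G.Walk u v) :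
    Ends (w.support.map φ) (φ u) (φ v) := by
  constructor
  · rw [List.head?_map, List.head?_eq_some_head w.support_ne_nil, SimpleGraph.Walk.head_support]
    rfl
  · rw [List.getLast?_map, List.getLast?_eq_some_getLast w.support_ne_nil,
      SimpleGraph.Walk.getLast_support]
    rfl

theorem exists_map_eq {c : List ℕ} (hc : ∀ x ∈ c, ∃ i, φ i = x) : ∃ l : List (Fin N), l.map φ = c := by
  have : c ∈ Set.range (List.map φ) := by rw [Set.range_list_map]; exact hc
  exact this

theorem map_val_perm {l : List (Fin N)} (hn : l.Nodup) (hl : ∀ i, i ∈ l) :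
    (l.map Fin.val).Perm (List.range N) := by
  rw [List.perm_ext_iff_of_nodup (hn.map Fin.val_injective) List.nodup_range]
  intro a
  rw [List.mem_range, List.mem_map]
  exact ⟨fun ⟨i, _, hi⟩ => hi ▸ i.2, fun ha => ⟨⟨a, ha⟩, hl _, rfl⟩⟩

theorem lift_perm {c : List ℕ} (h : c.Perm (List.range N)) :
    ∃ l : List (Fin N), l.map Fin.val = c ∧ l.Nodup ∧ ∀ i, i ∈ l := by
  obtain ⟨l, rfl⟩ := exists_map_eq (φ := (Fin.val : Fin N → ℕ)) (c := c) fun x hx =>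
    ⟨⟨x, List.mem_range.1 (h.mem_iff.1 hx)⟩, rfl⟩
  refine ⟨l, rfl, (h.nodup_iff.2 List.nodup_range).of_map _, fun i => ?_⟩
  obtain ⟨j, hj, hji⟩ := List.mem_map.1 (h.mem_iff.2 (List.mem_range.2 i.2))
  rwa [← Fin.ext hji]

theorem outputs_of_support {s : RealRAM.State} {u v : Fin N} {w : S.bichromatic.Walk u v}
    {l : List ℕ} (h : w.support.map Fin.val = (List.range N).map (s.iarr 1) ++ l) :
    S.Outputs s w := by
  intro k
  have hlen := congrArg List.length h
  simp only [List.length_map, List.length_append, List.length_range,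
    SimpleGraph.Walk.length_support] at hlen
  have hk := k.2
  have h₁ : (w.support.map Fin.val)[(k : ℕ)]'(by simp; omega) = s.iarr 1 k := by
    simp only [h]
    rw [List.getElem_append_left (by simp)]
    simp
  rw [← h₁, List.getElem_map, SimpleGraph.Walk.getVert_eq_support_getElem _ (by omega)]

/-! ### Cycles -/

/-- The support of a closed walk lists the base point twice; without its last entry it is the list
of the tour. -/
theorem isTour_of_isHamiltonianCycle (hcol : ∀ i : Fin N, col i = S.isRed i) {u : Fin N}
    {w : S.bichromatic.Walk u u} (hw : w.IsHamiltonianCycle) :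
    IsTour col (w.support.dropLast.map Fin.val) ∧
      (w.support.dropLast.map Fin.val).Perm (List.range N) ∧
      tourEdges (w.support.dropLast.map Fin.val) = pathEdges (w.support.map Fin.val) := by
  have hnil := hw.isCycle.not_nil
  have e₁ : w.support.dropLast ++ [u] = w.support := by
    rw [← SimpleGraph.Walk.support_dropLast hnil, SimpleGraph.Walk.support_dropLast_concat hnil]
  have e₂ : u :: w.support.tail = w.support := w.cons_tail_support
  have hp : w.support.dropLast.Perm w.support.tail := by
    have : (u :: w.support.dropLast).Perm (u :: w.support.tail) := by
      rw [e₂]; nth_rw 2 [← e₁]; exact (List.perm_append_singleton _ _).symm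
    exact this.cons_inv
  have hcount := (SimpleGraph.Walk.isHamiltonianCycle_iff_isCycle_and_support_count_tail_eq_one.1
    hw).2
  have hperm : (w.support.dropLast.map Fin.val).Perm (List.range N) := by
    refine map_val_perm (hp.nodup_iff.2 hw.isCycle.support_nodup) fun i => hp.mem_iff.2 ?_
    exact List.one_le_count_iff.1 (hcount i).ge
  have htail : w.support.tail ≠ [] := fun h0 => by
    have := congrArg List.length h0
    rw [List.length_tail, w.length_support, List.length_nil] at this
    have := hw.isCycle.three_le_length
    omega
  have hdrop : w.support.dropLast = u :: w.support.tail.dropLast := by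
    nth_rw 1 [← e₂]; exact List.dropLast_cons_of_ne_nil htail
  have hE : tourEdges (w.support.dropLast.map Fin.val) = pathEdges (w.support.map Fin.val) := by
    rw [tourEdges]
    nth_rw 3 [← e₁]
    rw [List.map_append]
    congr 2
    rw [hdrop]; rfl
  refine ⟨⟨by simp [hdrop], hperm.nodup_iff.2 List.nodup_range, ?_⟩, hperm, hE⟩
  rw [hE]
  exact (isChain_iff hcol).1 w.isChain_adj_support

/-- At least three points are required, since a tour on two points uses one edge twice and is not a
cycle of the graph. -/
theorem exists_isHamiltonianCycle (hcol : ∀ i : Fin N, col i = S.isRed i) (hN : 3 ≤ N)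
    {c : List ℕ} (hc : IsTour col c) (hp : c.Perm (List.range N)) :
    ∃ (u : Fin N) (w : S.bichromatic.Walk u u), w.IsHamiltonianCycle ∧
      w.support.dropLast.map Fin.val = c := by
  obtain ⟨l, rfl, hn, hl⟩ := lift_perm hp
  cases l with
  | nil => exact absurd rfl hc.ne_nil
  | cons u t =>
    have hb := hc.bichromatic
    have hch : (u :: t ++ [u]).IsChain S.bichromatic.Adj := by
      rw [isChain_iff hcol]
      simpa [tourEdges] using hb
    obtain ⟨w, hw⟩ := exists_walk hch (u := u) (v := u) rfl List.getLast?_concat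
    have hlen : w.length = N := by
      have h₁ := hp.length_eq
      have h₂ := congrArg List.length hw
      simp only [List.length_map, List.length_range, List.length_cons, List.length_append,
        SimpleGraph.Walk.length_support, List.length_nil] at h₁ h₂
      omega
    have hwn : ¬ w.Nil := by
      intro h0
      have := SimpleGraph.Walk.length_eq_zero_iff.2 h0
      omega
    refine ⟨u, w, ?_, ?_⟩
    · rw [SimpleGraph.Walk.isHamiltonianCycle_iff_isCycle_and_length_eq,
        SimpleGraph.Walk.isCycle_iff_isPath_tail_and_le_length, Fintype.card_fin]
      refine ⟨⟨?_, by omega⟩, hlen⟩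
      refine SimpleGraph.Walk.IsPath.mk' ?_
      rw [SimpleGraph.Walk.support_tail_of_not_nil _ hwn, hw]
      exact (List.perm_append_singleton u t).nodup_iff.2 hn
    · rw [hw, List.dropLast_concat]

theorem exists_optimumCycle (h : S.ClockwiseOrder) (hcol : ∀ i : Fin N, col i = S.isRed i)
    (hN : 3 ≤ N) {c : List ℕ} (hc : BestTour col N c) :
    ∃ (u : Fin N) (w : S.bichromatic.Walk u u), S.IsOptimumCycle w ∧
      w.support.dropLast.map Fin.val = c := by
  obtain ⟨u, w, hw, rfl⟩ := exists_isHamiltonianCycle hcol hN hc.isTour hc.perm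
  refine ⟨u, w, ⟨hw, fun v w' hw' => ?_⟩, rfl⟩
  obtain ⟨-, -, h₃⟩ := isTour_of_isHamiltonianCycle hcol hw
  obtain ⟨h₄, h₅, h₆⟩ := isTour_of_isHamiltonianCycle hcol hw'
  have := hc.le_total _ h₄ h₅
  rw [h₃, h₆, ← h.two_mul_crossings_edgeSet Fin.val_strictMono hw.isCycle.edges_nodup,
    ← h.two_mul_crossings_edgeSet Fin.val_strictMono hw'.isCycle.edges_nodup] at this
  omega

theorem onePlane_of_isOptimumCycle (h : S.ClockwiseOrder) (hcol : ∀ i : Fin N, col i = S.isRed i)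
    (hN : 3 ≤ N) {c : List ℕ} (hc : BestTour col N c) {u : Fin N} {w : S.bichromatic.Walk u u}
    (hw : S.IsOptimumCycle w) : S.OnePlane w.edgeSet := by
  obtain ⟨v, w', hw', rfl⟩ := exists_isHamiltonianCycle hcol hN hc.isTour hc.perm
  obtain ⟨h₁, h₂, h₃⟩ := isTour_of_isHamiltonianCycle hcol hw.1
  obtain ⟨-, -, h₆⟩ := isTour_of_isHamiltonianCycle hcol hw'
  refine h.onePlane Fin.val_strictMono h₁ (fun e he => h₃ ▸ he) (hc.not_improvable h₂ ?_)
  have := hw.2 v w' hw'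
  rw [h₃, h₆, ← h.two_mul_crossings_edgeSet Fin.val_strictMono hw.1.isCycle.edges_nodup,
    ← h.two_mul_crossings_edgeSet Fin.val_strictMono hw'.isCycle.edges_nodup]
  omega

/-! ### Paths with consecutive endpoints of different colors -/

/-- The endpoints are hull neighbors, so closing the path adds an edge that crosses nothing. -/
theorem isTour_of_isHamiltonian (hcol : ∀ i : Fin N, col i = S.isRed i) {r b : Fin N}
    (hrb : S.isRed r ≠ S.isRed b) (hcons : Consecutive r b) {w : S.bichromatic.Walk r b}
    (hw : w.IsHamiltonian) :
    IsTour col (w.support.map Fin.val) ∧ (w.support.map Fin.val).Perm (List.range N) ∧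
      (∀ e ∈ pathEdges (w.support.map Fin.val), e ∈ tourEdges (w.support.map Fin.val)) ∧
      total (tourEdges (w.support.map Fin.val)) = total (pathEdges (w.support.map Fin.val)) := by
  have hE := tourEdges_eq (ends_support Fin.val w)
  have hp := map_val_perm hw.isPath.support_nodup hw.mem_support
  refine ⟨⟨by simp, hp.nodup_iff.2 List.nodup_range, ?_⟩, hp, fun e he => ?_, ?_⟩
  · rw [hE, bichromatic_add, bichromatic_singleton, hcol, hcol]
    exact ⟨(isChain_iff hcol).1 w.isChain_adj_support, hrb.symm⟩
  · rw [hE]; exact Multiset.mem_add.2 (Or.inl he)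
  · rw [hE]
    refine total_add_singleton (M := N) (fun x y hxy => ?_) b.2 r.2 hcons.symm
    have := mem_of_mem_pathEdges hxy
    rw [hp.mem_iff, hp.mem_iff, List.mem_range, List.mem_range] at this
    exact this

theorem exists_isHamiltonian (hcol : ∀ i : Fin N, col i = S.isRed i) {r b : Fin N} {c : List ℕ}
    (hc : IsTour col c) (hp : c.Perm (List.range N)) (hE : Ends c r b) :
    ∃ w : S.bichromatic.Walk r b, w.IsHamiltonian ∧ w.support.map Fin.val = c := by
  obtain ⟨l, rfl, hn, hl⟩ := lift_perm hp
  obtain ⟨h₁, h₂⟩ := hE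
  rw [List.head?_map] at h₁
  rw [List.getLast?_map] at h₂
  have hb := hc.bichromatic
  rw [tourEdges_eq ⟨by rw [List.head?_map]; exact h₁, by rw [List.getLast?_map]; exact h₂⟩,
    bichromatic_add, ← isChain_iff hcol] at hb
  obtain ⟨w, rfl⟩ := exists_walk hb.1 (u := r) (v := b)
    (Option.map_injective Fin.val_injective h₁) (Option.map_injective Fin.val_injective h₂)
  exact ⟨w, (SimpleGraph.Walk.IsPath.mk' hn).isHamiltonian_of_mem hl, rfl⟩

/-- A best tour contains every bichromatic hull edge, in particular `rb`. -/
theorem IsSolution.ends_of_consecutive (hcol : ∀ i : Fin N, col i = S.isRed i) {r b : Fin N}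
    (hrb : S.isRed r ≠ S.isRed b) (hcons : Consecutive r b) {c : List ℕ}
    (hc : IsSolution col N r b c) : Ends c r b := by
  obtain ⟨b', h₁, h₂⟩ := hc.ends
  rw [← h₂]
  · exact h₁
  · rcases hcons with h | h
    · exact hc.best.mem_of_next r.2 h (by rwa [hcol, hcol])
    · rw [Sym2.eq_swap]
      exact hc.best.mem_of_next b.2 h (by rw [hcol, hcol]; exact hrb.symm)

theorem exists_optimumPath (h : S.ClockwiseOrder) (hcol : ∀ i : Fin N, col i = S.isRed i)
    {r b : Fin N} (hrb : S.isRed r ≠ S.isRed b) (hcons : Consecutive r b) {c : List ℕ}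
    (hc : IsSolution col N r b c) :
    ∃ w : S.bichromatic.Walk r b, S.IsOptimumPath w ∧ w.support.map Fin.val = c := by
  obtain ⟨w, hw, rfl⟩ := exists_isHamiltonian hcol hc.best.isTour hc.best.perm
    (IsSolution.ends_of_consecutive hcol hrb hcons hc)
  refine ⟨w, ⟨hw, fun w' hw' => ?_⟩, rfl⟩
  obtain ⟨-, -, -, h₃⟩ := isTour_of_isHamiltonian hcol hrb hcons hw
  obtain ⟨h₄, h₅, -, h₆⟩ := isTour_of_isHamiltonian hcol hrb hcons hw'
  have := hc.best.le_total _ h₄ h₅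
  rw [h₃, h₆, ← h.two_mul_crossings_edgeSet Fin.val_strictMono hw.isPath.edges_nodup,
    ← h.two_mul_crossings_edgeSet Fin.val_strictMono hw'.isPath.edges_nodup] at this
  omega

theorem onePlane_of_isOptimumPath (h : S.ClockwiseOrder) (hcol : ∀ i : Fin N, col i = S.isRed i)
    {r b : Fin N} (hrb : S.isRed r ≠ S.isRed b) (hcons : Consecutive r b) {c : List ℕ}
    (hc : IsSolution col N r b c) {w : S.bichromatic.Walk r b} (hw : S.IsOptimumPath w) :
    S.OnePlane w.edgeSet := by
  obtain ⟨w', hw', rfl⟩ := exists_isHamiltonian hcol hc.best.isTour hc.best.perm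
    (IsSolution.ends_of_consecutive hcol hrb hcons hc)
  obtain ⟨h₁, h₂, h₃, h₄⟩ := isTour_of_isHamiltonian hcol hrb hcons hw.1
  obtain ⟨-, -, -, h₆⟩ := isTour_of_isHamiltonian hcol hrb hcons hw'
  refine h.onePlane Fin.val_strictMono h₁ h₃ (hc.best.not_improvable h₂ ?_)
  have := hw.2 w' hw'
  rw [h₄, h₆, ← h.two_mul_crossings_edgeSet Fin.val_strictMono hw.1.isPath.edges_nodup,
    ← h.two_mul_crossings_edgeSet Fin.val_strictMono hw'.isPath.edges_nodup]
  omega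

end BicoloredPoints

/-! ## Paths with consecutive endpoints of the same color -/

namespace BicoloredPoints

open Chord

variable {N : ℕ} {S : BicoloredPoints N} {φ : Fin N → ℕ} {col : ℕ → Bool}

/-- The points `φ i` together with a further blue point `x`, which is a neighbor of the two red
points `φ r` and `φ r'`. -/
structure IsExtension (S : BicoloredPoints N) (φ : Fin N → ℕ) (col : ℕ → Bool) (M x : ℕ)
    (r r' : Fin N) : Prop where
  strictMono : StrictMono φ
  lt : ∀ i, φ i < M
  ne : ∀ i, φ i ≠ x
  lt' : x < M
  surj : ∀ y, y < M → y ≠ x → ∃ i, φ i = y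
  col_map : ∀ i, col (φ i) = S.isRed i
  col_new : col x = false
  red : S.isRed r = true
  red' : S.isRed r' = true
  ne_ends : r ≠ r'
  next : x = (φ r + 1) % M ∨ φ r = (x + 1) % M
  next' : x = (φ r' + 1) % M ∨ φ r' = (x + 1) % M

variable {M x : ℕ} {r r' : Fin N}

/-- The path is closed through `x` by two hull edges, which add no crossings. -/
theorem IsExtension.isTour (h : IsExtension S φ col M x r r') {w : S.bichromatic.Walk r r'}
    (hw : w.IsHamiltonian) :
    IsTour col (w.support.map φ ++ [x]) ∧ (w.support.map φ ++ [x]).Perm (List.range M) ∧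
      (∀ e ∈ pathEdges (w.support.map φ), e ∈ tourEdges (w.support.map φ ++ [x])) ∧
      total (tourEdges (w.support.map φ ++ [x])) = total (pathEdges (w.support.map φ)) := by
  have hE := tourEdges_append (ends_support φ w) (ends_singleton x)
  have hn : (w.support.map φ ++ [x]).Nodup := by
    rw [(List.perm_append_singleton _ _).nodup_iff, List.nodup_cons]
    refine ⟨?_, hw.isPath.support_nodup.map h.strictMono.injective⟩
    rw [List.mem_map]
    rintro ⟨i, -, hi⟩
    exact h.ne i hi
  have hp : (w.support.map φ ++ [x]).Perm (List.range M) := by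
    rw [List.perm_ext_iff_of_nodup hn List.nodup_range]
    intro a
    rw [List.mem_range, List.mem_append, List.mem_map, List.mem_singleton]
    constructor
    · rintro (⟨i, -, rfl⟩ | rfl)
      · exact h.lt i
      · exact h.lt'
    · intro ha
      by_cases hax : a = x
      · exact Or.inr hax
      · obtain ⟨i, hi⟩ := h.surj a ha hax
        exact Or.inl ⟨i, hw.mem_support i, hi⟩
  have hlt : ∀ a b, s(a, b) ∈ pathEdges (w.support.map φ) → a < M ∧ b < M := by
    intro a b hab
    have := mem_of_mem_pathEdges hab
    simp only [List.mem_map] at this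
    obtain ⟨⟨i, -, rfl⟩, j, -, rfl⟩ := this
    exact ⟨h.lt i, h.lt j⟩
  simp only [pathEdges, add_zero] at hE
  refine ⟨⟨by simp, hn, ?_⟩, hp, fun e he => ?_, ?_⟩
  · rw [hE, bichromatic_add, bichromatic_add, bichromatic_singleton, bichromatic_singleton,
      h.col_map, h.col_map, h.col_new, h.red, h.red']
    exact ⟨⟨(isChain_iff h.col_map).1 w.isChain_adj_support, by simp⟩, by simp⟩
  · rw [hE, Multiset.mem_add, Multiset.mem_add]
    exact Or.inl (Or.inl he)
  · rw [hE, total_add_singleton (M := M) ?_ h.lt' (h.lt r) h.next.symm,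
      total_add_singleton hlt (h.lt r') h.lt' h.next']
    intro a b hab
    rw [Multiset.mem_add, Multiset.mem_singleton] at hab
    rcases hab with hab | hab
    · exact hlt a b hab
    · rcases Sym2.eq_iff.1 hab with ⟨rfl, rfl⟩ | ⟨rfl, rfl⟩
      · exact ⟨h.lt r', h.lt'⟩
      · exact ⟨h.lt', h.lt r'⟩

/-- The edges from `x` to `r` and `r'` are bichromatic hull edges, so a best tour contains both;
removing `x` leaves a path between `r` and `r'`. -/
theorem IsExtension.exists_isHamiltonian (h : IsExtension S φ col M x r r') {c : List ℕ}
    (hc : IsSolution col M (φ r) x c) :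
    ∃ w : S.bichromatic.Walk r r', w.IsHamiltonian ∧ w.support.map φ ++ [x] = c := by
  have hmem : ∀ i : Fin N, S.isRed i = true → (x = (φ i + 1) % M ∨ φ i = (x + 1) % M) →
      s(φ i, x) ∈ tourEdges c := by
    intro i hi hix
    have hcol : col (φ i) ≠ col x := by rw [h.col_map, h.col_new, hi]; simp
    rcases hix with hix | hix
    · exact hc.best.mem_of_next (h.lt i) hix hcol
    · rw [Sym2.eq_swap]
      exact hc.best.mem_of_next h.lt' hix hcol.symm
  have hr := hmem r h.red h.next
  have hr' := hmem r' h.red' h.next'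
  obtain ⟨b', hE, hb'⟩ := hc.ends
  obtain rfl := hb' hr
  have hn := hc.best.isTour.nodup
  obtain ⟨c₁, rfl⟩ : ∃ c₁, c = c₁ ++ [b'] := by
    have := hE.2
    rw [List.getLast?_eq_some_iff] at this
    exact this
  have hc₁ : c₁ ≠ [] := by
    rintro rfl
    have := hE.1
    simp only [List.nil_append, List.head?_cons, Option.some_inj] at this
    exact h.ne r this.symm
  obtain ⟨a, y, hay⟩ := exists_ends hc₁
  obtain rfl : a = φ r := by
    have := (hay.append (ends_singleton b')).1
    rw [hE.1, Option.some_inj] at this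
    exact this.symm
  have hx : b' ∉ c₁ := by
    rw [(List.perm_append_singleton _ _).nodup_iff, List.nodup_cons] at hn
    exact hn.1
  -- The new point is last in the list; its neighbors are the first vertex `φ r` and the vertex `y`
  -- before it, so `y` must be `φ r'`.
  have hy : y = φ r' := by
    rw [tourEdges_append hay (ends_singleton b')] at hr'
    simp only [pathEdges, add_zero, Multiset.mem_add, Multiset.mem_singleton] at hr'
    rcases hr' with (h₁ | h₁) | h₁
    · exact absurd (mem_of_mem_pathEdges h₁).2 hx
    · rcases Sym2.eq_iff.1 h₁ with ⟨h₂, -⟩ | ⟨h₂, -⟩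
      · exact h₂.symm
      · exact absurd h₂ (h.ne r')
    · rcases Sym2.eq_iff.1 h₁ with ⟨h₂, -⟩ | ⟨h₂, -⟩
      · exact absurd h₂ (h.ne r')
      · exact absurd (h.strictMono.injective h₂).symm h.ne_ends
  subst hy
  obtain ⟨l, rfl⟩ := exists_map_eq (φ := φ) (c := c₁) fun z hz =>
    h.surj z (List.mem_range.1 (hc.best.perm.mem_iff.1 (List.mem_append_left _ hz)))
      (fun h' => hx (h' ▸ hz))
  have hb := hc.best.isTour.bichromatic
  rw [tourEdges_append hay (ends_singleton b'), bichromatic_add, bichromatic_add, bichromatic_add,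
    ← isChain_iff h.col_map] at hb
  obtain ⟨h₁, h₂⟩ := hay
  rw [List.head?_map] at h₁
  rw [List.getLast?_map] at h₂
  obtain ⟨w, rfl⟩ := exists_walk hb.1.1.1 (u := r) (v := r')
    (Option.map_injective h.strictMono.injective h₁)
    (Option.map_injective h.strictMono.injective h₂)
  refine ⟨w, (SimpleGraph.Walk.IsPath.mk' ?_).isHamiltonian_of_mem fun i => ?_, rfl⟩
  · rw [(List.perm_append_singleton _ _).nodup_iff, List.nodup_cons] at hn
    exact hn.2.of_map _
  · have := hc.best.perm.mem_iff.2 (List.mem_range.2 (h.lt i))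
    rw [List.mem_append, List.mem_map, List.mem_singleton] at this
    rcases this with ⟨j, hj, hji⟩ | h'
    · rwa [← h.strictMono.injective hji]
    · exact absurd h' (h.ne i)

theorem IsExtension.exists_optimumPath (h : IsExtension S φ col M x r r') (hS : S.ClockwiseOrder)
    {c : List ℕ} (hc : IsSolution col M (φ r) x c) :
    ∃ w : S.bichromatic.Walk r r', S.IsOptimumPath w ∧ w.support.map φ ++ [x] = c := by
  obtain ⟨w, hw, rfl⟩ := h.exists_isHamiltonian hc
  refine ⟨w, ⟨hw, fun w' hw' => ?_⟩, rfl⟩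
  obtain ⟨-, -, -, h₃⟩ := h.isTour hw
  obtain ⟨h₄, h₅, -, h₆⟩ := h.isTour hw'
  have := hc.best.le_total _ h₄ h₅
  rw [h₃, h₆, ← hS.two_mul_crossings_edgeSet h.strictMono hw.isPath.edges_nodup,
    ← hS.two_mul_crossings_edgeSet h.strictMono hw'.isPath.edges_nodup] at this
  omega

theorem IsExtension.onePlane (h : IsExtension S φ col M x r r') (hS : S.ClockwiseOrder)
    {c : List ℕ} (hc : IsSolution col M (φ r) x c) {w : S.bichromatic.Walk r r'}
    (hw : S.IsOptimumPath w) : S.OnePlane w.edgeSet := by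
  obtain ⟨w', hw', rfl⟩ := h.exists_isHamiltonian hc
  obtain ⟨h₁, h₂, h₃, h₄⟩ := h.isTour hw.1
  obtain ⟨-, -, -, h₆⟩ := h.isTour hw'
  refine hS.onePlane h.strictMono h₁ h₃ (hc.best.not_improvable h₂ ?_)
  have := hw.2 w' hw'
  rw [h₄, h₆, ← hS.two_mul_crossings_edgeSet h.strictMono hw.1.isPath.edges_nodup,
    ← hS.two_mul_crossings_edgeSet h.strictMono hw'.isPath.edges_nodup]
  omega

/-! ### The colors as functions on the natural numbers -/

/-- The color of the point with a given index. -/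
def color (S : BicoloredPoints N) (k : ℕ) : Bool := if h : k < N then S.isRed ⟨k, h⟩ else false

theorem color_val (S : BicoloredPoints N) (i : Fin N) : S.color i = S.isRed i := by
  simp [color]

theorem sum_isRed (S : BicoloredPoints N) :
    ∑ i : Fin N, (if S.isRed i then (1 : ℤ) else -1) = S.red.card - S.blue.card := by
  rw [Finset.sum_ite, Finset.sum_const, Finset.sum_const, red, blue]
  simp only [nsmul_eq_mul, mul_one, mul_neg, Bool.not_eq_true, sub_eq_add_neg]

theorem card_red_add_card_blue (S : BicoloredPoints N) : S.red.card + S.blue.card = N := by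
  have := Finset.card_filter_add_card_filter_not (s := (Finset.univ : Finset (Fin N)))
    (fun i => S.isRed i = true)
  simpa [red, blue] using this

theorem height_color {n : ℕ} (hr : S.red.card = n) (hb : S.blue.card = n) :
    height S.color N = 0 := by
  rw [height, Finset.sum_range]
  simp only [color_val]
  rw [sum_isRed, hr, hb, sub_self]

/-- The index of the point `i` when a new point is inserted after the point `q`. -/
def insertIndex (q i : ℕ) : ℕ := if i ≤ q then i else i + 1

/-- The colors when a blue point is inserted after the point `q`. -/
def insertColor (S : BicoloredPoints N) (q k : ℕ) : Bool :=
  if k ≤ q then S.color k else if k = q + 1 then false else S.color (k - 1)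

theorem insertColor_insertIndex (S : BicoloredPoints N) (q : ℕ) (i : Fin N) :
    S.insertColor q (insertIndex q i) = S.isRed i := by
  rw [← color_val]
  unfold insertColor insertIndex
  split_ifs <;> first | rfl | omega

theorem height_insertColor {n q : ℕ} (hq : q < N) (hr : S.red.card = n + 1)
    (hb : S.blue.card = n) : height (S.insertColor q) (N + 1) = 0 := by
  rw [height, Finset.sum_range, Fin.sum_univ_succAbove _ (⟨q + 1, by omega⟩ : Fin (N + 1))]
  have : ∀ i : Fin N, (((⟨q + 1, by omega⟩ : Fin (N + 1)).succAbove i : Fin (N + 1)) : ℕ) =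
      insertIndex q i := by
    intro i
    unfold insertIndex Fin.succAbove
    simp only [Fin.lt_def, Fin.val_castSucc]
    split_ifs <;> first | rfl | omega
  simp only [this, insertColor_insertIndex]
  rw [sum_isRed, hr, hb, insertColor, if_neg (by simp)]
  simp

/-- For `q = N - 1` the new point is the last one, and its successor in the circular order is `0`.
-/
theorem isExtension {q : ℕ} (hq : q < N) {r r' : Fin N} (hr : S.isRed r = true)
    (hr' : S.isRed r' = true) (hne : r ≠ r')
    (h : ((r : ℕ) = q ∧ (r' : ℕ) = (q + 1) % N) ∨ ((r' : ℕ) = q ∧ (r : ℕ) = (q + 1) % N)) :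
    IsExtension S (fun i => insertIndex q i) (S.insertColor q) (N + 1) (q + 1) r r' := by
  have h₁ : insertIndex q q = q := if_pos le_rfl
  have h₂ : insertIndex q ((q + 1) % N) = (q + 1 + 1) % (N + 1) := by
    rcases Nat.lt_or_ge (q + 1) N with hlt | hge
    · rw [Nat.mod_eq_of_lt hlt, Nat.mod_eq_of_lt (by omega)]
      exact if_neg (by omega)
    · obtain rfl : N = q + 1 := by omega
      rw [Nat.mod_self, Nat.mod_self]
      exact if_pos (by omega)
  have h₃ : (q + 1) % (N + 1) = q + 1 := Nat.mod_eq_of_lt (by omega)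
  refine ⟨?_, ?_, ?_, by omega, ?_, insertColor_insertIndex S q, ?_, hr, hr', hne, ?_, ?_⟩
  · intro i j hij
    have : (i : ℕ) < j := hij
    simp only [insertIndex]
    split_ifs <;> omega
  · intro i
    have := i.2
    simp only [insertIndex]
    split_ifs <;> omega
  · intro i
    simp only [insertIndex]
    split_ifs <;> omega
  · intro y hy hyq
    rcases Nat.lt_or_ge q y with hlt | hge
    · refine ⟨⟨y - 1, by omega⟩, ?_⟩
      simp only [insertIndex]
      split_ifs <;> omega
    · exact ⟨⟨y, by omega⟩, if_pos hge⟩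
  · simp [insertColor]
  · rcases h with ⟨h, -⟩ | ⟨-, h⟩
    · left; rw [h, h₁, h₃]
    · right; rw [h, h₂]
  · rcases h with ⟨-, h⟩ | ⟨h, -⟩
    · right; rw [h, h₂]
    · left; rw [h, h₁, h₃]

end BicoloredPoints

/-! ## Verification of programs -/

namespace RealRAM

/-- The weakest precondition of an instruction on integers. -/
def Instr.wp (m : ℕ) : Instr → (State → Prop) → State → Prop
  | .set x a, Q, s => a.eval s ≤ m ∧ Q (s.setVar x (a.eval s))
  | .add x a b, Q, s => a.eval s + b.eval s ≤ m ∧ Q (s.setVar x (a.eval s + b.eval s))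
  | .sub x a b, Q, s => a.eval s - b.eval s ≤ m ∧ Q (s.setVar x (a.eval s - b.eval s))
  | .load x A a, Q, s => a.eval s < m ∧ s.iarr A (a.eval s) ≤ m ∧
      Q (s.setVar x (s.iarr A (a.eval s)))
  | .store A a b, Q, s => a.eval s < m ∧ b.eval s ≤ m ∧ Q (s.setCell A (a.eval s) (b.eval s))
  | _, _, _ => False

/-- The weakest precondition of a program without loops. -/
def Program.wp (m : ℕ) : Program → (State → Prop) → State → Prop
  | .skip, Q, s => Q s
  | .instr c, Q, s => c.wp m Q s
  | .seq P P', Q, s => P.wp m (P'.wp m Q) s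
  | .ite b P P', Q, s => (b.Holds s → P.wp m Q s) ∧ (¬ b.Holds s → P'.wp m Q s)
  | .loop _ _, _, _ => False

/-- A bound on the running time of a program without loops. -/
def Program.cost : Program → ℕ
  | .skip => 1
  | .instr _ => 1
  | .seq P P' => P.cost + P'.cost
  | .ite _ P P' => P.cost + P'.cost + 1
  | .loop _ _ => 0

/-- Consecutive execution. -/
def Program.block : List Program → Program
  | [] => .skip
  | P :: l => .seq P (Program.block l)

/-! ### Rules for correctness and running time -/

theorem Program.Achieves.mono {P : Program} {m T T' : ℕ} {s : State} {Q Q' : State → Prop}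
    (h : P.Achieves m T s Q) (hT : T ≤ T') (hQ : ∀ s, Q s → Q' s) : P.Achieves m T' s Q' := by
  obtain ⟨s', t, h₁, h₂, h₃⟩ := h
  exact ⟨s', t, h₁, h₂.trans hT, hQ _ h₃⟩

theorem Program.Achieves.seq {P P' : Program} {m T T' : ℕ} {s : State} {Q Q' : State → Prop}
    (h : P.Achieves m T s Q) (h' : ∀ s, Q s → P'.Achieves m T' s Q') :
    (Program.seq P P').Achieves m (T + T') s Q' := by
  obtain ⟨s₁, t₁, h₁, h₂, h₃⟩ := h
  obtain ⟨s₂, t₂, h₄, h₅, h₆⟩ := h' s₁ h₃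
  exact ⟨s₂, t₁ + t₂, .seq h₁ h₄, Nat.add_le_add h₂ h₅, h₆⟩

theorem Program.Achieves.of_wp {P : Program} {m : ℕ} {s : State} {Q : State → Prop}
    (h : P.wp m Q s) : P.Achieves m P.cost s Q := by
  induction P generalizing s Q with
  | skip => exact ⟨s, 1, .skip s, le_rfl, h⟩
  | instr c =>
    cases c with
    | set x a => exact ⟨_, 1, .instr (.set s x a h.1), le_rfl, h.2⟩
    | add x a b => exact ⟨_, 1, .instr (.add s x a b h.1), le_rfl, h.2⟩
    | sub x a b => exact ⟨_, 1, .instr (.sub s x a b h.1), le_rfl, h.2⟩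
    | load x A a => exact ⟨_, 1, .instr (.load s x A a h.1 h.2.1), le_rfl, h.2.2⟩
    | store A a b => exact ⟨_, 1, .instr (.store s A a b h.1 h.2.1), le_rfl, h.2.2⟩
    | _ => exact h.elim
  | seq P P' ih ih' => exact (ih h).seq fun s hs => ih' hs
  | ite b P P' ih ih' =>
    by_cases hb : b.Holds s
    · obtain ⟨s', t, h₁, h₂, h₃⟩ := ih (h.1 hb)
      exact ⟨s', t + 1, .ite_true hb h₁, by simp only [Program.cost]; omega, h₃⟩
    · obtain ⟨s', t, h₁, h₂, h₃⟩ := ih' (h.2 hb)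
      exact ⟨s', t + 1, .ite_false hb h₁, by simp only [Program.cost]; omega, h₃⟩
  | loop b P ih => exact h.elim

/-- A loop with a known number of iterations. -/
theorem Program.Achieves.loop {b : Cond} {P : Program} {m T K : ℕ} {s : State}
    (I : ℕ → State → Prop) (h0 : I 0 s) (hb : ∀ k s, k ≤ K → I k s → (b.Holds s ↔ k < K))
    (hP : ∀ k s, k < K → I k s → P.Achieves m T s (I (k + 1))) :
    (Program.loop b P).Achieves m (K * (T + 1) + 1) s (I K) := by
  have key : ∀ j k s, k + j = K → I k s →
      (Program.loop b P).Achieves m (j * (T + 1) + 1) s (I K) := by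
    intro j
    induction j with
    | zero =>
      intro k s hk hI
      have : ¬ b.Holds s := by rw [hb k s (by omega) hI]; omega
      exact ⟨s, 1, .loop_false this, by omega, by rwa [← show k = K by omega]⟩
    | succ j ih =>
      intro k s hk hI
      have hb' : b.Holds s := by rw [hb k s (by omega) hI]; omega
      obtain ⟨s₁, t₁, h₁, h₂, h₃⟩ := hP k s (by omega) hI
      obtain ⟨s₂, t₂, h₄, h₅, h₆⟩ := ih (k + 1) s₁ (by omega) h₃
      exact ⟨s₂, t₁ + t₂ + 1, .loop_true hb' h₁ h₄, by rw [add_mul]; omega, h₆⟩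
  exact key K 0 s (Nat.zero_add K) h0

@[simp]
theorem State.setVar_ivar (s : State) (x v y : ℕ) :
    (s.setVar x v).ivar y = if y = x then v else s.ivar y := Function.update_apply _ _ _ _

@[simp]
theorem State.setVar_iarr (s : State) (x v : ℕ) : (s.setVar x v).iarr = s.iarr := rfl

@[simp]
theorem State.setCell_ivar (s : State) (A i v : ℕ) : (s.setCell A i v).ivar = s.ivar := rfl

@[simp]
theorem State.setCell_iarr (s : State) (A i v B : ℕ) :
    (s.setCell A i v).iarr B = if B = A then Function.update (s.iarr A) i v else s.iarr B :=
  Function.update_apply _ _ _ _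

theorem State.setVar_self (s : State) (x : ℕ) : s.setVar x (s.ivar x) = s := by
  simp [State.setVar]

open Program

/-- Reduce the contents of a register modulo the contents of the register `0`. -/
def wrap (x : ℕ) : Program :=
  .ite (.lt (.var x) (.var 0)) .skip (.instr (.sub x (.var x) (.var 0)))

theorem wp_wrap {m x : ℕ} {s : State} {Q : State → Prop} (hm : s.ivar x ≤ m)
    (h : Q (s.setVar x (if s.ivar x < s.ivar 0 then s.ivar x else s.ivar x - s.ivar 0))) :
    (wrap x).wp m Q s := by
  refine ⟨fun hlt => ?_, fun hlt => ⟨(Nat.sub_le _ _).trans hm, ?_⟩⟩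
  · rw [if_pos (show s.ivar x < s.ivar 0 from hlt), State.setVar_self] at h
    exact h
  · rw [if_neg (show ¬ s.ivar x < s.ivar 0 from hlt)] at h
    exact h

/-- Registers `0` to `3` contain the number of points, two indices, and a number that is not
changed; array `0` contains the colors. -/
structure Data (col : ℕ → Bool) (M r b q : ℕ) (s : State) : Prop where
  size : s.ivar 0 = M
  left : s.ivar 1 = r
  right : s.ivar 2 = b
  spare : s.ivar 3 = q
  color : ∀ k, k < M → s.iarr 0 k = if col k then 0 else 1

theorem Data.of_eq {col : ℕ → Bool} {M r b q : ℕ} {s s' : State} (h : Data col M r b q s)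
    (h₀ : s'.ivar 0 = s.ivar 0) (h₁ : s'.ivar 1 = s.ivar 1) (h₂ : s'.ivar 2 = s.ivar 2)
    (h₃ : s'.ivar 3 = s.ivar 3) (h₄ : s'.iarr 0 = s.iarr 0) : Data col M r b q s' where
  size := h₀.trans h.size
  left := h₁.trans h.left
  right := h₂.trans h.right
  spare := h₃.trans h.spare
  color := by rw [h₄]; exact h.color

open Chord

theorem abs_height_le (col : ℕ → Bool) (k : ℕ) : -(k : ℤ) ≤ height col k ∧ height col k ≤ k := by
  induction k with
  | zero => simp [height]
  | succ k ih => rw [height_succ]; push_cast; split_ifs <;> omega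

variable {col : ℕ → Bool} {m M r b q : ℕ}

/-! ### The position where the height is minimum -/

/-- Register `4` is the counter and `5` the current height, increased by `M` because integers cannot
be negative; `6` and `7` hold the minimum and its position. -/
def lowestBody : Program := block [
  .instr (.load 8 0 (.var 4)),
  .ite (.eq (.var 8) (.lit 0)) (.instr (.add 5 (.var 5) (.lit 1)))
    (.instr (.sub 5 (.var 5) (.lit 1))),
  .instr (.add 4 (.var 4) (.lit 1)),
  .ite (.lt (.var 5) (.var 6)) (block [.instr (.set 6 (.var 5)), .instr (.set 7 (.var 4))]) .skip]

def lowestInit : Program := block [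
  .instr (.set 4 (.lit 0)),
  .instr (.set 5 (.var 0)),
  .instr (.set 6 (.var 0)),
  .instr (.set 7 (.lit 0))]

def lowest : Program := .seq lowestInit (.loop (.lt (.var 4) (.var 0)) lowestBody)

structure LowestInv (col : ℕ → Bool) (M r b q k : ℕ) (s : State) : Prop where
  data : Data col M r b q s
  stack : s.iarr 2 = fun _ => 0
  mate : s.iarr 3 = fun _ => 0
  count : s.ivar 4 = k
  height : (s.ivar 5 : ℤ) = M + height col k
  lowest : (s.ivar 6 : ℤ) = M + Chord.height col (s.ivar 7)
  index_le : s.ivar 7 ≤ k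
  le : ∀ j, j ≤ k → Chord.height col (s.ivar 7) ≤ Chord.height col j

theorem lowestBody_achieves (hm : 2 * M + 2 ≤ m) {k : ℕ} (hk : k < M) {s : State}
    (h : LowestInv col M r b q k s) :
    lowestBody.Achieves m lowestBody.cost s (LowestInv col M r b q (k + 1)) := by
  refine .of_wp ?_
  have h₁ := h.count
  have h₂ := h.data.color k hk
  have h₃ := h.height
  have h₄ := h.lowest
  have h₅ := h.index_le
  have h₆ := abs_height_le col k
  have h₇ := height_succ col k
  -- One argument for both colors: `c` is the increment of the height, `v` the new value of register
  -- `5`, and the alternative says whether the minimum was replaced.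
  have hcol : ∀ c : ℤ, Chord.height col (k + 1) = Chord.height col k + c →
      ∀ v : ℕ, (v : ℤ) = M + Chord.height col k + c →
      ∀ s' : State, Data col M r b q s' → s'.iarr 2 = s.iarr 2 → s'.iarr 3 = s.iarr 3 →
      s'.ivar 4 = k + 1 → s'.ivar 5 = v →
      (v < s.ivar 6 ∧ s'.ivar 6 = v ∧ s'.ivar 7 = k + 1 ∨
        s.ivar 6 ≤ v ∧ s'.ivar 6 = s.ivar 6 ∧ s'.ivar 7 = s.ivar 7) →
      LowestInv col M r b q (k + 1) s' := by
    intro c hc v hv s' hd e₂ e₃ e₄ e₅ e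
    have hle : ∀ j, j ≤ k + 1 → j ≤ k ∨ j = k + 1 := by intro j hj; omega
    refine ⟨hd, e₂.trans h.stack, e₃.trans h.mate, e₄, by rw [e₅]; omega, ?_, ?_, ?_⟩
    · rcases e with ⟨_, e₆, e₇⟩ | ⟨_, e₆, e₇⟩
      · rw [e₆, e₇]; omega
      · rw [e₆, e₇]; exact h₄
    · rcases e with ⟨_, e₆, e₇⟩ | ⟨_, e₆, e₇⟩ <;> omega
    · intro j hj
      rcases e with ⟨e, e₆, e₇⟩ | ⟨e, e₆, e₇⟩ <;> rw [e₇]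
      · rcases hle j hj with hj | rfl
        · have := h.le j hj
          omega
        · exact le_rfl
      · rcases hle j hj with hj | rfl
        · exact h.le j hj
        · omega
  simp only [lowestBody, block, Program.wp, Instr.wp, Operand.eval, Cond.Holds, h₁, h₂,
    State.setVar_ivar]
  cases hck : col k
  · rw [hck] at h₇
    simp only [Bool.false_eq_true, ↓reduceIte] at h₇
    simp
    exact ⟨by omega, by omega, by omega, by omega, fun hlt => ⟨by omega, by omega,
      hcol _ h₇ (s.ivar 5 - 1) (by omega) _ (h.data.of_eq rfl rfl rfl rfl rfl) rfl rfl rfl rfl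
        (Or.inl ⟨hlt, rfl, rfl⟩)⟩, fun hge => hcol _ h₇ (s.ivar 5 - 1) (by omega) _
        (h.data.of_eq rfl rfl rfl rfl rfl) rfl rfl rfl rfl (Or.inr ⟨hge, rfl, rfl⟩)⟩
  · rw [hck] at h₇
    simp only [↓reduceIte] at h₇
    simp
    exact ⟨by omega, by omega, by omega, fun hlt => ⟨by omega, by omega,
      hcol _ h₇ (s.ivar 5 + 1) (by omega) _ (h.data.of_eq rfl rfl rfl rfl rfl) rfl rfl rfl rfl
        (Or.inl ⟨hlt, rfl, rfl⟩)⟩, fun hge => hcol _ h₇ (s.ivar 5 + 1) (by omega) _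
        (h.data.of_eq rfl rfl rfl rfl rfl) rfl rfl rfl rfl (Or.inr ⟨hge, rfl, rfl⟩)⟩

theorem lowest_achieves (hm : 2 * M + 2 ≤ m) {s : State} (h : Data col M r b q s)
    (h₂ : s.iarr 2 = fun _ => 0) (h₃ : s.iarr 3 = fun _ => 0) :
    lowest.Achieves m (lowestInit.cost + (M * (lowestBody.cost + 1) + 1)) s
      (LowestInv col M r b q M) := by
  have h₀ := h.size
  have hz : height col 0 = 0 := by simp [height]
  refine (Achieves.of_wp (Q := LowestInv col M r b q 0) ?_).seq fun s' hs' => ?_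
  · simp only [lowestInit, block, Program.wp, Instr.wp, Operand.eval, State.setVar_ivar]
    simp [h₀]
    refine ⟨by omega, h.of_eq rfl rfl rfl rfl rfl, h₂, h₃, rfl, ?_, ?_, Nat.zero_le _, ?_⟩
    · rw [hz]; simp
    · simp [hz]
    · intro j hj
      obtain rfl : j = 0 := by omega
      exact le_rfl
  · refine Achieves.loop (K := M) _ hs' (fun k t _ ht => ?_)
      fun k t hk ht => lowestBody_achieves hm hk ht
    simp only [Cond.Holds, Operand.eval, ht.count, ht.data.size]

/-! ### Matching -/

/-- Register `8` is the point at word position `4`, for the rotation by register `7`. Array `2` is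
the stack, with height in register `5`, and array `3` the matching. -/
def matchBody : Program := block [
  .instr (.add 8 (.var 4) (.var 7)),
  wrap 8,
  .instr (.load 9 0 (.var 8)),
  .ite (.eq (.var 9) (.lit 0))
    (block [.instr (.store 2 (.var 5) (.var 4)), .instr (.add 5 (.var 5) (.lit 1))])
    (block [.instr (.sub 5 (.var 5) (.lit 1)), .instr (.load 10 2 (.var 5)),
      .instr (.store 3 (.var 4) (.var 10)), .instr (.store 3 (.var 10) (.var 4))]),
  .instr (.add 4 (.var 4) (.lit 1))]

def matchInit : Program := block [.instr (.set 4 (.lit 0)), .instr (.set 5 (.lit 0))]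

def matching : Program := .seq matchInit (.loop (.lt (.var 4) (.var 0)) matchBody)

structure MatchInv (col : ℕ → Bool) (M r b q o : ℕ) (σ : Stack) (k : ℕ) (s : State) : Prop where
  data : Data col M r b q s
  shift : s.ivar 7 = o
  count : s.ivar 4 = k
  height : s.ivar 5 = σ.height
  stack : s.iarr 2 = σ.cell
  mate : s.iarr 3 = σ.mate

theorem matchBody_achieves (hm : 2 * M + 2 ≤ m) {o k : ℕ} (ho : o ≤ M) (hk : k < M) {s : State}
    {σ : Stack} (h₁ : σ.height ≤ k) (h₂ : ∀ x, σ.cell x ≤ k)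
    (h : MatchInv col M r b q o σ k s) :
    matchBody.Achieves m matchBody.cost s
      (MatchInv col M r b q o (σ.read (fun i => col (rot M o i)) k) (k + 1)) := by
  refine .of_wp ?_
  have e₀ := h.data.size
  have e₁ := h.shift
  have e₂ := h.count
  have e₃ := h.height
  have e₄ := h.stack
  have e₅ := h.mate
  have hrot : rot M o k < M := rot_lt ho hk
  have e₆ := h.data.color _ hrot
  simp only [matchBody, block, Program.wp, Instr.wp, Operand.eval, Cond.Holds]
  refine ⟨by omega, wp_wrap (by simp; omega) ?_⟩
  have hr : (if k + o < M then k + o else k + o - M) = rot M o k := rfl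
  simp [e₀, e₁, e₂, hr, e₆, e₃, e₄]
  have h₃ := h₂ (σ.height - 1)
  refine ⟨by omega, by split_ifs <;> omega, fun hc => ⟨by omega, by omega, by omega, by omega, ?_⟩,
    fun hc => ⟨by omega, by omega, by omega, by omega, by omega, by omega, by omega, by omega, ?_⟩⟩
  · refine ⟨h.data.of_eq rfl rfl rfl rfl rfl, e₁, rfl, ?_, ?_, ?_⟩ <;>
      simp [Stack.read, hc, e₄, e₅]
  · refine ⟨h.data.of_eq rfl rfl rfl rfl rfl, e₁, rfl, ?_, ?_, ?_⟩ <;>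
      simp [Stack.read, hc, e₄, e₅]

theorem matching_achieves (hm : 2 * M + 2 ≤ m) {o : ℕ} (ho : o ≤ M) {s : State}
    (h : Data col M r b q s) (h₁ : s.ivar 7 = o) (h₂ : s.iarr 2 = fun _ => 0)
    (h₃ : s.iarr 3 = fun _ => 0) :
    matching.Achieves m (matchInit.cost + (M * (matchBody.cost + 1) + 1)) s
      (MatchInv col M r b q o (Stack.run (fun i => col (rot M o i)) 0 ⟨0, fun _ => 0, fun _ => 0⟩ M)
        M) := by
  set σ := Stack.run (fun i => col (rot M o i)) 0 ⟨0, fun _ => 0, fun _ => 0⟩ with hσ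
  refine (Achieves.of_wp (Q := MatchInv col M r b q o (σ 0) 0) ?_).seq fun s' hs' => ?_
  · simp only [matchInit, block, Program.wp, Instr.wp, Operand.eval]
    simp
    exact ⟨h.of_eq rfl rfl rfl rfl rfl, h₁, rfl, rfl, h₂, h₃⟩
  · refine Achieves.loop (K := M) (fun k => MatchInv col M r b q o (σ k) k) hs'
      (fun k t _ ht => ?_) fun k t hk ht => ?_
    · simp only [Cond.Holds, Operand.eval, ht.count, ht.data.size]
    · obtain ⟨a₁, a₂, -⟩ := Stack.run_le (fun i => col (rot M o i)) k
      have := matchBody_achieves hm ho hk a₁ a₂ ht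
      simpa only [hσ, Stack.run, zero_add] using this

/-! ### Traversal -/

/-- Register `10` holds a word position, which becomes the index of a point by the rotation before
it is stored in array `4`. -/
def traverseTail : Program := block [
  .instr (.add 10 (.var 10) (.var 7)),
  wrap 10,
  .instr (.store 4 (.var 4) (.var 10)),
  .instr (.add 4 (.var 4) (.lit 1))]

/-- Registers `5` and `6` are the state of `advance`, with `1` for backward; register `9` is the
mate, and the comparisons compute `visit`. -/
def traverseBody : Program := block [
  .instr (.load 9 3 (.var 5)),
  .ite (.eq (.var 6) (.lit 0))
    (block [
      .ite (.lt (.var 5) (.var 9)) (.instr (.set 10 (.var 5))) (.instr (.set 10 (.var 9))),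
      .instr (.sub 5 (.var 9) (.lit 1)),
      .instr (.set 6 (.lit 1))])
    (block [
      .ite (.lt (.var 5) (.var 9)) (.instr (.set 10 (.var 9))) (.instr (.set 10 (.var 5))),
      .instr (.add 5 (.var 9) (.lit 1)),
      .instr (.set 6 (.lit 0))]),
  traverseTail]

def traverseInit : Program := block [
  .instr (.set 4 (.lit 0)), .instr (.set 5 (.lit 0)), .instr (.set 6 (.lit 0))]

def traverse : Program := .seq traverseInit (.loop (.lt (.var 4) (.var 0)) traverseBody)

structure TraverseInv (col : ℕ → Bool) (M r b q o : ℕ) (mate Z : ℕ → ℕ) (σ : Bool × ℕ) (k : ℕ)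
    (s : State) : Prop where
  data : Data col M r b q s
  shift : s.ivar 7 = o
  count : s.ivar 4 = k
  mate : s.iarr 3 = mate
  position : s.ivar 5 = σ.2
  direction : s.ivar 6 = if σ.1 then 1 else 0
  visited : ∀ i, i < k → s.iarr 4 i = Z i

theorem traverseBody_achieves (hm : 2 * M + 2 ≤ m) {o k : ℕ} (ho : o ≤ M) (hk : k < M) {s : State}
    {mate Z : ℕ → ℕ} {σ : Bool × ℕ} (h₁ : ∀ x, mate x ≤ M) (h₂ : σ.2 ≤ M + 1)
    (hZ : Z k = rot M o (visit mate σ)) (h : TraverseInv col M r b q o mate Z σ k s) :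
    traverseBody.Achieves m traverseBody.cost s
      (TraverseInv col M r b q o mate Z (advance mate σ) (k + 1)) := by
  refine .of_wp ?_
  have e₀ := h.data.size
  have e₁ := h.shift
  have e₂ := h.count
  have e₃ := h.mate
  have e₄ := h.position
  have e₅ := h.direction
  have h₃ := h₁ σ.2
  obtain ⟨d, p⟩ := σ
  simp only at e₄ e₅ h₂ h₃
  have hwrap : ∀ v, v ≤ M + 1 → v = visit mate (d, p) → ∀ s' : State, s'.ivar 10 = v →
      Data col M r b q s' → s'.ivar 7 = o → s'.ivar 4 = k → s'.iarr 3 = mate →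
      s'.ivar 5 = (advance mate (d, p)).2 →
      s'.ivar 6 = (if (advance mate (d, p)).1 then 1 else 0) → (∀ i, i < k → s'.iarr 4 i = Z i) →
      traverseTail.wp m
        (TraverseInv col M r b q o mate Z (advance mate (d, p)) (k + 1)) s' := by
    intro v hv hv' s' a₁ hd a₂ a₃ a₄ a₅ a₆ a₇
    have a₀ := hd.size
    have hr : (if v + o < M then v + o else v + o - M) = rot M o v := rfl
    have hr' : rot M o v ≤ m := by rw [← hr]; split_ifs <;> omega
    simp only [traverseTail, block, Program.wp, Instr.wp, Operand.eval]
    refine ⟨by omega, wp_wrap (by simp; omega) ?_⟩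
    simp [a₀, a₁, a₂, hr, a₃]
    refine ⟨by omega, hr', by omega, hd.of_eq rfl rfl rfl rfl rfl, a₂, rfl, a₄, a₅, a₆, ?_⟩
    intro i hi
    simp only [State.setVar_iarr, State.setCell_iarr, if_pos, Function.update_apply]
    split_ifs with hik
    · rw [hik, hZ, hv']
    · exact a₇ i (by omega)
  cases d
  · simp [traverseBody, block, Program.wp, Instr.wp, Operand.eval, Cond.Holds, e₃, e₄, e₅]
    refine ⟨by omega, by omega, fun hlt => ⟨by omega, by omega, by omega, ?_⟩,
      fun hge => ⟨by omega, by omega, by omega, ?_⟩⟩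
    · exact hwrap p h₂ (by simp [visit]; omega) _ rfl (h.data.of_eq rfl rfl rfl rfl rfl) e₁ e₂ e₃
        rfl rfl h.visited
    · exact hwrap (mate p) (by omega) (by simp [visit]; omega) _ rfl
        (h.data.of_eq rfl rfl rfl rfl rfl) e₁ e₂ e₃ rfl rfl h.visited
  · simp [traverseBody, block, Program.wp, Instr.wp, Operand.eval, Cond.Holds, e₃, e₄, e₅]
    refine ⟨by omega, by omega, fun hlt => ⟨by omega, by omega, ?_⟩,
      fun hge => ⟨by omega, by omega, ?_⟩⟩
    · exact hwrap (mate p) (by omega) (by simp [visit]; omega) _ rfl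
        (h.data.of_eq rfl rfl rfl rfl rfl) e₁ e₂ e₃ rfl rfl h.visited
    · exact hwrap p h₂ (by simp [visit]; omega) _ rfl (h.data.of_eq rfl rfl rfl rfl rfl) e₁ e₂ e₃
        rfl rfl h.visited

theorem traverse_achieves (hm : 2 * M + 2 ≤ m) {o : ℕ} (ho : o ≤ M) {mate Z : ℕ → ℕ}
    (h₁ : ∀ x, mate x ≤ M) (hZ : ∀ k, Z k = rot M o (visit mate ((advance mate)^[k] (false, 0))))
    {s : State} (h : Data col M r b q s) (h₂ : s.ivar 7 = o) (h₃ : s.iarr 3 = mate) :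
    traverse.Achieves m (traverseInit.cost + (M * (traverseBody.cost + 1) + 1)) s
      (TraverseInv col M r b q o mate Z ((advance mate)^[M] (false, 0)) M) := by
  refine (Achieves.of_wp (Q := TraverseInv col M r b q o mate Z (false, 0) 0) ?_).seq
    fun s' hs' => ?_
  · simp only [traverseInit, block, Program.wp, Instr.wp, Operand.eval]
    simp
    exact ⟨h.of_eq rfl rfl rfl rfl rfl, h₂, rfl, h₃, rfl, rfl,
      fun i hi => absurd hi (Nat.not_lt_zero i)⟩
  · refine Achieves.loop (K := M)
      (fun k => TraverseInv col M r b q o mate Z ((advance mate)^[k] (false, 0)) k) hs'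
      (fun k t _ ht => ?_) fun k t hk ht => ?_
    · simp only [Cond.Holds, Operand.eval, ht.count, ht.data.size]
    · have := traverseBody_achieves hm ho hk h₁ (advance_le h₁ k) (hZ k) ht
      rwa [← Function.iterate_succ_apply' (advance mate) k (false, 0)] at this

/-! ### The position of the first endpoint -/

def findBody : Program := block [
  .instr (.load 9 4 (.var 4)),
  .ite (.eq (.var 9) (.var 1)) (.instr (.set 10 (.var 4))) .skip,
  .instr (.add 4 (.var 4) (.lit 1))]

def findInit : Program := .instr (.set 4 (.lit 0))

def find : Program := .seq findInit (.loop (.lt (.var 4) (.var 0)) findBody)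

structure FindInv (col : ℕ → Bool) (M r b q : ℕ) (Z : ℕ → ℕ) (j k : ℕ) (s : State) : Prop where
  data : Data col M r b q s
  count : s.ivar 4 = k
  cells : ∀ i, i < M → s.iarr 4 i = Z i
  found : j < k → s.ivar 10 = j

theorem find_achieves (hm : 2 * M + 2 ≤ m) {Z : ℕ → ℕ} {j : ℕ} (hZ : ∀ i, i < M → Z i < M)
    (hj : ∀ i, i < M → (Z i = r ↔ i = j)) {s : State} (h : Data col M r b q s)
    (h₁ : ∀ i, i < M → s.iarr 4 i = Z i) :
    find.Achieves m (findInit.cost + (M * (findBody.cost + 1) + 1)) s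
      (FindInv col M r b q Z j M) := by
  refine (Achieves.of_wp (Q := FindInv col M r b q Z j 0) ?_).seq fun s' hs' => ?_
  · exact ⟨Nat.zero_le _, h.of_eq rfl rfl rfl rfl rfl, rfl, h₁, fun hi => absurd hi (Nat.not_lt_zero j)⟩
  · refine Achieves.loop (K := M) (fun k => FindInv col M r b q Z j k) hs'
      (fun k t _ ht => ?_) fun k t hk ht => .of_wp ?_
    · simp only [Cond.Holds, Operand.eval, ht.count, ht.data.size]
    · have e₀ := ht.count
      have e₁ := ht.cells k hk
      have e₂ := ht.data.left
      have e₃ := hZ k hk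
      have e₄ := hj k hk
      simp [findBody, block, Program.wp, Instr.wp, Operand.eval, Cond.Holds, e₀, e₁, e₂]
      refine ⟨by omega, by omega, fun hr => ⟨by omega, by omega, ?_⟩, fun hr => ⟨by omega, ?_⟩⟩
      · exact ⟨ht.data.of_eq rfl rfl rfl rfl rfl, rfl, ht.cells, fun _ => e₄.1 hr⟩
      · refine ⟨ht.data.of_eq rfl rfl rfl rfl rfl, rfl, ht.cells, fun hjk => ?_⟩
        have : k ≠ j := fun h' => hr (e₄.2 h')
        exact ht.found (by omega)

/-! ### The direction -/

/-- Register `11` becomes the step of `readOff`: `M - 1` if the successor of the first endpoint is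
the second one, and `1` otherwise. -/
def orientation : Program := block [
  .instr (.add 11 (.var 10) (.lit 1)),
  wrap 11,
  .instr (.load 9 4 (.var 11)),
  .ite (.eq (.var 9) (.var 2)) (.instr (.sub 11 (.var 0) (.lit 1))) (.instr (.set 11 (.lit 1))),
  .instr (.set 4 (.lit 0))]

structure OutputInv (col : ℕ → Bool) (M r b q : ℕ) (Z : ℕ → ℕ) (d j k : ℕ) (s : State) :
    Prop where
  data : Data col M r b q s
  count : s.ivar 4 = k
  cells : ∀ i, i < M → s.iarr 4 i = Z i
  step : s.ivar 11 = d
  position : s.ivar 10 = (rot M d)^[k] j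
  written : ∀ i, i < k → s.iarr 1 i = Z ((rot M d)^[i] j)

theorem orientation_achieves (hm : 2 * M + 2 ≤ m) {Z : ℕ → ℕ} {j : ℕ} (hj : j < M)
    (hZ : ∀ i, i < M → Z i < M) {s : State} (h : FindInv col M r b q Z j M s) :
    orientation.Achieves m orientation.cost s
      (OutputInv col M r b q Z (if Z (rot M 1 j) = b then M - 1 else 1) j 0) := by
  refine .of_wp ?_
  have e₀ := h.data.size
  have e₁ := h.data.right
  have e₂ := h.found hj
  have hlt : rot M 1 j < M := rot_lt (by omega) hj
  have e₃ := h.cells _ hlt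
  have e₄ := hZ _ hlt
  have hr : (if j + 1 < M then j + 1 else j + 1 - M) = rot M 1 j := rfl
  simp only [orientation, block, Program.wp, Instr.wp, Operand.eval, Cond.Holds]
  refine ⟨by omega, wp_wrap (by simp; omega) ?_⟩
  simp [e₀, e₁, e₂, hr, e₃]
  refine ⟨by omega, by omega, fun hb => ⟨by omega, ?_⟩, fun hb => ⟨by omega, ?_⟩⟩
  · exact ⟨h.data.of_eq rfl rfl rfl rfl rfl, rfl, h.cells, (if_pos hb).symm, e₂,
      fun i hi => absurd hi (Nat.not_lt_zero i)⟩
  · exact ⟨h.data.of_eq rfl rfl rfl rfl rfl, rfl, h.cells, (if_neg hb).symm, e₂,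
      fun i hi => absurd hi (Nat.not_lt_zero i)⟩

/-! ### The output -/

def writeBody : Program := block [
  .instr (.load 9 4 (.var 10)),
  .instr (.store 1 (.var 4) (.var 9)),
  .instr (.add 10 (.var 10) (.var 11)),
  wrap 10,
  .instr (.add 4 (.var 4) (.lit 1))]

def write : Program := .loop (.lt (.var 4) (.var 0)) writeBody

theorem write_achieves (hm : 2 * M + 2 ≤ m) {Z : ℕ → ℕ} {d j : ℕ} (hj : j < M) (hd : d ≤ M)
    (hZ : ∀ i, i < M → Z i < M) {s : State} (h : OutputInv col M r b q Z d j 0 s) :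
    write.Achieves m (M * (writeBody.cost + 1) + 1) s (OutputInv col M r b q Z d j M) := by
  refine Achieves.loop (K := M) (fun k => OutputInv col M r b q Z d j k) h
    (fun k t _ ht => ?_) fun k t hk ht => .of_wp ?_
  · simp only [Cond.Holds, Operand.eval, ht.count, ht.data.size]
  · have e₀ := ht.data.size
    have e₁ := ht.count
    have e₂ := ht.step
    have e₃ := ht.position
    have e₆ := ht.written
    have hlt := iterate_rot_lt hd hj k
    have hs := Function.iterate_succ_apply' (rot M d) k j
    generalize hp : (rot M d)^[k] j = p at e₃ hlt hs
    have e₄ := ht.cells p hlt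
    have e₅ := hZ p hlt
    have hr : (if p + d < M then p + d else p + d - M) = rot M d p := rfl
    simp only [writeBody, block, Program.wp, Instr.wp, Operand.eval]
    simp only [State.setVar_ivar, State.setCell_ivar]
    refine ⟨by omega, by rw [e₃, e₄]; omega, by simp; omega, by simp [e₃, e₄]; omega,
      by simp; omega, wp_wrap (by simp; omega) ?_⟩
    simp [e₀, e₁, e₂, e₃, e₄, hr]
    refine ⟨by omega, ht.data.of_eq rfl rfl rfl rfl rfl, rfl, ht.cells, e₂, hs.symm, ?_⟩
    intro i hi
    simp [Function.update_apply]
    split_ifs with hik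
    · rw [hik, hp]
    · exact e₆ i (by omega)

/-! ### The whole computation -/

def solve : Program :=
  .seq lowest (.seq matching (.seq traverse (.seq find (.seq orientation write))))

def solveCost (M : ℕ) : ℕ :=
  lowestInit.cost + (M * (lowestBody.cost + 1) + 1) +
    (matchInit.cost + (M * (matchBody.cost + 1) + 1) +
      (traverseInit.cost + (M * (traverseBody.cost + 1) + 1) +
        (findInit.cost + (M * (findBody.cost + 1) + 1) +
          (orientation.cost + (M * (writeBody.cost + 1) + 1)))))

theorem solve_achieves (hm : 2 * M + 2 ≤ m) (hM : 2 ≤ M) (hr : r < M) (hh : height col M = 0)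
    {s : State} (h : Data col M r b q s) (h₂ : s.iarr 2 = fun _ => 0)
    (h₃ : s.iarr 3 = fun _ => 0) :
    solve.Achieves m (solveCost M) s fun s' =>
      IsSolution col M r b ((List.range M).map (s'.iarr 1)) ∧ Data col M r b q s' := by
  refine (lowest_achieves hm h h₂ h₃).seq fun s₁ hs₁ => ?_
  obtain ⟨t, ht, hc⟩ := exists_forest_rot hs₁.index_le hh hs₁.le
  have hB := bestTour_map_rot (by omega) hs₁.index_le ht hc
  refine (matching_achieves hm hs₁.index_le hs₁.data rfl hs₁.stack hs₁.mate).seq fun s₂ hs₂ => ?_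
  set o := s₁.ivar 7 with ho
  have hv := visits_run hc
  obtain ⟨-, -, hmate⟩ := Stack.run_le (fun i => col (rot M o i)) M
  have hs₂m := hs₂.mate
  rw [ht] at hv
  generalize (Stack.run (fun i => col (rot M o i)) 0 ⟨0, fun _ => 0, fun _ => 0⟩ M).mate = mate
    at hv hmate hs₂m
  -- The tour as a function of time, the form in which it is stored in array `4`.
  set Z : ℕ → ℕ := fun k => rot M o (visit mate ((advance mate)^[k] (false, 0))) with hZ
  have hZB : BestTour col M ((List.range M).map Z) := by
    rw [← hv, visits_eq_map, List.map_map] at hB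
    exact hB
  have hZlt : ∀ i, i < M → Z i < M := fun i hi => List.mem_range.1
    (hZB.perm.mem_iff.1 (List.mem_map_of_mem (List.mem_range.2 hi)))
  obtain ⟨j, hj, hjr⟩ := hZB.exists_index hr
  have hinj : ∀ i, i < M → (Z i = r ↔ i = j) := by
    intro i hi
    refine ⟨fun h' => ?_, fun h' => h' ▸ hjr⟩
    exact List.inj_on_of_nodup_map hZB.isTour.nodup (List.mem_range.2 hi) (List.mem_range.2 hj)
      (h'.trans hjr.symm)
  refine (traverse_achieves hm hs₁.index_le hmate (fun _ => rfl) hs₂.data hs₂.shift hs₂m).seq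
    fun s₃ hs₃ => ?_
  refine (find_achieves hm hZlt hinj hs₃.data hs₃.visited).seq fun s₄ hs₄ => ?_
  refine (orientation_achieves hm hj hZlt hs₄).seq fun s₅ hs₅ => ?_
  refine (write_achieves hm hj (by split_ifs <;> omega) hZlt hs₅).mono le_rfl fun s₆ hs₆ => ?_
  refine ⟨?_, hs₆.data⟩
  have : (List.range M).map (s₆.iarr 1) =
      readOff Z M (if Z (rot M 1 j) = b then M - 1 else 1) j :=
    List.map_congr_left fun i hi => hs₆.written i (List.mem_range.1 hi)
  rw [this]
  exact hZB.isSolution hM hj hjr rfl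

end RealRAM

/-! ## Insertion of a blue point between two red ones -/

namespace RealRAM

open Program Chord BicoloredPoints

theorem solveCost_le (M : ℕ) : solveCost M ≤ 100 * M + 100 := by
  simp only [solveCost, lowestInit, lowestBody, matchInit, matchBody, traverseInit, traverseBody,
    traverseTail, findInit, findBody, orientation, writeBody, wrap, block, cost]
  omega

/-- Find out which of the two given points is followed by the other one. -/
def locate : Program := block [
  .ite (.lt (.var 1) (.var 2))
    (block [.instr (.add 4 (.var 1) (.lit 1)),
      .ite (.eq (.var 4) (.var 2)) (.instr (.set 3 (.var 1))) (.instr (.set 3 (.var 2)))])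
    (block [.instr (.add 4 (.var 2) (.lit 1)),
      .ite (.eq (.var 4) (.var 1)) (.instr (.set 3 (.var 2))) (.instr (.set 3 (.var 1)))]),
  .instr (.set 4 (.var 0)),
  .instr (.add 6 (.var 3) (.lit 1))]

/-- The colors are moved from the end downwards, so that none is overwritten before it is moved. -/
def shiftBody : Program := block [
  .instr (.sub 4 (.var 4) (.lit 1)),
  .instr (.load 5 0 (.var 4)),
  .instr (.add 7 (.var 4) (.lit 1)),
  .instr (.store 0 (.var 7) (.var 5))]

def shift : Program := .loop (.lt (.var 6) (.var 4)) shiftBody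

def adjust : Program := block [
  .instr (.store 0 (.var 6) (.lit 1)),
  .ite (.lt (.var 3) (.var 1)) (.instr (.add 1 (.var 1) (.lit 1))) .skip,
  .instr (.set 2 (.var 6)),
  .instr (.add 0 (.var 0) (.lit 1))]

def restoreInit : Program := block [.instr (.set 4 (.lit 0)), .instr (.sub 0 (.var 0) (.lit 1))]

/-- Undoes the insertion in the output. `restoreInit` has lowered the number of points by one, so
the new point, the last vertex of the tour, is left out. -/
def restoreBody : Program := block [
  .instr (.load 5 1 (.var 4)),
  .ite (.lt (.var 3) (.var 5)) (.instr (.sub 5 (.var 5) (.lit 1))) .skip,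
  .instr (.store 1 (.var 4) (.var 5)),
  .instr (.add 4 (.var 4) (.lit 1))]

def restore : Program := .seq restoreInit (.loop (.lt (.var 4) (.var 0)) restoreBody)

def solveInserted : Program :=
  .seq locate (.seq shift (.seq adjust (.seq solve restore)))

/-- The state while the colors are moved. -/
structure ShiftInv (A : ℕ → ℕ) (N r q k : ℕ) (s : State) : Prop where
  size : s.ivar 0 = N
  left : s.ivar 1 = r
  spare : s.ivar 3 = q
  count : s.ivar 4 = N - k
  new : s.ivar 6 = q + 1
  stack : s.iarr 2 = fun _ => 0
  mate : s.iarr 3 = fun _ => 0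
  cells : ∀ j, j ≤ N → s.iarr 0 j = if j ≤ N - k then A j else A (j - 1)

variable {m N : ℕ} {A : ℕ → ℕ}

/-- The smaller index is the predecessor unless the indices are `0` and `N - 1`. As `N ≥ 3`, these
two do not differ by one, so the test recognizes this case. -/
theorem locate_achieves (hm : 2 * N + 2 ≤ m) (hN : 3 ≤ N) {q r r' : ℕ} (hq : q < N)
    (hqr : (r = q ∧ r' = (q + 1) % N) ∨ (r' = q ∧ r = (q + 1) % N)) {s : State}
    (h₀ : s.ivar 0 = N) (h₁ : s.ivar 1 = r) (h₂ : s.ivar 2 = r') (h₃ : s.iarr 0 = A)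
    (h₄ : s.iarr 2 = fun _ => 0) (h₅ : s.iarr 3 = fun _ => 0) :
    locate.Achieves m locate.cost s (ShiftInv A N r q 0) := by
  refine .of_wp ?_
  have key : ∀ s' : State, s'.ivar 0 = N → s'.ivar 1 = r → s'.ivar 3 = q → s'.ivar 4 = N →
      s'.ivar 6 = q + 1 → s'.iarr = s.iarr → ShiftInv A N r q 0 s' := by
    intro s' a₀ a₁ a₃ a₄ a₆ a
    refine ⟨a₀, a₁, a₃, a₄, a₆, by rw [a, h₄], by rw [a, h₅], fun j hj => ?_⟩
    rw [a, h₃, if_pos (by omega)]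
  have hqr' : (r = q ∧ r' = q + 1) ∨ (r' = q ∧ r = q + 1) ∨ (r = q ∧ q + 1 = N ∧ r' = 0) ∨
      (r' = q ∧ q + 1 = N ∧ r = 0) := by
    rcases Nat.lt_or_ge (q + 1) N with hlt | hge
    · rw [Nat.mod_eq_of_lt hlt] at hqr
      tauto
    · obtain rfl : N = q + 1 := by omega
      rw [Nat.mod_self] at hqr
      tauto
  simp [locate, block, Program.wp, Instr.wp, Operand.eval, Cond.Holds, h₀, h₁, h₂]
  refine ⟨fun hlt => ⟨by omega, fun he => ⟨by omega, by omega, by omega, ?_⟩,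
    fun he => ⟨by omega, by omega, by omega, ?_⟩⟩,
    fun hge => ⟨by omega, fun he => ⟨by omega, by omega, by omega, ?_⟩,
    fun he => ⟨by omega, by omega, by omega, ?_⟩⟩⟩
  · obtain rfl : r = q := by omega
    exact key _ h₀ h₁ rfl rfl rfl rfl
  · obtain rfl : r' = q := by omega
    exact key _ h₀ h₁ rfl rfl rfl rfl
  · obtain rfl : r' = q := by omega
    exact key _ h₀ h₁ rfl rfl rfl rfl
  · obtain rfl : r = q := by omega
    exact key _ h₀ h₁ rfl rfl rfl rfl

theorem shift_achieves (hm : 2 * N + 2 ≤ m) {q r : ℕ} (hq : q < N) (hA : ∀ j, A j ≤ 1)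
    {s : State} (h : ShiftInv A N r q 0 s) :
    shift.Achieves m (N * (shiftBody.cost + 1) + 1) s (ShiftInv A N r q (N - (q + 1))) := by
  refine (Achieves.loop (K := N - (q + 1)) (fun k => ShiftInv A N r q k) h
    (fun k t hk ht => ?_) fun k t hk ht => .of_wp ?_).mono
    (Nat.add_le_add_right (Nat.mul_le_mul_right _ (Nat.sub_le _ _)) 1) fun _ => id
  · simp only [Cond.Holds, Operand.eval, ht.count, ht.new]
    omega
  · have e₀ := ht.count
    have e₁ := ht.cells (N - k - 1) (by omega)
    rw [if_pos (by omega)] at e₁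
    have e₂ := hA (N - k - 1)
    simp [shiftBody, block, Program.wp, Instr.wp, Operand.eval, e₀, e₁]
    refine ⟨by omega, by omega, by omega, by omega, by omega, by omega, ht.size, ht.left, ht.spare,
      ?_, ht.new, ht.stack, ht.mate, fun j hj => ?_⟩
    · simp; omega
    · have e₃ := ht.cells j hj
      simp [Function.update_apply]
      by_cases hjk : j = N - k - 1 + 1
      · rw [if_pos hjk, if_neg (by omega), hjk, Nat.add_sub_cancel]
      · rw [if_neg hjk, e₃]
        by_cases hj' : j ≤ N - k
        · rw [if_pos hj', if_pos (by omega)]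
        · rw [if_neg hj', if_neg (by omega)]

theorem adjust_achieves {S : BicoloredPoints N} (hm : 2 * N + 2 ≤ m) {q r : ℕ} (hq : q < N)
    (hr : r < N) {s : State} (hA : ∀ j, j < N → A j = if S.color j then 0 else 1)
    (h : ShiftInv A N r q (N - (q + 1)) s) :
    adjust.Achieves m adjust.cost s fun s' =>
      Data (S.insertColor q) (N + 1) (insertIndex q r) (q + 1) q s' ∧
        s'.iarr 2 = (fun _ => 0) ∧ s'.iarr 3 = fun _ => 0 := by
  refine .of_wp ?_
  have e₀ := h.size
  have e₁ := h.left
  have e₂ := h.spare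
  have e₃ := h.new
  have hcell : ∀ j, j < N + 1 → Function.update (s.iarr 0) (q + 1) 1 j =
      if S.insertColor q j then 0 else 1 := by
    intro j hj
    have e₄ := h.cells j (by omega)
    rw [show N - (N - (q + 1)) = q + 1 by omega] at e₄
    rw [Function.update_apply, insertColor]
    by_cases hj₁ : j = q + 1
    · rw [if_pos hj₁]; subst hj₁; simp
    · rw [if_neg hj₁, e₄]
      by_cases hj₂ : j ≤ q
      · rw [if_pos (by omega), if_pos hj₂, hA j (by omega)]
      · rw [if_neg (by omega), if_neg hj₂, if_neg hj₁, hA (j - 1) (by omega)]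
  simp [adjust, block, Program.wp, Instr.wp, Operand.eval, Cond.Holds, e₀, e₁, e₂, e₃]
  refine ⟨by omega, by omega, fun hlt => ⟨by omega, by omega, by omega, ?_, h.stack, h.mate⟩,
    fun hge => ⟨by omega, by omega, ?_, h.stack, h.mate⟩⟩
  · exact ⟨rfl, (if_neg (by omega)).symm, rfl, e₂, hcell⟩
  · exact ⟨rfl, e₁.trans (if_pos hge).symm, rfl, e₂, hcell⟩

structure RestoreInv (O : ℕ → ℕ) (N q k : ℕ) (s : State) : Prop where
  size : s.ivar 0 = N
  spare : s.ivar 3 = q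
  count : s.ivar 4 = k
  cells : ∀ j, s.iarr 1 j = if j < k then (if q < O j then O j - 1 else O j) else O j

theorem restore_achieves (hm : 2 * N + 2 ≤ m) {q : ℕ} {s : State} (h₀ : s.ivar 0 = N + 1)
    (h₁ : s.ivar 3 = q) (hO : ∀ j, j < N → s.iarr 1 j ≤ N) :
    restore.Achieves m (restoreInit.cost + (N * (restoreBody.cost + 1) + 1)) s
      (RestoreInv (s.iarr 1) N q N) := by
  set O := s.iarr 1 with hOdef
  refine (Achieves.of_wp (Q := RestoreInv O N q 0) ?_).seq fun s' hs' => ?_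
  · simp only [restoreInit, block, Program.wp, Instr.wp, Operand.eval]
    simp [h₀]
    exact ⟨by omega, rfl, h₁, rfl, fun j => rfl⟩
  · refine Achieves.loop (K := N) (fun k => RestoreInv O N q k) hs'
      (fun k t _ ht => ?_) fun k t hk ht => .of_wp ?_
    · simp only [Cond.Holds, Operand.eval, ht.count, ht.size]
    · have e₀ := ht.count
      have e₁ := ht.cells k
      rw [if_neg (lt_irrefl k)] at e₁
      have e₂ := ht.spare
      have e₃ := hO k hk
      have hcell : ∀ v, v = (if q < O k then O k - 1 else O k) → ∀ j,
          Function.update (t.iarr 1) k v j =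
            if j < k + 1 then (if q < O j then O j - 1 else O j) else O j := by
        intro v hv j
        rw [Function.update_apply]
        by_cases hj : j = k
        · rw [if_pos hj, if_pos (show j < k + 1 by omega), hv, hj]
        · rw [if_neg hj, ht.cells j]
          by_cases hj' : j < k
          · rw [if_pos hj', if_pos (show j < k + 1 by omega)]
          · rw [if_neg hj', if_neg (show ¬ j < k + 1 by omega)]
      simp [restoreBody, block, Program.wp, Instr.wp, Operand.eval, Cond.Holds, e₀, e₁, e₂]
      refine ⟨by omega, by omega, fun hlt => ⟨by omega, by omega, by omega, by omega,
        ht.size, e₂, rfl, hcell _ (if_pos hlt).symm⟩, fun hge => ⟨by omega, by omega, by omega,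
        ht.size, e₂, rfl, hcell _ (if_neg (by omega)).symm⟩⟩

theorem solveInserted_achieves {S : BicoloredPoints N} {n : ℕ} (hm : 2 * N + 4 ≤ m) (hN : 3 ≤ N)
    (hr : S.red.card = n + 1) (hb : S.blue.card = n) {q r r' : ℕ} (hq : q < N) (hrN : r < N)
    (hqr : (r = q ∧ r' = (q + 1) % N) ∨ (r' = q ∧ r = (q + 1) % N))
    {s : State} (h₀ : s.ivar 0 = N) (h₁ : s.ivar 1 = r) (h₂ : s.ivar 2 = r')
    (h₃ : ∀ j, s.iarr 0 j ≤ 1) (h₃' : ∀ j, j < N → s.iarr 0 j = if S.color j then 0 else 1)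
    (h₄ : s.iarr 2 = fun _ => 0) (h₅ : s.iarr 3 = fun _ => 0) :
    solveInserted.Achieves m (200 * N + 300) s fun s' => ∃ O : ℕ → ℕ,
      IsSolution (S.insertColor q) (N + 1) (insertIndex q r) (q + 1) ((List.range (N + 1)).map O) ∧
        ∀ j, j < N → s'.iarr 1 j = if q < O j then O j - 1 else O j := by
  have hcost : locate.cost + (N * (shiftBody.cost + 1) + 1 + (adjust.cost + (solveCost (N + 1) +
      (restoreInit.cost + (N * (restoreBody.cost + 1) + 1))))) ≤ 200 * N + 300 := by
    have := solveCost_le (N + 1)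
    simp only [locate, shiftBody, adjust, restoreInit, restoreBody, block, cost]
    omega
  refine Achieves.mono ?_ hcost fun _ => id
  refine (locate_achieves (A := s.iarr 0) (by omega) hN hq hqr h₀ h₁ h₂ rfl h₄ h₅).seq
    fun s₁ hs₁ => ?_
  refine (shift_achieves (by omega) hq h₃ hs₁).seq fun s₂ hs₂ => ?_
  refine (adjust_achieves (by omega) hq hrN h₃' hs₂).seq fun s₃ hs₃ => ?_
  obtain ⟨a₁, a₂, a₃⟩ := hs₃
  have hlt : insertIndex q r < N + 1 := by unfold insertIndex; split_ifs <;> omega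
  refine (solve_achieves (by omega) (by omega) hlt (height_insertColor hq hr hb) a₁ a₂ a₃).seq
    fun s₄ hs₄ => ?_
  obtain ⟨b₁, b₂⟩ := hs₄
  have hO : ∀ j, j < N → s₄.iarr 1 j ≤ N := by
    intro j hj
    have := b₁.best.perm.mem_iff.1 (List.mem_map_of_mem (f := s₄.iarr 1)
      (List.mem_range.2 (show j < N + 1 by omega)))
    rw [List.mem_range] at this
    omega
  refine (restore_achieves (by omega) b₂.size b₂.spare hO).mono le_rfl fun s₅ hs₅ => ?_
  refine ⟨_, b₁, fun j hj => ?_⟩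
  rw [hs₅.cells j, if_pos hj]

end RealRAM

/-! ## The theorem -/

namespace BicoloredPoints

open RealRAM Chord

variable {N : ℕ} {S : BicoloredPoints N}

theorem input_colors (S : BicoloredPoints N) (a b k : ℕ) (hk : k < N) :
    (S.input a b).iarr 0 k = if S.color k then 0 else 1 := by
  simp only [input, color, hk, dif_pos, true_and]
  cases S.isRed ⟨k, hk⟩ <;> rfl

theorem input_colors_le (S : BicoloredPoints N) (a b k : ℕ) : (S.input a b).iarr 0 k ≤ 1 := by
  simp only [input]
  split_ifs <;> omega

theorem input_iarr_of_ne (S : BicoloredPoints N) (a b : ℕ) {B : ℕ} (hB : B ≠ 0) :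
    (S.input a b).iarr B = fun _ => 0 := by
  funext k
  simp [input, hB]

theorem input_data (S : BicoloredPoints N) (a b : ℕ) : Data S.color N a b 0 (S.input a b) :=
  ⟨rfl, rfl, rfl, rfl, fun k hk => S.input_colors a b k hk⟩

theorem input_achieves {n : ℕ} (hn : 2 ≤ n) (hr : S.red.card = n) (hb : S.blue.card = n) {a b : ℕ}
    (ha : a < N) : solve.Achieves (1000 * n) (1000 * n) (S.input a b) fun s =>
      IsSolution S.color N a b ((List.range N).map (s.iarr 1)) := by
  have hN := S.card_red_add_card_blue
  have hc := solveCost_le N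
  exact (solve_achieves (by omega) (by omega) ha (height_color hr hb) (S.input_data a b)
    (S.input_iarr_of_ne a b (by norm_num)) (S.input_iarr_of_ne a b (by norm_num))).mono
    (by omega) fun s hs => hs.1

theorem insertIndex_inv (q i : ℕ) :
    (if q < insertIndex q i then insertIndex q i - 1 else insertIndex q i) = i := by
  unfold insertIndex
  split_ifs <;> omega

theorem exists_predecessor {r r' : Fin N} (h : Consecutive r r') : ∃ q, q < N ∧
    (((r : ℕ) = q ∧ (r' : ℕ) = (q + 1) % N) ∨ ((r' : ℕ) = q ∧ (r : ℕ) = (q + 1) % N)) := by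
  rcases h with h | h
  · exact ⟨r, r.2, Or.inl ⟨rfl, h⟩⟩
  · exact ⟨r', r'.2, Or.inr ⟨rfl, h⟩⟩

theorem ne_of_consecutive (hN : 2 ≤ N) {r r' : Fin N} (h : Consecutive r r') : r ≠ r' := by
  have key : ∀ i : Fin N, ¬ IsNext i i := by
    intro i hi
    have := i.2
    unfold IsNext at hi
    rcases Nat.lt_or_ge ((i : ℕ) + 1) N with hlt | hge
    · rw [Nat.mod_eq_of_lt hlt] at hi; omega
    · rw [show (i : ℕ) + 1 = N by omega, Nat.mod_self] at hi; omega
  rintro rfl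
  rcases h with h | h <;> exact key _ h

end BicoloredPoints

open BicoloredPoints RealRAM Chord in
theorem theorem5 :
    -- cycles, with as many red as blue points
    ((∃ (P : RealRAM.Program) (C : ℕ), ∀ (n N : ℕ) (S : BicoloredPoints N),
        2 ≤ n → S.ConvexPosition → S.ClockwiseOrder → S.red.card = n → S.blue.card = n →
        P.Achieves (C * n) (C * n) (S.input 0 0) fun s =>
          ∃ (u : Fin N) (w : S.bichromatic.Walk u u), S.IsOptimumCycle w ∧ S.Outputs s w) ∧
      (∀ (n N : ℕ) (S : BicoloredPoints N),
        2 ≤ n → S.ConvexPosition → S.ClockwiseOrder → S.red.card = n → S.blue.card = n →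
        ∀ (u : Fin N) (w : S.bichromatic.Walk u u),
          S.IsOptimumCycle w → S.OnePlane w.edgeSet)) ∧
    -- paths between consecutive points of different colors
    ((∃ (P : RealRAM.Program) (C : ℕ), ∀ (n N : ℕ) (S : BicoloredPoints N) (r b : Fin N),
        2 ≤ n → S.ConvexPosition → S.ClockwiseOrder → S.red.card = n → S.blue.card = n →
        r ∈ S.red → b ∈ S.blue → BicoloredPoints.Consecutive r b →
        P.Achieves (C * n) (C * n) (S.input r b) fun s =>
          ∃ w : S.bichromatic.Walk r b, S.IsOptimumPath w ∧ S.Outputs s w) ∧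
      (∀ (n N : ℕ) (S : BicoloredPoints N) (r b : Fin N),
        2 ≤ n → S.ConvexPosition → S.ClockwiseOrder → S.red.card = n → S.blue.card = n →
        r ∈ S.red → b ∈ S.blue → BicoloredPoints.Consecutive r b →
        ∀ w : S.bichromatic.Walk r b, S.IsOptimumPath w → S.OnePlane w.edgeSet)) ∧
    -- paths between consecutive red points, with one more red than blue points
    ((∃ (P : RealRAM.Program) (C : ℕ), ∀ (n N : ℕ) (S : BicoloredPoints N) (r r' : Fin N),
        1 ≤ n → S.ConvexPosition → S.ClockwiseOrder → S.red.card = n + 1 → S.blue.card = n →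
        r ∈ S.red → r' ∈ S.red → BicoloredPoints.Consecutive r r' →
        P.Achieves (C * n) (C * n) (S.input r r') fun s =>
          ∃ w : S.bichromatic.Walk r r', S.IsOptimumPath w ∧ S.Outputs s w) ∧
      (∀ (n N : ℕ) (S : BicoloredPoints N) (r r' : Fin N),
        1 ≤ n → S.ConvexPosition → S.ClockwiseOrder → S.red.card = n + 1 → S.blue.card = n →
        r ∈ S.red → r' ∈ S.red → BicoloredPoints.Consecutive r r' →
        ∀ w : S.bichromatic.Walk r r', S.IsOptimumPath w → S.OnePlane w.edgeSet)) := by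
  -- With `N = 2 * n`, the cost is at most `200 * n + 100`; with `N = 2 * n + 1`, it is at most `400
  -- * n + 500`. The constants also cover the machine sizes `2 * N + 2` and `2 * N + 4`.
  refine ⟨⟨⟨solve, 1000, ?_⟩, ?_⟩, ⟨⟨solve, 1000, ?_⟩, ?_⟩, ⟨solveInserted, 2000, ?_⟩, ?_⟩
  · intro n N S hn _ hS hr hb
    have hN := S.card_red_add_card_blue
    refine (input_achieves hn hr hb (by omega)).mono le_rfl fun s hs => ?_
    obtain ⟨u, w, hw, hwc⟩ := exists_optimumCycle hS S.color_val (by omega) hs.best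
    -- The support of the closed walk has one entry more than the output, the repeated base point.
    refine ⟨u, w, hw, outputs_of_support (l := [(u : ℕ)]) ?_⟩
    have hnil := hw.1.isCycle.not_nil
    have e : w.support.dropLast ++ [u] = w.support := by
      rw [← SimpleGraph.Walk.support_dropLast hnil, SimpleGraph.Walk.support_dropLast_concat hnil]
    rw [← hwc, ← e, List.map_append, List.dropLast_concat]
    rfl
  · intro n N S hn _ hS hr hb u w hw
    have hN := S.card_red_add_card_blue
    obtain ⟨c, hc⟩ := exists_isSolution (height_color hr hb) (by omega) (show 0 < N by omega) 0
    exact onePlane_of_isOptimumCycle hS S.color_val (by omega) hc.best hw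
  · intro n N S r b hn _ hS hr hb hrr hbb hcons
    have hrb : S.isRed r ≠ S.isRed b := by
      rw [(Finset.mem_filter.1 hrr).2, (Finset.mem_filter.1 hbb).2]; simp
    refine (input_achieves hn hr hb r.2).mono le_rfl fun s hs => ?_
    obtain ⟨w, hw, hwc⟩ := exists_optimumPath hS S.color_val hrb hcons hs
    exact ⟨w, hw, outputs_of_support (l := []) (by rw [hwc, List.append_nil])⟩
  · intro n N S r b hn _ hS hr hb hrr hbb hcons w hw
    have hrb : S.isRed r ≠ S.isRed b := by
      rw [(Finset.mem_filter.1 hrr).2, (Finset.mem_filter.1 hbb).2]; simp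
    have hN := S.card_red_add_card_blue
    obtain ⟨c, hc⟩ := exists_isSolution (height_color hr hb) (by omega) r.2 b
    exact onePlane_of_isOptimumPath hS S.color_val hrb hcons hc hw
  · intro n N S r r' hn _ hS hr hb hrr hrr' hcons
    have hN := S.card_red_add_card_blue
    obtain ⟨q, hq, hqr⟩ := exists_predecessor hcons
    have hX := isExtension hq (Finset.mem_filter.1 hrr).2 (Finset.mem_filter.1 hrr').2
      (ne_of_consecutive (by omega) hcons) hqr
    refine (solveInserted_achieves (S := S) (by omega) (by omega) hr hb hq r.2 hqr rfl rfl rfl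
      (S.input_colors_le r r') (S.input_colors r r') (S.input_iarr_of_ne r r' (by norm_num))
      (S.input_iarr_of_ne r r' (by norm_num))).mono (by omega) fun s hs => ?_
    obtain ⟨O, hO, hsO⟩ := hs
    obtain ⟨w, hw, hwc⟩ := hX.exists_optimumPath hS hO
    refine ⟨w, hw, outputs_of_support (l := []) ?_⟩
    rw [List.range_succ, List.map_append] at hwc
    -- The tour ends with the inserted point. Dropping it and undoing the shift of the indices gives
    -- the output.
    have e := (List.append_inj_left' hwc rfl)
    have e' := congrArg (List.map fun x => if q < x then x - 1 else x) e
    rw [List.map_map, List.map_map] at e'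
    rw [List.append_nil]
    refine Eq.trans ?_ (e'.trans ?_)
    · exact List.map_congr_left fun i _ => (insertIndex_inv q i).symm
    · exact List.map_congr_left fun j hj => (hsO j (List.mem_range.1 hj)).symm
  · intro n N S r r' hn _ hS hr hb hrr hrr' hcons w hw
    have hN := S.card_red_add_card_blue
    obtain ⟨q, hq, hqr⟩ := exists_predecessor hcons
    have hX := isExtension hq (Finset.mem_filter.1 hrr).2 (Finset.mem_filter.1 hrr').2
      (ne_of_consecutive (by omega) hcons) hqr
    obtain ⟨c, hc⟩ := exists_isSolution (height_insertColor hq hr hb) (by omega) (hX.lt r) (q + 1)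
    exact hX.onePlane hS hc hw
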